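/- Fix $p\in\mathbb N$. For $\beta=(\beta_0,\dots,\beta_{p+1})\in\mathbb R^{p+2}$, $N\in\mathbb R$ and $x=(x_1,\dots,x_p)$ put $x_{p+1}=N$. Write $(a)_m=a(a+1)\cdots(a+m-1)$. For $n\in\mathbb N_0^p$ put $|n|=n_1+\dots+n_p$, $N_1^j=n_1+\dots+n_j$, and let $$r_m(a,b,c,d;y)=(a+1)_m(b+d+1)_m(c+1)_m\;{}_4F_3\!\left[\begin{matrix}-m,\ m+a+b+1,\ -y,\ y+c+d+1\\ a+1,\ b+d+1,\ c+1\end{matrix};1\right]$$ (a polynomial in all its parameters, the denominators cancelling), $$R_p(n;x;\beta;N)=\prod_{k=1}^p r_{n_k}\big(2N_1^{k-1}+\beta_k-\beta_0-1,\ \beta_{k+1}-\beta_k-1,\ N_1^{k-1}-x_{k+1}-1,\ N_1^{k-1}+\beta_k+x_{k+1};\ -N_1^{k-1}+x_k\big),$$ $$\hat R_p(n;x;\beta;N)=\frac{R_p(n;x;\beta;N)}{(-N)_{|n|}(-N-\beta_0)_{|n|}\prod_{k=1}^p(\beta_{k+1}-\beta_k)_{n_k}}\quad\text{whenever the denominator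 is nonzero.}$$ Operators in $x$. Let $\mathcal D_x$ be the algebra of difference operators $\sum_\nu l_\nu E_x^\nu$ (finite sums over $\nu\in\mathbb Z^p$, with $E_x^\nu g(x)=g(x+\nu)E_x^\nu$) whose coefficients are real rational functions of $x,\beta,N$. Let $\triangle_i=E_{x_i}-1$, $\nabla_i=1-E_{x_i}^{-1}$, and let $I_i$ be the substitution $x_i\mapsto -x_i-\beta_i$. For $1\le j\le p$ and $\nu\in\{0,1\}^j\setminus\{0\}$ with nonzero components at $i_1<\dots<i_s$, set $$A^{(j)}_\nu=(x_{i_1}+\beta_{i_1}-\beta_0)(x_{i_1}+\beta_{i_1})\frac{\prod_{k=2}^s(x_{i_k}+x_{i_{k-1}}+\beta_{i_k})(x_{i_k}+x_{i_{k-1}}+\beta_{i_k}+1)}{\prod_{k=1}^s(2x_{i_k}+\beta_{i_k})(2x_{i_k}+\beta_{i_k}+1)}(x_{i_s}+\beta_{j+1}+x_{j+1})(x_{j+1}-x_{i_s}).$$ For $\nu\in\{-1,0,1\}^j\setminus\{0\}$ with positive and negative parts $\nu^\pm$, let $A^{(j)}_\nu$ be obtained from $A^{(j)}_{\nu^++\nu^-}$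 by applying $I_i$ for all $i$ with $\nu_i=-1$. Let $$\mathfrak L^x_j=\sum_{\nu\in\{-1,0,1\}^j\setminus\{0\}}(-1)^{|\nu^-|}A^{(j)}_\nu\triangle^{\nu^+}\nabla^{\nu^-},\qquad \mathcal A_x=\mathbb R[\mathfrak L^x_1,\dots,\mathfrak L^x_p]\subset\mathcal D_x .$$ Operators in $n$. Let $\mathcal D_n$ be the analogous algebra of difference operators in $n_1,\dots,n_p$, and let $\mathfrak b:\mathcal D_x\to\mathcal D_n$ be the isomorphism with $\mathfrak b(N)=N$, $\mathfrak b(\beta_0)=\beta_0$, $\mathfrak b(\beta_k)=\beta_0-\beta_{p+2-k}-2N+1$ ($1\le k\le p+1$), $\mathfrak b(x_k)=n_1+\dots+n_{p+1-k}+\beta_{p+2-k}-\beta_0+N-1$ and $\mathfrak b(E_{x_k})=E_{n_{p+1-k}}E_{n_{p+2-k}}^{-1}$ ($1\le k\le p$, $E_{n_{p+1}}=1$). Put $\mathfrak L^n_j=\mathfrak b(\mathfrak L^x_j)$ and $\mathcal A_n=\mathfrak b(\mathcal A_x)$. Finally let $$\mu_j(n)=-N_1^j\,(N_1^j-1+\beta_{j+1}-\beta_0),\qquad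 \kappa_j(x)=-x_{p+1-j}(x_{p+1-j}+\beta_{p+1-j})+N(N+\beta_{p+1-j}).$$ **Theorem.** 1. $\mathcal A_x$ and $\mathcal A_n$ are commutative, and $\mathcal A_n$ is generated by $\mathfrak L^n_1,\dots,\mathfrak L^n_p$. Whenever the normalizing denominator of $\hat R_p(n;x;\beta;N)$ is nonzero, $\hat R_p(n;x;\beta;N)$ is not identically zero in $x$. 2. If the normalizing denominator of $\hat R_p(n;x;\beta;N)$ is nonzero, then for $1\le j\le p$ $$\mathfrak L^x_j\,\hat R_p(n;x;\beta;N)=\mu_j(n)\,\hat R_p(n;x;\beta;N)$$ at every $x\in\mathbb R^p$ with $2x_i+\beta_i\notin\{0,1,-1\}$ for $i\le j$; at such points all coefficients of $\mathfrak L^x_j$ are defined. 3. Let $\beta$ be such that $\beta_{k}-\beta_{k+1}\notin\mathbb N_0$ for $1\le k\le p$, and let $n\in\mathbb N_0^p$ and $1\le j\le p$ be such that $2N_1^i+\beta_{i+1}-\beta_0-1\notin\{0,1,-1\}$ for $p+1-j\le i\le p$. Then at $n$ all coefficients of $\mathfrak L^n_j$ are defined, and the coefficient of $E_n^\nu$ vanishes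 if $n+\nu\notin\mathbb N_0^p$. If $N\ne m$ and $N+\beta_0\neq m$ for all integers $0\le m\le|n|$, then for all $x\in\mathbb R^p$ $$\mathfrak L^n_j\,\hat R_p(n;x;\beta;N)=\kappa_j(x)\,\hat R_p(n;x;\beta;N).$$ If this is only assumed for $0\le m<|n|$ (which for $N\in\mathbb N_0$ allows $|n|\le N$, and in particular $|n|=N$), the equation holds in the limit: on the left-hand side at $n$, with $N$ replaced by $N'$, every term has a finite limit as $N'\to N$, $N'\ne N$, and the sum of these limits is $\kappa_j(x)\hat R_p(n;x;\beta;N)$. 4. Every $L\in\mathcal A_x$ is diagonalized: its coefficients are defined at $(x,\beta,N)$ if $2x_i+\beta_i\notin\mathbb Z$ for all $i$, and there is a function $\mu_L(n,\beta,N)$, independent of $x$, with $L\hat R_p=\mu_L\hat R_p$ at all points where the coefficients of $L$ are defined and the normalizing denominator is nonzero. Every $L\in\mathcal A_n$ is diagonalized: its coefficients are defined at $(n,\beta,N)$, $n\in\mathbb N_0^p$, if $\beta_{i+1}-\beta_0\notin\mathbb Z$ for $1\le i\le p$, and there is a function $\kappa_L(x,\beta,N)$, independent of $n$, such that, whenever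 $\beta_k-\beta_{k+1}\notin\mathbb N_0$ for $1\le k\le p$ and the coefficients of $L$ are defined at $(n,\beta,N)$, one has $L\hat R_p=\kappa_L\hat R_p$ at $n$ if $N,\,N+\beta_0\notin\mathbb N_0$, and in the limit sense of part 3 if $N\ne m$ and $N+\beta_0\ne m$ for all integers $0\le m<|n|$. (When $L$ acts on functions of $n$, $\hat R_p$ is set equal to $0$ outside $\mathbb N_0^p$.) -/

import Mathlib

open Filter Topology

noncomputable section

namespace Racah

/-! ### Rational functions of the position variables and the parameters -/

/-- Index set of the indeterminates: `pos i` is the position variable number `i + 1`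
(`x_{i+1}` on the `x`-side, `n_{i+1}` on the `n`-side), `par k` is the parameter `β_k`
(`k = 0, …, p + 1`), and `size` is the parameter `N`. -/
inductive Ind (p : ℕ) : Type
  | pos (i : Fin p) : Ind p
  | par (k : Fin (p + 2)) : Ind p
  | size : Ind p

/-- Polynomials with real coefficients in the positions, `β` and `N`. -/
abbrev Poly (p : ℕ) : Type := MvPolynomial (Ind p) ℝ

/-- Rational functions with real coefficients in the positions, `β` and `N`. -/
abbrev RatFun (p : ℕ) : Type := FractionRing (Poly p)

/-- The group `ℤ^p` of shifts, written multiplicatively: `E^ν`. -/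
abbrev Shift (p : ℕ) : Type := Multiplicative (Fin p → ℤ)

/-- The position indeterminates, as rational functions. -/
def posVar {p : ℕ} (i : Fin p) : RatFun p := algebraMap (Poly p) (RatFun p) (MvPolynomial.X (Ind.pos i))
/-- The parameter indeterminates `β_k`, as rational functions. -/
def parVar {p : ℕ} (k : Fin (p + 2)) : RatFun p :=
  algebraMap (Poly p) (RatFun p) (MvPolynomial.X (Ind.par k))
/-- The parameter indeterminate `N`, as a rational function. -/
def sizeVar {p : ℕ} : RatFun p := algebraMap (Poly p) (RatFun p) (MvPolynomial.X Ind.size)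

/-- Images of the indeterminates under the shift of the positions by `ν`. -/
def shiftImage {p : ℕ} (ν : Fin p → ℤ) : Ind p → Poly p
  | .pos i => MvPolynomial.X (Ind.pos i) + MvPolynomial.C (ν i : ℝ)
  | .par k => MvPolynomial.X (Ind.par k)
  | .size => MvPolynomial.X Ind.size

theorem aeval_shiftImage_comp {p : ℕ} (ν μ : Fin p → ℤ) :
    (MvPolynomial.aeval (shiftImage ν)).comp (MvPolynomial.aeval (shiftImage μ)) =
      MvPolynomial.aeval (R := ℝ) (shiftImage (ν + μ)) := by
  apply MvPolynomial.algHom_ext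
  rintro (i | k | _)
  · simp [shiftImage, add_assoc]
  · simp [shiftImage]
  · simp [shiftImage]

theorem aeval_shiftImage_zero {p : ℕ} :
    MvPolynomial.aeval (R := ℝ) (shiftImage (0 : Fin p → ℤ)) = AlgHom.id ℝ (Poly p) := by
  apply MvPolynomial.algHom_ext
  rintro (i | k | _) <;> simp [shiftImage]

/-- The automorphism `f(x) ↦ f(x + ν)` of the polynomial ring. -/
def shiftPoly (p : ℕ) : Shift p →* (Poly p ≃ₐ[ℝ] Poly p) where
  toFun ν := AlgEquiv.ofAlgHom (MvPolynomial.aeval (shiftImage ν.toAdd))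
    (MvPolynomial.aeval (shiftImage (-ν.toAdd)))
    (by rw [aeval_shiftImage_comp, add_neg_cancel, aeval_shiftImage_zero])
    (by rw [aeval_shiftImage_comp, neg_add_cancel, aeval_shiftImage_zero])
  map_one' := by
    ext1 f
    exact DFunLike.congr_fun aeval_shiftImage_zero f
  map_mul' ν μ := by
    ext1 f
    exact (DFunLike.congr_fun (aeval_shiftImage_comp ν.toAdd μ.toAdd) f).symm

/-- The automorphism `f(x) ↦ f(x + ν)` of the field of rational functions. -/
def shiftRat (p : ℕ) : Shift p →* (RatFun p ≃ₐ[ℝ] RatFun p) where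
  toFun ν := IsFractionRing.algEquivOfAlgEquiv (shiftPoly p ν)
  map_one' := by
    ext x
    obtain ⟨a, b, -, rfl⟩ := IsFractionRing.div_surjective (Poly p) x
    simp
  map_mul' ν μ := by
    ext x
    obtain ⟨a, b, -, rfl⟩ := IsFractionRing.div_surjective (Poly p) x
    simp

instance (p : ℕ) : MulSemiringAction (Shift p) (RatFun p) :=
  MulSemiringAction.compHom (RatFun p) (shiftRat p)

theorem shift_smul_def {p : ℕ} (ν : Shift p) (f : RatFun p) : ν • f = shiftRat p ν f := rfl

instance (p : ℕ) : SMulCommClass (Shift p) ℝ (RatFun p) :=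
  ⟨fun ν r f => by
    simp only [shift_smul_def, Algebra.smul_def, map_mul, AlgEquiv.commutes]⟩

/-- The algebra of difference operators `∑_ν l_ν E^ν` (finite sums), with coefficients `l_ν`
depending rationally on the positions and on the parameters, and the commutation rule
`E^ν · g(x) = g(x + ν) E^ν`.  For an operator acting in `x` the positions are `x_1, …, x_p`;
for an operator acting in `n` they are `n_1, …, n_p`. -/
abbrev DiffOp (p : ℕ) : Type := SkewMonoidAlgebra (RatFun p) (Shift p)

/-- Multiplication by a rational function, as a difference operator. -/
def mulOp {p : ℕ} : RatFun p →ₐ[ℝ] DiffOp p where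
  __ := SkewMonoidAlgebra.singleOneRingHom
  commutes' _ := rfl

/-- The shift operator `E^ν`. -/
def shiftOp {p : ℕ} : Shift p →* DiffOp p := SkewMonoidAlgebra.of (RatFun p) (Shift p)

theorem shiftOp_mul_mulOp {p : ℕ} (ν : Shift p) (f : RatFun p) :
    shiftOp ν * mulOp f = mulOp (ν • f) * shiftOp ν := by
  change SkewMonoidAlgebra.single ν 1 * SkewMonoidAlgebra.single 1 f =
    SkewMonoidAlgebra.single 1 (ν • f) * SkewMonoidAlgebra.single ν 1
  simp [SkewMonoidAlgebra.single_mul_single]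

/-! ### Evaluation at real points -/

/-- The real point with positions `x` and parameters `β`, `N`. -/
def point {p : ℕ} (x : Fin p → ℝ) (β : Fin (p + 2) → ℝ) (N : ℝ) : Ind p → ℝ
  | .pos i => x i
  | .par k => β k
  | .size => N

/-- A rational function is defined at `v` if its reduced denominator does not vanish there. -/
def RatDefinedAt {p : ℕ} (v : Ind p → ℝ) (f : RatFun p) : Prop :=
  MvPolynomial.eval v (IsFractionRing.den (Poly p) f : Poly p) ≠ 0

/-- The value of a rational function at `v` (meaningful when `RatDefinedAt v f`). -/
def ratValue {p : ℕ} (v : Ind p → ℝ) (f : RatFun p) : ℝ :=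
  MvPolynomial.eval v (IsFractionRing.num (Poly p) f) /
    MvPolynomial.eval v (IsFractionRing.den (Poly p) f : Poly p)

/-- All the coefficients of `L` are defined at `v`. -/
def DefinedAt {p : ℕ} (v : Ind p → ℝ) (L : DiffOp p) : Prop :=
  ∀ ν ∈ L.support, RatDefinedAt v (L.coeff ν)

/-- A fraction whose denominator does not vanish at `v` is defined at `v`, with the value
computed from that fraction. -/
theorem ratValue_div {p : ℕ} (v : Ind p → ℝ) (a b : Poly p) (hb : MvPolynomial.eval v b ≠ 0) :
    RatDefinedAt v (algebraMap (Poly p) (RatFun p) a / algebraMap (Poly p) (RatFun p) b) ∧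
      ratValue v (algebraMap (Poly p) (RatFun p) a / algebraMap (Poly p) (RatFun p) b) =
        MvPolynomial.eval v a / MvPolynomial.eval v b := by
  set f := algebraMap (Poly p) (RatFun p) a / algebraMap (Poly p) (RatFun p) b with hf
  have hb0 : b ≠ 0 := by rintro rfl; simp at hb
  have key : IsFractionRing.num (Poly p) f * b = a * (IsFractionRing.den (Poly p) f : Poly p) := by
    have h1 : algebraMap (Poly p) (RatFun p) (IsFractionRing.num (Poly p) f) /
        algebraMap (Poly p) (RatFun p) (IsFractionRing.den (Poly p) f : Poly p) = f :=
      (IsFractionRing.mk'_eq_div _).symm.trans (IsFractionRing.mk'_num_den (Poly p) f)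
    have hb1 : algebraMap (Poly p) (RatFun p) b ≠ 0 := by
      simpa using hb0
    have hd1 : algebraMap (Poly p) (RatFun p) (IsFractionRing.den (Poly p) f : Poly p) ≠ 0 := by
      simp
    rw [hf] at h1
    rw [← hf, div_eq_div_iff hd1 hb1] at h1
    apply IsFractionRing.injective (Poly p) (RatFun p)
    simpa using h1
  have hdvd : (IsFractionRing.den (Poly p) f : Poly p) ∣ b := by
    have hrel := IsFractionRing.num_den_reduced (Poly p) f
    exact (hrel.symm).dvd_of_dvd_mul_left ⟨a, by rw [key, mul_comm]⟩
  have hd : MvPolynomial.eval v (IsFractionRing.den (Poly p) f : Poly p) ≠ 0 := by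
    obtain ⟨c, hc⟩ := hdvd
    intro h
    apply hb
    rw [hc, map_mul, h, zero_mul]
  refine ⟨hd, ?_⟩
  rw [ratValue, div_eq_div_iff hd hb, ← map_mul, ← map_mul, key]

/-- The action on functions of `x` of a difference operator in `x`, with real parameters. -/
def actX {p : ℕ} (L : DiffOp p) (β : Fin (p + 2) → ℝ) (N : ℝ) (f : (Fin p → ℝ) → ℝ)
    (x : Fin p → ℝ) : ℝ :=
  ∑ ν ∈ L.support, ratValue (point x β N) (L.coeff ν) * f (fun i => x i + (ν.toAdd i : ℝ))

/-- The coefficient of `E^ν`, at the integer point `n`, of a difference operator in `n`,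
with real parameters. -/
def coeffN {p : ℕ} (L : DiffOp p) (β : Fin (p + 2) → ℝ) (N : ℝ) (n : Fin p → ℤ)
    (ν : Shift p) : ℝ :=
  ratValue (point (fun i => (n i : ℝ)) β N) (L.coeff ν)

/-- The action on functions of `n ∈ ℤ^p` of a difference operator in `n`, with real
parameters. -/
def actN {p : ℕ} (L : DiffOp p) (β : Fin (p + 2) → ℝ) (N : ℝ) (g : (Fin p → ℤ) → ℝ)
    (n : Fin p → ℤ) : ℝ :=
  ∑ ν ∈ L.support, coeffN L β N n ν * g (n + ν.toAdd)

/-! ### The operators acting in `x` -/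

/-- `x_0 = 0, x_1, …, x_p, x_{p+1} = N`. -/
def extPos {p : ℕ} {F : Type*} [Zero F] (x : Fin p → F) (N : F) : Fin (p + 2) → F :=
  Fin.cons 0 (Fin.snoc (α := fun _ => F) x N)

/-- The coefficient `A_ν` for `ν ∈ {0,1}^p ∖ {0}`, where `l` lists the indices of the nonzero
components of `ν` in increasing order, `y i` stands for the position and `b i` for the parameter
`β` with the same index as `y i`, and `b0`, `bEnd`, `M` play the roles of
`β_0`, `β_{p+1}`, `N`. -/
def coefA {p : ℕ} {F : Type*} [Field F] (y b : Fin p → F) (b0 bEnd M : F) : List (Fin p) → F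
  | [] => 0
  | a :: t =>
    let z := (a :: t).getLast (List.cons_ne_nil a t)
    (y a + b a - b0) * (y a + b a) *
      ((((a :: t).zip t).map fun q =>
          (y q.2 + y q.1 + b q.2) * (y q.2 + y q.1 + b q.2 + 1)).prod /
        ((a :: t).map fun i => (2 * y i + b i) * (2 * y i + b i + 1)).prod) *
      ((y z + bEnd + M) * (M - y z))

/-- The values of the positions after the involutions `x_i ↦ -x_i - β_i` for all `i` with
`ν_i = -1`. -/
def reflect {p : ℕ} {F : Type*} [Field F] (ν : Fin p → SignType) (y b : Fin p → F) : Fin p → F :=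
  fun i => if ν i = -1 then -y i - b i else y i

/-- `A_ν = I^{ν⁻}(A_{ν⁺ + ν⁻})` for `ν ∈ {-1,0,1}^p`. -/
def coefSigned {p : ℕ} {F : Type*} [Field F] (ν : Fin p → SignType) (y b : Fin p → F)
    (b0 bEnd M : F) : F :=
  coefA (reflect ν y b) b b0 bEnd M ((List.finRange p).filter fun i => ν i ≠ 0)

/-- `E_i^k`. -/
def singleShift {p : ℕ} (i : Fin p) (k : ℤ) : DiffOp p :=
  shiftOp (Multiplicative.ofAdd (Pi.single i k))

/-- The forward difference `△_i = E_i - 1` if `s = 1`, the backward difference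
`∇_i = 1 - E_i⁻¹` if `s = -1`, and `1` if `s = 0`. -/
def signDiff {p : ℕ} (i : Fin p) : SignType → DiffOp p
  | .pos => singleShift i 1 - 1
  | .neg => 1 - singleShift i (-1)
  | .zero => 1

/-- `△^{ν⁺} ∇^{ν⁻}`. -/
def diffProd {p : ℕ} (ν : Fin p → SignType) : DiffOp p :=
  ((List.finRange p).map fun i => signDiff i (ν i)).prod

/-- The operator `𝔏^x_{j+1} = 𝓛_{j+1}(x_1, …, x_{j+1}; β_0, …, β_{j+2}; x_{j+2})`,
with `x_{p+1} = N`, where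
`𝓛_m = ∑_{ν ∈ {-1,0,1}^m ∖ {0}} (-1)^{|ν⁻|} A_ν △^{ν⁺} ∇^{ν⁻}`;
the multi-indices `ν ∈ {-1,0,1}^{j+1}` are extended by `0` to `{-1,0,1}^p`. -/
def opX {p : ℕ} (j : Fin p) : DiffOp p :=
  ∑ ν : Fin p → SignType with ν ≠ 0 ∧ ∀ i, j < i → ν i = 0,
    mulOp ((-1) ^ (Finset.univ.filter fun i => ν i = -1).card *
      coefSigned ν posVar (fun i => parVar i.castSucc.succ) (parVar 0) (parVar j.succ.succ)
        (extPos posVar sizeVar j.succ.succ)) * diffProd ν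

/-- `𝓐_x`, the algebra generated by the operators `𝔏^x_1, …, 𝔏^x_p`. -/
def algX (p : ℕ) : Subalgebra ℝ (DiffOp p) := Algebra.adjoin ℝ (Set.range opX)

/-! ### The isomorphism `𝔟` and the operators acting in `n` -/

/-- The sequence of differences `a_0, a_1 - a_0, a_2 - a_1, …`. -/
def diffs {p : ℕ} {M : Type*} [AddCommGroup M] (a : Fin p → M) (i : Fin p) : M :=
  a i - if h : i.val = 0 then 0 else a ⟨i.val - 1, by omega⟩

/-- The sequence of partial sums `a_0, a_0 + a_1, …`. -/
def psum {p : ℕ} {M : Type*} [AddCommMonoid M] (a : Fin p → M) (i : Fin p) : M :=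
  ∑ l ∈ Finset.univ.filter (fun l => l ≤ i), a l

theorem psum_zero {p : ℕ} {M : Type*} [AddCommMonoid M] (a : Fin p → M) (h : 0 < p) :
    psum a ⟨0, h⟩ = a ⟨0, h⟩ := by
  have : (Finset.univ.filter fun l : Fin p => l ≤ ⟨0, h⟩) = {⟨0, h⟩} := by
    ext l; simp [Fin.le_def, Fin.ext_iff]
  rw [psum, this, Finset.sum_singleton]

theorem psum_succ {p : ℕ} {M : Type*} [AddCommMonoid M] (a : Fin p → M) (k : ℕ) (h : k + 1 < p) :
    psum a ⟨k + 1, h⟩ = psum a ⟨k, by omega⟩ + a ⟨k + 1, h⟩ := by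
  have : (Finset.univ.filter fun l : Fin p => l ≤ ⟨k + 1, h⟩) =
      insert ⟨k + 1, h⟩ (Finset.univ.filter fun l : Fin p => l ≤ ⟨k, by omega⟩) := by
    ext l; simp [Fin.le_def, Fin.ext_iff]; omega
  rw [psum, this, Finset.sum_insert (by simp), add_comm, psum]

theorem psum_diffs {p : ℕ} {M : Type*} [AddCommGroup M] (a : Fin p → M) : psum (diffs a) = a := by
  ext ⟨k, hk⟩
  induction k with
  | zero => rw [psum_zero]; simp [diffs]
  | succ k ih => rw [psum_succ, ih (by omega)]; simp [diffs]

theorem diffs_psum {p : ℕ} {M : Type*} [AddCommGroup M] (a : Fin p → M) : diffs (psum a) = a := by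
  ext ⟨k, hk⟩
  cases k with
  | zero => simp [diffs, psum_zero]
  | succ k => simp [diffs, psum_succ]

theorem map_psum {p : ℕ} {M M' G : Type*} [AddCommMonoid M] [AddCommMonoid M'] [FunLike G M M']
    [AddMonoidHomClass G M M'] (φ : G) (a : Fin p → M) (i : Fin p) :
    φ (psum a i) = psum (fun l => φ (a l)) i := by
  simp [psum]

theorem map_diffs {p : ℕ} {M M' G : Type*} [AddCommGroup M] [AddCommGroup M'] [FunLike G M M']
    [AddMonoidHomClass G M M'] (φ : G) (a : Fin p → M) (i : Fin p) :
    φ (diffs a i) = diffs (fun l => φ (a l)) i := by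
  unfold diffs; split_ifs <;> simp

theorem diffs_comp_eq {p : ℕ} {M : Type*} [AddCommGroup M] (a b : Fin p → M) :
    diffs (fun i => a i + b i) = fun i => diffs a i + diffs b i := by
  ext i
  unfold diffs
  split_ifs
  · simp
  · exact add_sub_add_comm _ _ _ _

theorem psum_add_fun {p : ℕ} {M : Type*} [AddCommMonoid M] (a b : Fin p → M) (i : Fin p) :
    psum (fun l => a l + b l) i = psum a i + psum b i := by
  simp [psum, Finset.sum_add_distrib]

/-- The images under `𝔟` of the indeterminates:
`𝔟(N) = N`, `𝔟(β_0) = β_0`, `𝔟(β_k) = β_0 - β_{p+2-k} - 2N + 1` for `k = 1, …, p + 1`, and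
`𝔟(x_k) = n_1 + ⋯ + n_{p+1-k} + β_{p+2-k} - β_0 + N - 1` for `k = 1, …, p`. -/
def dualImage {p : ℕ} : Ind p → Poly p
  | .pos i =>
      psum (fun l => MvPolynomial.X (Ind.pos l)) i.rev + MvPolynomial.X (Ind.par i.rev.succ.succ)
        - MvPolynomial.X (Ind.par 0) + MvPolynomial.X Ind.size - 1
  | .par k => Fin.cases (MvPolynomial.X (Ind.par 0)) (fun k' : Fin (p + 1) =>
      MvPolynomial.X (Ind.par 0) - MvPolynomial.X (Ind.par k'.rev.succ)
        - 2 * MvPolynomial.X Ind.size + 1) k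
  | .size => MvPolynomial.X Ind.size

/-- The images of the indeterminates under the inverse of `𝔟`; in particular
`n_1 + ⋯ + n_i ↦ x_{p+1-i} + β_{p+1-i} + N`. -/
def dualImageInv {p : ℕ} : Ind p → Poly p
  | .pos i => diffs (fun l => MvPolynomial.X (Ind.pos l.rev) +
      MvPolynomial.X (Ind.par l.rev.castSucc.succ) + MvPolynomial.X Ind.size) i
  | .par k => Fin.cases (MvPolynomial.X (Ind.par 0)) (fun k' : Fin (p + 1) =>
      MvPolynomial.X (Ind.par 0) - MvPolynomial.X (Ind.par k'.rev.succ)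
        - 2 * MvPolynomial.X Ind.size + 1) k
  | .size => MvPolynomial.X Ind.size

theorem rev_castSucc' {p : ℕ} (i : Fin p) : i.castSucc.rev = i.rev.succ := Fin.rev_castSucc i
theorem rev_succ' {p : ℕ} (i : Fin p) : i.succ.rev = i.rev.castSucc := Fin.rev_succ i

/-- `𝔟` on polynomial coefficients. -/
def dualPoly (p : ℕ) : Poly p ≃ₐ[ℝ] Poly p :=
  AlgEquiv.ofAlgHom (MvPolynomial.aeval dualImage) (MvPolynomial.aeval dualImageInv)
    (by
      apply MvPolynomial.algHom_ext
      rintro (i | k | _)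
      · simp only [AlgHom.comp_apply, MvPolynomial.aeval_X, dualImageInv, map_diffs, AlgHom.id_apply]
        have : (fun l : Fin p => MvPolynomial.aeval (R := ℝ) dualImage
            (MvPolynomial.X (Ind.pos l.rev) + MvPolynomial.X (Ind.par l.rev.castSucc.succ) +
              MvPolynomial.X Ind.size : Poly p)) =
            psum (fun l => (MvPolynomial.X (Ind.pos l) : Poly p)) := by
          ext1 l
          simp [dualImage, rev_castSucc']
          ring
        rw [this, diffs_psum]
      · refine Fin.cases ?_ (fun k => ?_) k
        · simp [dualImageInv, dualImage]
        · simp [dualImageInv, dualImage, map_ofNat]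
          ring
      · simp [dualImageInv, dualImage])
    (by
      apply MvPolynomial.algHom_ext
      rintro (i | k | _)
      · simp only [AlgHom.comp_apply, MvPolynomial.aeval_X, dualImage, map_add, map_sub, map_psum,
          dualImageInv, psum_diffs, AlgHom.id_apply, map_one]
        simp [rev_succ']
        ring
      · refine Fin.cases ?_ (fun k => ?_) k
        · simp [dualImageInv, dualImage]
        · simp [dualImageInv, dualImage, map_ofNat]
          ring
      · simp [dualImageInv, dualImage])

/-- `𝔟` on coefficients. -/
def dualRat (p : ℕ) : RatFun p ≃ₐ[ℝ] RatFun p := IsFractionRing.algEquivOfAlgEquiv (dualPoly p)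

/-- `𝔟` on shifts: `E_{x_k} ↦ E_{n_{p+1-k}} E_{n_{p+2-k}}⁻¹`, with `E_{n_{p+1}} = 1`. -/
def dualShift (p : ℕ) : Shift p ≃* Shift p where
  toFun ν := Multiplicative.ofAdd (diffs fun i => ν.toAdd i.rev)
  invFun ν := Multiplicative.ofAdd fun i => psum ν.toAdd i.rev
  left_inv ν := by
    apply Multiplicative.toAdd.injective
    ext i
    simp [psum_diffs]
  right_inv ν := by
    apply Multiplicative.toAdd.injective
    simp [diffs_psum]
  map_mul' ν μ := by
    apply Multiplicative.toAdd.injective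
    exact diffs_comp_eq (fun i : Fin p => ν.toAdd i.rev) (fun i => μ.toAdd i.rev)

theorem dualPoly_shift {p : ℕ} (ν : Shift p) (f : Poly p) :
    dualPoly p (shiftPoly p ν f) = shiftPoly p (dualShift p ν) (dualPoly p f) := by
  have : (MvPolynomial.aeval dualImage).comp (MvPolynomial.aeval (shiftImage ν.toAdd)) =
      (MvPolynomial.aeval (shiftImage (dualShift p ν).toAdd)).comp
        (MvPolynomial.aeval (R := ℝ) (dualImage (p := p))) := by
    apply MvPolynomial.algHom_ext
    rintro (i | k | _)
    · simp only [AlgHom.comp_apply, MvPolynomial.aeval_X, shiftImage, dualImage, map_add, map_sub,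
        map_psum, map_one]
      rw [psum_add_fun]
      have h : psum (fun l => (MvPolynomial.C (((dualShift p ν).toAdd l : ℤ) : ℝ) : Poly p)) i.rev =
          MvPolynomial.C ((ν.toAdd i : ℤ) : ℝ) := by
        have h2 := congrFun (psum_diffs fun i : Fin p => ν.toAdd i.rev) i.rev
        rw [Fin.rev_rev] at h2
        rw [← h2]
        change _ = (MvPolynomial.C.comp (Int.castRingHom ℝ)) _
        rw [map_psum]
        rfl
      rw [h]
      simp
      ring
    · refine Fin.cases ?_ (fun k => ?_) k
      · simp [shiftImage, dualImage]
      · simp [shiftImage, dualImage, map_ofNat]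
    · simp [shiftImage, dualImage]
  exact DFunLike.congr_fun this f

theorem dualRat_smul {p : ℕ} (ν : Shift p) (f : RatFun p) :
    dualRat p (ν • f) = dualShift p ν • dualRat p f := by
  obtain ⟨a, b, -, rfl⟩ := IsFractionRing.div_surjective (Poly p) f
  simp [shift_smul_def, dualRat, shiftRat, dualPoly_shift]

theorem dualRat_symm_smul {p : ℕ} (ν : Shift p) (f : RatFun p) :
    (dualRat p).symm (ν • f) = (dualShift p).symm ν • (dualRat p).symm f := by
  apply (dualRat p).injective
  rw [dualRat_smul]
  simp

/-- The homomorphism of algebras of difference operators given by compatible automorphisms of the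
coefficients and of the shifts. -/
def transportHom {p : ℕ} (φ : RatFun p ≃ₐ[ℝ] RatFun p) (ψ : Shift p ≃* Shift p)
    (h : ∀ ν f, φ (ν • f) = ψ ν • φ f) : DiffOp p →ₐ[ℝ] DiffOp p :=
  SkewMonoidAlgebra.liftNCAlgHom (mulOp.comp φ.toAlgHom) (shiftOp.comp ψ.toMonoidHom) (by
    intro f ν
    simpa [h] using (shiftOp_mul_mulOp (ψ ν) (φ f)).symm)

theorem transportHom_single {p : ℕ} (φ : RatFun p ≃ₐ[ℝ] RatFun p) (ψ : Shift p ≃* Shift p)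
    (h : ∀ ν f, φ (ν • f) = ψ ν • φ f) (ν : Shift p) (f : RatFun p) :
    transportHom φ ψ h (SkewMonoidAlgebra.single ν f) =
      SkewMonoidAlgebra.single (ψ ν) (φ f) := by
  have h1 : transportHom φ ψ h (SkewMonoidAlgebra.single ν f) = mulOp (φ f) * shiftOp (ψ ν) :=
    SkewMonoidAlgebra.liftNC_single _ _ _ _
  rw [h1]
  change SkewMonoidAlgebra.single 1 (φ f) * SkewMonoidAlgebra.single (ψ ν) 1 = _
  simp [SkewMonoidAlgebra.single_mul_single]

/-- The isomorphism `𝔟` from the algebra of difference operators in `x` to the algebra of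
difference operators in `n`. -/
def dualIso (p : ℕ) : DiffOp p ≃ₐ[ℝ] DiffOp p :=
  AlgEquiv.ofAlgHom (transportHom (dualRat p) (dualShift p) dualRat_smul)
    (transportHom (dualRat p).symm (dualShift p).symm dualRat_symm_smul)
    (by
      ext1 L
      induction L using SkewMonoidAlgebra.induction_on with
      | zero => simp
      | single g a => simp [transportHom_single]
      | add f g hf hg => rw [map_add, hf, hg, map_add])
    (by
      ext1 L
      induction L using SkewMonoidAlgebra.induction_on with
      | zero => simp
      | single g a => simp [transportHom_single]
      | add f g hf hg => rw [map_add, hf, hg, map_add])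

theorem dualIso_single {p : ℕ} (ν : Shift p) (f : RatFun p) :
    dualIso p (SkewMonoidAlgebra.single ν f) =
      SkewMonoidAlgebra.single (dualShift p ν) (dualRat p f) :=
  transportHom_single _ _ dualRat_smul _ _

/-- `𝔏^n_{j+1} = 𝔟(𝔏^x_{j+1})`. -/
def opN {p : ℕ} (j : Fin p) : DiffOp p := dualIso p (opX j)

/-- `𝓐_n = 𝔟(𝓐_x)`. -/
def algN (p : ℕ) : Subalgebra ℝ (DiffOp p) := (algX p).map (dualIso p : DiffOp p →ₐ[ℝ] DiffOp p)

/-! ### The polynomials -/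

/-- The Pochhammer symbol `(a)_m = a (a + 1) ⋯ (a + m - 1)`. -/
def poch (a : ℝ) (m : ℕ) : ℝ := (ascPochhammer ℝ m).eval a

/-- The one-variable Racah polynomial
`r_m(α,β,γ,δ;y) = (α+1)_m (β+δ+1)_m (γ+1)_m
  ₄F₃(-m, m+α+β+1, -y, y+γ+δ+1; α+1, β+δ+1, γ+1; 1)`,
in which the denominators `(α+1)_k (β+δ+1)_k (γ+1)_k` of the hypergeometric sum are cancelled
against the prefactor, `(c)_m / (c)_k = (c+k)_{m-k}`. -/
def racah1 (m : ℕ) (α β γ δ y : ℝ) : ℝ :=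
  ∑ k ∈ Finset.range (m + 1),
    poch (-m) k * poch (m + α + β + 1) k * poch (-y) k * poch (y + γ + δ + 1) k / (k.factorial : ℝ) *
      (poch (α + 1 + k) (m - k) * poch (β + δ + 1 + k) (m - k) * poch (γ + 1 + k) (m - k))

/-- `N_1^{k} = n_1 + ⋯ + n_k` for the 0-based index `k`, i.e. the sum of the `n_i` before `n_{k+1}`. -/
def before {p : ℕ} (n : Fin p → ℕ) (k : Fin p) : ℕ :=
  ∑ i ∈ Finset.univ.filter (fun i => i < k), n i

/-- `|n| = n_1 + ⋯ + n_p`. -/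
def total {p : ℕ} (n : Fin p → ℕ) : ℕ := ∑ i, n i

/-- Tratnik's multivariable Racah polynomial `R_p(n;x;β;N)`. -/
def racah {p : ℕ} (n : Fin p → ℕ) (x : Fin p → ℝ) (β : Fin (p + 2) → ℝ) (N : ℝ) : ℝ :=
  ∏ k : Fin p, racah1 (n k)
    (2 * before n k + β k.castSucc.succ - β 0 - 1)
    (β k.succ.succ - β k.castSucc.succ - 1)
    (before n k - extPos x N k.succ.succ - 1)
    (before n k + β k.castSucc.succ + extPos x N k.succ.succ)
    (-before n k + x k)

/-- The normalizing factor `(-N)_{|n|} (-N-β_0)_{|n|} ∏_{k=1}^p (β_{k+1}-β_k)_{n_k}`. -/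
def normalizer {p : ℕ} (n : Fin p → ℕ) (β : Fin (p + 2) → ℝ) (N : ℝ) : ℝ :=
  poch (-N) (total n) * poch (-N - β 0) (total n) *
    ∏ k : Fin p, poch (β k.succ.succ - β k.castSucc.succ) (n k)

/-- The normalized polynomial `R̂_p(n;x;β;N)`; meaningful when the normalizing factor is not 0. -/
def racahHat {p : ℕ} (n : Fin p → ℕ) (x : Fin p → ℝ) (β : Fin (p + 2) → ℝ) (N : ℝ) : ℝ :=
  racah n x β N / normalizer n β N

/-- `n ↦ R̂_p(n;x;β;N)`, extended by `0` from `ℕ^p` to `ℤ^p`. -/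
def racahHatZ {p : ℕ} (x : Fin p → ℝ) (β : Fin (p + 2) → ℝ) (N : ℝ) (n : Fin p → ℤ) : ℝ :=
  if ∀ i, 0 ≤ n i then racahHat (fun i => (n i).toNat) x β N else 0

/-- `μ_{j+1}(n) = -(n_1+⋯+n_{j+1})(n_1+⋯+n_{j+1} - 1 + β_{j+2} - β_0)`. -/
def eigenMu {p : ℕ} (j : Fin p) (n : Fin p → ℕ) (β : Fin (p + 2) → ℝ) : ℝ :=
  -((psum n j : ℕ) : ℝ) * (((psum n j : ℕ) : ℝ) - 1 + β j.succ.succ - β 0)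

/-- `κ_j(x) = -λ_{p+1-j}(x_{p+1-j}) + N(N+β_{p+1-j})`, where `λ_i(x_i) = x_i(x_i+β_i)`; the
0-based index of `x_{p+1-j}` is the reflection of that of `j`. -/
def eigenKappa {p : ℕ} (j : Fin p) (x : Fin p → ℝ) (β : Fin (p + 2) → ℝ) (N : ℝ) : ℝ :=
  -(x j.rev * (x j.rev + β j.rev.castSucc.succ)) + N * (N + β j.rev.castSucc.succ)

/-! ### Limits in `N` -/

/-- Every term `l_ν(n;β;N') R̂_p(n+ν;x;β;N')` of `L R̂_p` at the point `n` has a limit as `N' → N`,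
and the sum of these limits is `s`. -/
def ActsInLimit {p : ℕ} (L : DiffOp p) (β : Fin (p + 2) → ℝ) (N : ℝ) (x : Fin p → ℝ)
    (n : Fin p → ℕ) (s : ℝ) : Prop :=
  ∃ T : Shift p → ℝ,
    (∀ ν ∈ L.support,
      Tendsto (fun N' : ℝ => coeffN L β N' (fun i => (n i : ℤ)) ν *
        racahHatZ x β N' ((fun i => (n i : ℤ)) + ν.toAdd)) (𝓝[≠] N) (𝓝 (T ν))) ∧
    ∑ ν ∈ L.support, T ν = s

end Racah

end

open Filter Topology

noncomputable section

namespace Racah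

/-! Equations in `x`. The last factor of `A_ν` is a quadratic `Q` evaluated at the last position of
the chain, and removing the last index of a chain leaves a shorter chain whose quadratic is
`quadPlus` or its reflection `quadMinus`. The sum over `ν` is thus a recursion on the number of
variables (`chainOp`). Every quadratic is a combination of `quadPlus`, `quadMinus` and `quadZero`,
which reduces an operator in `m + 1` variables to two kinds of operators in `m` variables: one with
`quadZero`, and raising operators `raiseOp`, both with `x_{m+1}` as a parameter. The product of the
first `m` factors of `R_p` is an eigenfunction of the former, and the latter turn the parameter
value `z + 1` into `z` up to a scalar. Both facts are proved together in `chainProd_eigen`; what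
remains in each induction step is an identity for one balanced `₄F₃`, checked in a basis on which
the one-variable operator is bidiagonal (`threeTerm_fac`, `threeTerm_fac_shift`).

Equations in `n`. Whipple's transformation gives each factor two negative integers among its upper
parameters when `x` is a lattice point, and exchanging them gives the duality `racahHat_duality`:
position and degree swap roles while the parameters are replaced by their images under `𝔟`. At
lattice points the equation in `n` is therefore the equation in `x` for the dual parameters; both
sides are polynomials in `x`, so it holds for all `x`. The extension of `R̂` by zero outside `ℕ^p`
is harmless because the operators do not connect the image of `ℕ^p` with the rest of the grid
(`chainOp_vanish`).

Commutativity. A commutator annihilates every `R̂(n; ·)`. For generic `x` the functions `n ↦ R̂(n; x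
+ ν)` are linearly independent, since the eigenvalues `κ_j(x + ν)` separate the shifts `ν`; hence
all coefficients of the commutator vanish.

Exceptional parameters. Poles caused by special `β_0` are avoided by moving `β_0` and using
continuity. Poles of `R̂(n + ν)` in `N`, which occur when `|n + ν| > |n|`, are compensated by zeros
of the coefficients: the half-spaces `x_1 + β_1 - a ∈ -ℕ`, `a ∈ {0, β_0}`, are invariant under all
of `𝓐_x`, so a coefficient that raises `x_1` by `k` is divisible by the `2k` linear forms of the
walls it crosses (`chainOp_eq_zero_of_wall`, `wallForm_dvd_num`, `exists_cofactor`). -/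

theorem poch_zero (a : ℝ) : poch a 0 = 1 := by simp [poch]

theorem poch_succ (a : ℝ) (m : ℕ) : poch a (m + 1) = poch a m * (a + m) := by
  simp [poch, ascPochhammer_succ_right]

theorem poch_succ_left (a : ℝ) (m : ℕ) : poch a (m + 1) = a * poch (a + 1) m := by
  simp [poch, ascPochhammer_succ_left]

theorem poch_add (a : ℝ) (m k : ℕ) : poch a (m + k) = poch a m * poch (a + m) k := by
  induction k with
  | zero => simp [poch_zero]
  | succ k ih => rw [← add_assoc, poch_succ, ih, poch_succ]; push_cast; ring

theorem poch_reflect (a : ℝ) (m : ℕ) : poch (1 - m - a) m = (-1) ^ m * poch a m := by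
  induction m generalizing a with
  | zero => simp [poch_zero]
  | succ m ih =>
    rw [poch_succ_left, poch_succ, show (1 - ((m + 1 : ℕ) : ℝ) - a + 1) = 1 - m - a by push_cast; ring,
      ih, pow_succ]
    push_cast
    ring

theorem poch_eq_zero_iff (a : ℝ) (m : ℕ) : poch a m = 0 ↔ ∃ i < m, a + i = 0 := by
  induction m with
  | zero => simp [poch_zero]
  | succ m ih =>
    rw [poch_succ, mul_eq_zero, ih]
    constructor
    · rintro (⟨i, hi, h⟩ | h)
      · exact ⟨i, by omega, h⟩
      · exact ⟨m, by omega, h⟩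
    · rintro ⟨i, hi, h⟩
      rcases Nat.lt_succ_iff_lt_or_eq.mp hi with h1 | rfl
      · exact Or.inl ⟨i, h1, h⟩
      · exact Or.inr h

theorem poch_ne_zero {a : ℝ} (m : ℕ) (h : ∀ i : ℕ, i < m → a + i ≠ 0) : poch a m ≠ 0 := by
  rw [Ne, poch_eq_zero_iff]
  push Not
  exact h

theorem poch_neg_nat (n k : ℕ) : poch (-n) k / k.factorial = (-1) ^ k * n.choose k := by
  induction k with
  | zero => simp [poch_zero]
  | succ k ih =>
    have h1 : ((n.choose (k + 1) : ℕ) : ℝ) * (k + 1) = n.choose k * (n - k) := by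
      rcases le_or_gt k n with h | h
      · have := Nat.choose_succ_right_eq n k
        have h2 := congrArg (Nat.cast (R := ℝ)) this
        rw [Nat.cast_mul, Nat.cast_mul, Nat.cast_sub h] at h2
        exact_mod_cast h2
      · simp [Nat.choose_eq_zero_of_lt h, Nat.choose_eq_zero_of_lt (show n < k + 1 by omega)]
    have hk : (k.factorial : ℝ) ≠ 0 := by exact_mod_cast k.factorial_ne_zero
    rw [div_eq_iff hk] at ih
    rw [poch_succ, ih, Nat.factorial_succ]
    push_cast
    field_simp
    rw [pow_succ]
    linear_combination (-1) ^ k * h1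

/-! ### Summation and transformation of balanced hypergeometric sums -/

/-- The terminating form of the Pfaff–Saalschütz sum, with denominators cleared. -/
theorem saalschuetz (d α β : ℝ) (k : ℕ) :
    ∑ j ∈ Finset.range (k + 1), (k.choose j : ℝ) * (poch α j * poch β j * poch (d + j) (k - j) *
      poch (d - α - β) (k - j)) = poch (d - α) k * poch (d - β) k := by
  induction k with
  | zero => simp [poch_zero]
  | succ k ih =>
    set w := d - α - β with hw
    -- A telescoping certificate: the summand for `k + 1` is the expected ratio `(d - α + k)(d - β +
    -- k)` times the summand for `k`, plus `G (j + 1) - G j`, where `G 0 = 0` and `G (k + 2) = 0`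
    -- because a binomial coefficient vanishes.
    have key : ∀ j ∈ Finset.range (k + 2), ((k + 1).choose j : ℝ) * (poch α j * poch β j *
        poch (d + j) (k + 1 - j) * poch w (k + 1 - j)) =
        (d - α + k) * (d - β + k) * ((k.choose j : ℝ) * (poch α j * poch β j * poch (d + j) (k - j) *
          poch w (k - j))) +
        (- ((k.choose j : ℝ) * (poch α (j + 1) * poch β (j + 1) * poch (d + j) (k - j) *
          poch w (k - j))) -
        - (if j = 0 then 0 else (k.choose (j - 1) : ℝ) * (poch α j * poch β j *
          poch (d + j - 1) (k + 1 - j) * poch w (k + 1 - j)))) := by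
      intro j hj
      have hj' : j ≤ k + 1 := by simpa [Nat.lt_succ_iff] using hj
      rcases Nat.lt_or_ge k j with h | h
      · obtain rfl : j = k + 1 := by omega
        simp [poch_zero]
      obtain ⟨i, rfl⟩ := Nat.exists_eq_add_of_le h
      rcases Nat.eq_zero_or_pos j with rfl | hj0
      · simp only [zero_add, Nat.choose_zero_right, Nat.cast_one, poch_zero, Nat.sub_zero,
          Nat.cast_zero, add_zero, poch_succ, if_true]
        rw [hw]; ring
      · obtain ⟨j, rfl⟩ := Nat.exists_eq_add_of_lt hj0
        simp only [zero_add] at *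
        rw [if_neg (by omega)]
        have e1 : j + 1 + i + 1 - (j + 1) = i + 1 := by omega
        have e2 : j + 1 + i - (j + 1) = i := by omega
        rw [e1, e2, Nat.add_sub_cancel, show d + ((j + 1 : ℕ) : ℝ) - 1 = d + j by push_cast; ring]
        rw [poch_succ_left (d + j), poch_succ w, poch_succ (d + ((j + 1 : ℕ) : ℝ)), poch_succ α (j + 1),
          poch_succ β (j + 1), show d + (j : ℝ) + 1 = d + ((j + 1 : ℕ) : ℝ) by push_cast; ring]
        have h1 : ((j + 1 + i + 1).choose (j + 1) : ℝ) = (j + 1 + i).choose j + (j + 1 + i).choose (j + 1) := by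
          exact_mod_cast Nat.choose_succ_succ (j + 1 + i) j
        have h2 : ((j + 1 + i).choose (j + 1) : ℝ) * (j + 1) = (j + 1 + i).choose j * (i + 1) := by
          have := Nat.choose_succ_right_eq (j + 1 + i) j
          rw [show j + 1 + i - j = i + 1 by omega] at this
          exact_mod_cast this
        rw [h1]
        push_cast
        generalize poch (d + (j + 1)) i = X
        generalize poch w i = Y
        generalize poch α (j + 1) = A
        generalize poch β (j + 1) = C
        have hw' : w = d - α - β := hw
        rw [hw']
        linear_combination (A * C * X * Y) * (α + β - d - i) * h2
    rw [Finset.sum_congr rfl key, Finset.sum_add_distrib, ← Finset.mul_sum]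
    rw [Finset.sum_range_succ (fun j => (k.choose j : ℝ) * _), ih]
    have tel : ∀ M : ℕ, ∑ j ∈ Finset.range M, (- ((k.choose j : ℝ) * (poch α (j + 1) *
        poch β (j + 1) * poch (d + j) (k - j) * poch w (k - j))) -
        - (if j = 0 then 0 else (k.choose (j - 1) : ℝ) * (poch α j * poch β j *
          poch (d + j - 1) (k + 1 - j) * poch w (k + 1 - j)))) =
        - (if M = 0 then 0 else (k.choose (M - 1) : ℝ) * (poch α M * poch β M *
          poch (d + M - 1) (k + 1 - M) * poch w (k + 1 - M))) := by
      intro M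
      induction M with
      | zero => simp
      | succ M ihM =>
        rw [Finset.sum_range_succ, ihM]
        simp only [Nat.add_sub_cancel, Nat.succ_ne_zero, if_false, Nat.add_sub_add_right]
        push_cast
        rw [show d + ((M : ℝ) + 1) - 1 = d + M by ring]
        ring
    rw [tel, if_neg (by omega)]
    rw [poch_succ (d - α), poch_succ (d - β)]
    simp
    ring

/-- The terminating sum `₄F₃(-n, a, b, c; d, e, f; 1)` multiplied by `(d)_n (e)_n (f)_n`. -/
def hyp (n : ℕ) (a b c d e f : ℝ) : ℝ :=
  ∑ k ∈ Finset.range (n + 1), poch (-n) k * poch a k * poch b k * poch c k / (k.factorial : ℝ) *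
    (poch (d + k) (n - k) * poch (e + k) (n - k) * poch (f + k) (n - k))

/-- This is `saalschuetz` with the fourth Pochhammer symbol reversed by `poch_reflect`, which moves
it into the lower row and leaves a balanced `₃F₂`. -/
theorem saalschuetz_hyp (m : ℕ) (A E F : ℝ) :
    ∑ i ∈ Finset.range (m + 1), poch (-m) i / (i.factorial : ℝ) * (poch A i * poch (E + F + m - 1 - A) i *
      (poch (E + i) (m - i) * poch (F + i) (m - i))) = poch (E - A) m * poch (F - A) m := by
  have h := saalschuetz E A (E + F + m - 1 - A) m
  rw [show E - (E + F + m - 1 - A) = 1 - m - (F - A) by ring, poch_reflect] at h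
  have h1 : poch (E - A) m * poch (F - A) m = (-1) ^ m * (poch (E - A) m * ((-1) ^ m * poch (F - A) m)) := by
    have : ((-1 : ℝ) ^ m) * (-1) ^ m = 1 := by rw [← mul_pow]; simp
    linear_combination (-(poch (E - A) m * poch (F - A) m)) * this
  rw [h1, ← h, Finset.mul_sum]
  refine Finset.sum_congr rfl fun i hi => ?_
  obtain ⟨l, rfl⟩ := Nat.exists_eq_add_of_le (Nat.lt_succ_iff.mp (Finset.mem_range.mp hi))
  rw [poch_neg_nat, Nat.add_sub_cancel_left,
    show E - A - (E + F + ((i + l : ℕ) : ℝ) - 1 - A) = 1 - l - (F + i) by push_cast; ring,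
    poch_reflect, pow_add]
  have : ((-1 : ℝ) ^ l) * (-1) ^ l = 1 := by rw [← mul_pow]; simp
  linear_combination (-((-1) ^ i * ((i + l).choose i : ℝ) * (poch A i * poch (E + F + ((i + l : ℕ) : ℝ) - 1 - A) i *
      (poch (E + i) l * poch (F + i) l)))) * this

/-- Whipple's transformation of terminating balanced `₄F₃` sums. -/
theorem whipple (n : ℕ) (a b c d e f : ℝ) (h : d + e + f = a + b + c - n + 1) :
    hyp n a b c d e f = hyp n a (d - b) (d - c) d (a - n + 1 - e) (a - n + 1 - f) := by
  -- The product `(b)_k (c)_k (d+k)_{n-k}` is expanded by Saalschütz with upper parameters `d - b`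
  -- and `d - c`. After the two sums are exchanged, the inner one is summed by Saalschütz again.
  have h1 : ∀ k ∈ Finset.range (n + 1),
      poch (-n) k * poch a k * poch b k * poch c k / (k.factorial : ℝ) *
        (poch (d + k) (n - k) * poch (e + k) (n - k) * poch (f + k) (n - k)) =
      ∑ j ∈ Finset.range (n + 1), if j ≤ k then
        poch (-n) k * poch a k / (k.factorial : ℝ) * (poch (e + k) (n - k) * poch (f + k) (n - k)) *
        ((k.choose j : ℝ) * (poch (d - b) j * poch (d - c) j * poch (d + j) (n - j) *
          poch (b + c - d) (k - j))) else 0 := by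
    intro k hk
    have hk' : k ≤ n := Nat.lt_succ_iff.mp (Finset.mem_range.mp hk)
    rw [← Finset.sum_filter, ← Finset.mul_sum]
    have hS := saalschuetz d (d - b) (d - c) k
    rw [sub_sub_cancel, sub_sub_cancel] at hS
    have : (Finset.range (n + 1)).filter (fun j => j ≤ k) = Finset.range (k + 1) := by
      ext j; simp; omega
    rw [this]
    have h2 : ∑ j ∈ Finset.range (k + 1), (k.choose j : ℝ) * (poch (d - b) j * poch (d - c) j *
        poch (d + j) (n - j) * poch (b + c - d) (k - j)) = poch b k * poch c k * poch (d + k) (n - k) := by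
      rw [← hS, Finset.sum_mul]
      refine Finset.sum_congr rfl fun j hj => ?_
      have hj' : j ≤ k := Nat.lt_succ_iff.mp (Finset.mem_range.mp hj)
      have : poch (d + j) (n - j) = poch (d + j) (k - j) * poch (d + k) (n - k) := by
        rw [show n - j = (k - j) + (n - k) by omega, poch_add]
        congr 2
        rw [Nat.cast_sub hj']; ring
      rw [this, show b - (d - c) = b + c - d by ring]
      ring
    rw [h2]
    ring
  rw [hyp, Finset.sum_congr rfl h1, Finset.sum_comm, hyp]
  refine Finset.sum_congr rfl fun j hj => ?_
  obtain ⟨m, rfl⟩ := Nat.exists_eq_add_of_le (Nat.lt_succ_iff.mp (Finset.mem_range.mp hj))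
  rw [show j + m + 1 = j + (m + 1) by ring, Finset.sum_range_add, Finset.sum_eq_zero, zero_add]
  swap
  · intro k hk
    rw [if_neg]
    simpa using hk
  have hS := saalschuetz_hyp m (a + j) (e + j) (f + j)
  have e1 : a - ((j + m : ℕ) : ℝ) + 1 - e + j = 1 - m - (e + j - (a + j)) := by push_cast; ring
  have e2 : a - ((j + m : ℕ) : ℝ) + 1 - f + j = 1 - m - (f + j - (a + j)) := by push_cast; ring
  rw [Nat.add_sub_cancel_left, e1, e2, poch_reflect, poch_reflect]
  have h3 : (-1 : ℝ) ^ m * poch (e + j - (a + j)) m * ((-1) ^ m * poch (f + j - (a + j)) m) =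
      poch (e + j - (a + j)) m * poch (f + j - (a + j)) m := by
    have : ((-1 : ℝ) ^ m) * (-1) ^ m = 1 := by rw [← mul_pow]; simp
    linear_combination (poch (e + j - (a + j)) m * poch (f + j - (a + j)) m) * this
  rw [mul_assoc (poch (d + j) m), h3, ← hS, Finset.mul_sum, Finset.mul_sum]
  refine Finset.sum_congr rfl fun i hi => ?_
  obtain ⟨l, rfl⟩ := Nat.exists_eq_add_of_le (Nat.lt_succ_iff.mp (Finset.mem_range.mp hi))
  rw [if_pos (by omega), show j + (i + l) - (j + i) = l by omega, Nat.add_sub_cancel_left,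
    Nat.add_sub_cancel_left, poch_add, poch_add a]
  have hch : (((j + i).choose j : ℕ) : ℝ) / ((j + i).factorial : ℝ) = 1 / (j.factorial * i.factorial) := by
    have := Nat.choose_mul_factorial_mul_factorial (show j ≤ j + i by omega)
    rw [Nat.add_sub_cancel_left] at this
    have h2 : (((j + i).choose j : ℕ) : ℝ) * j.factorial * i.factorial = (j + i).factorial := by
      exact_mod_cast this
    rw [← h2]
    have hi0 : (i.factorial : ℝ) ≠ 0 := by exact_mod_cast i.factorial_ne_zero
    have hj0 : (j.factorial : ℝ) ≠ 0 := by exact_mod_cast j.factorial_ne_zero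
    have hc0 : (((j + i).choose j : ℕ) : ℝ) ≠ 0 := by
      exact_mod_cast (Nat.choose_pos (show j ≤ j + i by omega)).ne'
    field_simp
  -- The balancing condition `h` enters here: it makes `b + c - d` the one parameter for which the
  -- inner sum is balanced.
  have e3 : e + j + (f + j) + ((i + l : ℕ) : ℝ) - 1 - (a + j) = b + c - d := by
    push_cast at h ⊢; linarith
  rw [e3, show -((j + (i + l) : ℕ) : ℝ) + j = -((i + l : ℕ) : ℝ) by push_cast; ring]
  push_cast
  rw [show e + ((j : ℝ) + i) = e + j + i by ring, show f + ((j : ℝ) + i) = f + j + i by ring]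
  linear_combination (poch (-(j + (i + l))) j * poch (-(i + l)) i * (poch a j * poch (a + j) i) *
    (poch (e + j + i) l * poch (f + j + i) l) * (poch (d - b) j * poch (d - c) j * poch (d + j) (i + l) *
          poch (b + c - d) i)) * hch

/-! ### One-variable difference equations for a single factor -/

/-- The `m`-th factor of `R_p` as a function of `x = x_m` and `z = x_{m+1}`, with
`T = N_1^{m-1}`, `b = β_m`, `b' = β_{m+1}`. -/
def fac (n : ℕ) (T b b' b0 x z : ℝ) : ℝ :=
  hyp n (n + 2 * T + b' - b0 - 1) (T - x) (T + x + b) (2 * T + b - b0) (T + b' + z) (T - z)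

/-- The coefficients of `fac` in the basis `(T - x)_k (T + x + b)_k`. -/
def facCoeff (n : ℕ) (T b b' b0 z : ℝ) (k : ℕ) : ℝ :=
  poch (-n) k * poch (n + 2 * T + b' - b0 - 1) k / (k.factorial : ℝ) *
    (poch (2 * T + b - b0 + k) (n - k) * poch (T + b' + z + k) (n - k) * poch (T - z + k) (n - k))

/-- The basis `(T - x)_k (T + x + b)_k`. -/
def wilsonBasis (T b : ℝ) (k : ℕ) (x : ℝ) : ℝ := poch (T - x) k * poch (T + x + b) k

theorem fac_eq_sum (n : ℕ) (T b b' b0 x z : ℝ) :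
    fac n T b b' b0 x z =
      ∑ k ∈ Finset.range (n + 1), facCoeff n T b b' b0 z k * wilsonBasis T b k x := by
  unfold fac hyp facCoeff wilsonBasis
  refine Finset.sum_congr rfl fun k _ => ?_
  ring

theorem facCoeff_eq_zero (n : ℕ) (T b b' b0 z : ℝ) : facCoeff n T b b' b0 z (n + 1) = 0 := by
  have : poch (-n) (n + 1) = 0 := by rw [poch_succ]; simp
  simp [facCoeff, this]

theorem wilsonBasis_succ (T b : ℝ) (k : ℕ) (x : ℝ) :
    wilsonBasis T b (k + 1) x = wilsonBasis T b k x * ((T - x + k) * (T + x + b + k)) := by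
  simp only [wilsonBasis, poch_succ]; ring

/-- Apart from end factors, the two Pochhammer symbols only slide by one. The factor `2x + b + 1`
that comes out cancels one of the two denominators of `threeTerm`; the `b0` factor is carried along
unchanged. -/
theorem wilsonBasis_forward (T b b0 : ℝ) (k : ℕ) (x : ℝ) :
    (x + b - b0 + T) * (x + b + T) * (wilsonBasis T b (k + 1) (x + 1) - wilsonBasis T b (k + 1) x) =
      -((k + 1) * (2 * x + b + 1) * (T + x + b - b0) * (T + x + b + k)) * wilsonBasis T b k x := by
  have h1 := poch_succ_left (T - (x + 1)) k
  have h2 := poch_succ (T + (x + 1) + b) k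
  have h3 := poch_succ (T - x) k
  have h4 := poch_succ_left (T + x + b) k
  have h5 : (T + x + b) * poch (T + x + b + 1) k = poch (T + x + b) k * (T + x + b + k) := by
    rw [← poch_succ_left, poch_succ]
  rw [show T - (x + 1) + 1 = T - x by ring] at h1
  rw [show T + (x + 1) + b = T + x + b + 1 by ring] at h2
  simp only [wilsonBasis]
  rw [h1, show T + (x + 1) + b = T + x + b + 1 by ring, h2, h3, h4]
  linear_combination (-(poch (T - x) k * (k + 1) * (2 * x + b + 1) * (T + x + b - b0))) * h5

theorem wilsonBasis_reflect (T b : ℝ) (k : ℕ) (x : ℝ) :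
    wilsonBasis T b k (-x - b) = wilsonBasis T b k x := by
  simp only [wilsonBasis]
  rw [show T - (-x - b) = T + x + b by ring, show T + (-x - b) + b = T - x by ring]
  ring

/-- The forward formula at the reflected point `-x - b`, where a step forward is a step backward of
`x`. -/
theorem wilsonBasis_backward (T b b0 : ℝ) (k : ℕ) (x : ℝ) :
    (-x - b0 + T) * (-x + T) * (wilsonBasis T b (k + 1) (x - 1) - wilsonBasis T b (k + 1) x) =
      ((k + 1) * (2 * x + b - 1) * (T - x - b0) * (T - x + k)) * wilsonBasis T b k x := by
  have h := wilsonBasis_forward T b b0 k (-x - b)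
  rw [show -x - b + 1 = -(x - 1) - b by ring] at h
  simp only [wilsonBasis_reflect] at h
  linear_combination h

/-- The three-term operator in `x` attached to a quadratic polynomial `Q`. -/
def threeTerm (Q : ℝ → ℝ) (T b b0 lead : ℝ) (g : ℝ → ℝ) (x : ℝ) : ℝ :=
  Q x / ((2 * x + b) * (2 * x + b + 1)) * ((x + b - b0 + T) * (x + b + T)) * g (x + 1) +
  Q (-x - b) / ((2 * x + b) * (2 * x + b - 1)) * ((-x - b0 + T) * (-x + T)) * g (x - 1) +
  ((Q x / ((2 * x + b) * (2 * x + b + 1)) + Q (-x - b) / ((2 * x + b) * (2 * x + b - 1)) - lead) *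
      (-T * (T - 1 + b - b0)) -
    Q x / ((2 * x + b) * (2 * x + b + 1)) * ((x + b - b0) * (x + b)) -
    Q (-x - b) / ((2 * x + b) * (2 * x + b - 1)) * (x * (x + b0))) * g x

theorem threeTerm_sum (Q : ℝ → ℝ) (T b b0 lead : ℝ) (n : ℕ) (a : ℕ → ℝ) (g : ℕ → ℝ → ℝ) (x : ℝ) :
    threeTerm Q T b b0 lead (fun y => ∑ k ∈ Finset.range n, a k * g k y) x =
      ∑ k ∈ Finset.range n, a k * threeTerm Q T b b0 lead (g k) x := by
  simp only [threeTerm, Finset.mul_sum, ← Finset.sum_add_distrib]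
  refine Finset.sum_congr rfl fun k _ => ?_
  ring

/-- On constants the brackets multiplying the two values of `Q` collapse to `T(2x + b + 1)` and
`-T(2x + b - 1)`. What remains is the divided difference of `Q` between `x` and `-x - b`, which for
a quadratic does not depend on `x`. -/
theorem threeTerm_wilsonBasis_zero (q2 q1 q0 T b b0 x : ℝ) (h0 : 2 * x + b ≠ 0)
    (h1 : 2 * x + b + 1 ≠ 0) (h2 : 2 * x + b - 1 ≠ 0) :
    threeTerm (fun y => q2 * y ^ 2 + q1 * y + q0) T b b0 q2 (wilsonBasis T b 0) x =
      (T * (q1 - q2 * b) + q2 * (T * (T - 1 + b - b0))) := by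
  have hu : (2 * x + b + 1) / ((2 * x + b) * (2 * x + b + 1)) = (2 * x + b)⁻¹ := by field_simp
  have hv : (2 * x + b - 1) / ((2 * x + b) * (2 * x + b - 1)) = (2 * x + b)⁻¹ := by field_simp
  have hw : (2 * x + b) * (2 * x + b)⁻¹ = 1 := mul_inv_cancel₀ h0
  simp only [threeTerm, wilsonBasis, poch_zero]
  linear_combination (T * (q2 * x ^ 2 + q1 * x + q0)) * hu -
    (T * (q2 * (-x - b) ^ 2 + q1 * (-x - b) + q0)) * hv + T * (q1 - q2 * b) * hw

/-- The operator is bidiagonal in this basis. Its value on a basis function is its value on `1`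
times that function plus the two differences, and the remaining denominator `2x + b` divides their
sum. The subdiagonal entry contains `Q(T + k)`, as it must, since the basis function of index `k +
1` vanishes at `x = T + k`. -/
theorem threeTerm_wilsonBasis_succ (q2 q1 q0 T b b0 x : ℝ) (k : ℕ) (h0 : 2 * x + b ≠ 0)
    (h1 : 2 * x + b + 1 ≠ 0) (h2 : 2 * x + b - 1 ≠ 0) :
    threeTerm (fun y => q2 * y ^ 2 + q1 * y + q0) T b b0 q2 (wilsonBasis T b (k + 1)) x =
      ((T * (q1 - q2 * b) + q2 * (T * (T - 1 + b - b0))) + (k + 1) * (q1 + q2 * (k + 2 * T - b0))) *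
        wilsonBasis T b (k + 1) x -
      (k + 1) * ((q2 * (T + k) ^ 2 + q1 * (T + k) + q0) * (2 * T + k + b - b0)) *
        wilsonBasis T b k x := by
  have e1 := wilsonBasis_forward T b b0 k x
  have e2 := wilsonBasis_backward T b b0 k x
  have e3 := threeTerm_wilsonBasis_zero q2 q1 q0 T b b0 x h0 h1 h2
  have key : threeTerm (fun y => q2 * y ^ 2 + q1 * y + q0) T b b0 q2 (wilsonBasis T b (k + 1)) x =
      threeTerm (fun y => q2 * y ^ 2 + q1 * y + q0) T b b0 q2 (wilsonBasis T b 0) x *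
        wilsonBasis T b (k + 1) x +
      (q2 * x ^ 2 + q1 * x + q0) / ((2 * x + b) * (2 * x + b + 1)) *
        ((x + b - b0 + T) * (x + b + T) *
          (wilsonBasis T b (k + 1) (x + 1) - wilsonBasis T b (k + 1) x)) +
      (q2 * (-x - b) ^ 2 + q1 * (-x - b) + q0) / ((2 * x + b) * (2 * x + b - 1)) *
        ((-x - b0 + T) * (-x + T) *
          (wilsonBasis T b (k + 1) (x - 1) - wilsonBasis T b (k + 1) x)) := by
    simp only [threeTerm, wilsonBasis, poch_zero]
    ring
  have hu : (2 * x + b + 1) / ((2 * x + b) * (2 * x + b + 1)) = (2 * x + b)⁻¹ := by field_simp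
  have hv : (2 * x + b - 1) / ((2 * x + b) * (2 * x + b - 1)) = (2 * x + b)⁻¹ := by field_simp
  have hw : (2 * x + b) * (2 * x + b)⁻¹ = 1 := mul_inv_cancel₀ h0
  rw [key, e1, e2, e3, wilsonBasis_succ]
  generalize wilsonBasis T b k x = W
  linear_combination (-((q2 * x ^ 2 + q1 * x + q0) * (k + 1) * (T + x + b - b0) * (T + x + b + k) * W)) * hu +
    ((q2 * (-x - b) ^ 2 + q1 * (-x - b) + q0) * (k + 1) * (T - x - b0) * (T - x + k) * W) * hv -
    (k + 1) * W * ((q1 + q2 * (k + 2 * T - b0)) * -((T - x + k) * (T + x + b + k)) +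
      (q2 * (T + k) ^ 2 + q1 * (T + k) + q0) * (2 * T + k + b - b0)) * hw

/-- Summation of a three-term action on the basis `(T - x)_k (T + x + b)_k`. -/
theorem sum_wilsonBasis_telescope (T b x : ℝ) (n : ℕ) (a a' lam e : ℕ → ℝ) (D : ℕ → ℝ) (r : ℝ)
    (hD0 : D 0 = lam 0 * wilsonBasis T b 0 x)
    (hD : ∀ k, D (k + 1) = lam (k + 1) * wilsonBasis T b (k + 1) x - e k * wilsonBasis T b k x)
    (hn : a (n + 1) = 0)
    (ha : ∀ k ≤ n, lam k * a k - r * a' k = e k * a (k + 1)) :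
    ∑ k ∈ Finset.range (n + 1), a k * D k =
      r * ∑ k ∈ Finset.range (n + 1), a' k * wilsonBasis T b k x := by
  have h : ∀ m ≤ n + 1, ∑ k ∈ Finset.range m, a k * D k =
      r * ∑ k ∈ Finset.range m, a' k * wilsonBasis T b k x +
        (if m = 0 then 0 else e (m - 1) * a m * wilsonBasis T b (m - 1) x) := by
    intro m
    induction m with
    | zero => simp
    | succ m ih =>
      intro hm
      rw [Finset.sum_range_succ, ih (by omega), Finset.sum_range_succ]
      have h1 := ha m (by omega)
      cases m with
      | zero =>
        simp [hD0]
        linear_combination (wilsonBasis T b 0 x) * h1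
      | succ m =>
        rw [hD]
        simp only [Nat.succ_ne_zero, if_false, Nat.add_sub_cancel]
        linear_combination (wilsonBasis T b (m + 1) x) * h1
  rw [h (n + 1) le_rfl, hn]
  simp

/-- The difference equation of the one-variable Racah polynomials. Here `Q(T + k)` factors into `T +
b' + z + k` and `-(T - z + k)`, exactly the lower factors by which consecutive `facCoeff` differ.
The eigenvalue depends on `T` and `n` only through `T + n`, the partial sum passed on to the next
variable. -/
theorem threeTerm_fac (n : ℕ) (T b b' b0 x z : ℝ) (h0 : 2 * x + b ≠ 0)
    (h1 : 2 * x + b + 1 ≠ 0) (h2 : 2 * x + b - 1 ≠ 0) :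
    threeTerm (fun y => (y + b' + z) * (z - y)) T b b0 (-1) (fun y => fac n T b b' b0 y z) x =
      -(T + n) * (T + n - 1 + b' - b0) * fac n T b b' b0 x z := by
  have hQ : (fun y : ℝ => (y + b' + z) * (z - y)) =
      fun y => (-1) * y ^ 2 + (-b') * y + z * (b' + z) := by
    ext y; ring
  simp only [fac_eq_sum]
  rw [hQ, threeTerm_sum]
  refine sum_wilsonBasis_telescope T b x n _ _
    (fun k => (T * (-b' - (-1) * b) + (-1) * (T * (T - 1 + b - b0))) +
      k * (-b' + (-1) * (k - 1 + 2 * T - b0)))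
    (fun k => (k + 1) * (((-1) * (T + k) ^ 2 + (-b') * (T + k) + z * (b' + z)) * (2 * T + k + b - b0)))
    _ _ ?_ ?_ (facCoeff_eq_zero _ _ _ _ _ _) ?_
  · rw [threeTerm_wilsonBasis_zero _ _ _ _ _ _ _ h0 h1 h2]
    simp [wilsonBasis, poch_zero]
  · intro k
    rw [threeTerm_wilsonBasis_succ _ _ _ _ _ _ _ _ h0 h1 h2]
    push_cast; ring
  · intro k hk
    rcases hk.eq_or_lt with rfl | hk
    · rw [facCoeff_eq_zero]; ring
    · obtain ⟨l, rfl⟩ := Nat.exists_eq_add_of_lt hk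
      have hf : ((k + 1 : ℕ).factorial : ℝ) = (k + 1) * k.factorial := by
        rw [Nat.factorial_succ]; push_cast; ring
      have hk0 : (k.factorial : ℝ) ≠ 0 := by exact_mod_cast k.factorial_ne_zero
      have hk1 : (k + 1 : ℝ) ≠ 0 := by positivity
      simp only [facCoeff]
      rw [hf, poch_succ _ k, poch_succ _ k, show k + l + 1 - k = l + 1 by omega,
        show k + l + 1 - (k + 1) = l by omega,
        poch_succ_left (2 * T + b - b0 + k), poch_succ_left (T + b' + z + k),
        poch_succ_left (T - z + k)]
      push_cast
      rw [show 2 * T + b - b0 + ((k : ℝ) + 1) = 2 * T + b - b0 + k + 1 by ring,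
        show T + b' + z + ((k : ℝ) + 1) = T + b' + z + k + 1 by ring,
        show T - z + ((k : ℝ) + 1) = T - z + k + 1 by ring]
      generalize poch (T + b' + z + k + 1) l = X
      generalize poch (2 * T + b - b0 + k + 1) l = Z
      generalize poch (T - z + k + 1) l = W
      generalize poch (-((k : ℝ) + l + 1)) k = U
      generalize poch ((k : ℝ) + l + 1 + 2 * T + b' - b0 - 1) k = V
      field_simp
      ring

/-- The companion contiguous relation in the parameter `z`, needed to propagate `raiseOp` from `m`
to `m + 1` variables: the scalar for `T` goes in through `threeTerm` and the one for `T + n` comes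
out. -/
theorem threeTerm_fac_shift (n : ℕ) (T b b' b0 x z : ℝ) (h0 : 2 * x + b ≠ 0)
    (h1 : 2 * x + b + 1 ≠ 0) (h2 : 2 * x + b - 1 ≠ 0) :
    threeTerm (fun y => (y + z + b') * (y + z + b' + 1)) T b b0 1
        (fun y => fac n T b b' b0 y (z + 1)) x +
      (z + b' - b0) * (z + b') * fac n T b b' b0 x (z + 1) =
      (z + b' - b0 + (T + n)) * (z + b' + (T + n)) * fac n T b b' b0 x z := by
  have hQ : (fun y : ℝ => (y + z + b') * (y + z + b' + 1)) =
      fun y => 1 * y ^ 2 + (2 * (z + b') + 1) * y + (z + b') * (z + b' + 1) := by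
    ext y; ring
  simp only [fac_eq_sum]
  rw [hQ, threeTerm_sum, Finset.mul_sum, ← Finset.sum_add_distrib]
  have hc : ∀ k, facCoeff n T b b' b0 (z + 1) k * threeTerm (fun y => 1 * y ^ 2 +
      (2 * (z + b') + 1) * y + (z + b') * (z + b' + 1)) T b b0 1 (wilsonBasis T b k) x +
      (z + b' - b0) * (z + b') * (facCoeff n T b b' b0 (z + 1) k * wilsonBasis T b k x) =
      facCoeff n T b b' b0 (z + 1) k * (threeTerm (fun y => 1 * y ^ 2 +
      (2 * (z + b') + 1) * y + (z + b') * (z + b' + 1)) T b b0 1 (wilsonBasis T b k) x +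
      (z + b' - b0) * (z + b') * wilsonBasis T b k x) := fun k => by ring
  rw [Finset.sum_congr rfl fun k _ => hc k]
  refine sum_wilsonBasis_telescope T b x n _ _
    (fun k => (T * ((2 * (z + b') + 1) - 1 * b) + 1 * (T * (T - 1 + b - b0))) +
      k * ((2 * (z + b') + 1) + 1 * (k - 1 + 2 * T - b0)) + (z + b' - b0) * (z + b'))
    (fun k => (k + 1) * ((1 * (T + k) ^ 2 + (2 * (z + b') + 1) * (T + k) + (z + b') * (z + b' + 1)) *
      (2 * T + k + b - b0)))
    _ _ ?_ ?_ (facCoeff_eq_zero _ _ _ _ _ _) ?_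
  · rw [threeTerm_wilsonBasis_zero _ _ _ _ _ _ _ h0 h1 h2]
    simp [wilsonBasis, poch_zero]
  · intro k
    rw [threeTerm_wilsonBasis_succ _ _ _ _ _ _ _ _ h0 h1 h2]
    push_cast; ring
  · intro k hk
    rcases hk.eq_or_lt with rfl | hk
    · rw [facCoeff_eq_zero]
      simp [facCoeff, poch_zero]; ring
    · obtain ⟨l, rfl⟩ := Nat.exists_eq_add_of_lt hk
      have hf : ((k + 1 : ℕ).factorial : ℝ) = (k + 1) * k.factorial := by
        rw [Nat.factorial_succ]; push_cast; ring
      have hk0 : (k.factorial : ℝ) ≠ 0 := by exact_mod_cast k.factorial_ne_zero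
      have hk1 : (k + 1 : ℝ) ≠ 0 := by positivity
      have p1 : (T + b' + z + k + 1) * poch (T + b' + z + k + 2) l =
          poch (T + b' + z + k + 1) l * (T + b' + z + k + 1 + l) := by
        rw [← poch_succ, poch_succ_left]; congr 2; ring
      simp only [facCoeff]
      rw [hf, poch_succ _ k, poch_succ _ k, show k + l + 1 - k = l + 1 by omega,
        show k + l + 1 - (k + 1) = l by omega,
        poch_succ_left (2 * T + b - b0 + k), poch_succ_left (T + b' + z + k),
        poch_succ (T - z + k), poch_succ (T + b' + (z + 1) + k), poch_succ_left (T - (z + 1) + k)]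
      push_cast
      rw [show T + b' + (z + 1) + ((k : ℝ) + 1) = T + b' + z + k + 2 by ring,
        show T + b' + (z + 1) + (k : ℝ) = T + b' + z + k + 1 by ring,
        show T - (z + 1) + ((k : ℝ) + 1) = T - z + k by ring,
        show T - (z + 1) + (k : ℝ) + 1 = T - z + k by ring,
        show 2 * T + b - b0 + ((k : ℝ) + 1) = 2 * T + b - b0 + k + 1 by ring]
      generalize poch (T + b' + z + k + 1) l = X at *
      generalize poch (T + b' + z + k + 2) l = Y at *
      generalize poch (2 * T + b - b0 + k + 1) l = Z
      generalize poch (T - z + k) l = W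
      generalize poch (-((k : ℝ) + l + 1)) k = U
      generalize poch ((k : ℝ) + l + 1 + 2 * T + b' - b0 - 1) k = V
      field_simp
      linear_combination (-(U * V * Z * W * (T + b' + z + k) * (2 * T + k + b - b0) *
        (-(l : ℝ) - 1) * (2 * k + l + 2 * T + b' - b0))) * p1

/-! ### The chain operators -/

/-- The quadratic `(y + b + x)(x - y)`. -/
def quadZero (b x : ℝ) (y : ℝ) : ℝ := (y + b + x) * (x - y)
/-- The quadratic `(y + x + b)(y + x + b + 1)`. -/
def quadPlus (b x : ℝ) (y : ℝ) : ℝ := (y + x + b) * (y + x + b + 1)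
/-- The quadratic `(y - x)(y - x + 1)`, obtained from `quadPlus` by `x ↦ -x - b`. -/
def quadMinus (x : ℝ) (y : ℝ) : ℝ := (y - x) * (y - x + 1)

theorem quadMinus_eq (b x : ℝ) : quadMinus x = quadPlus b (-x - b) := by
  ext y; simp only [quadMinus, quadPlus]; ring

/-- Translation of the `m`-th coordinate. -/
def bump (m : ℕ) (s : ℝ) (y : ℕ → ℝ) : ℕ → ℝ := Function.update y m (y m + s)

/-- The operators `∑_ν (-1)^{|ν⁻|} A_ν △^{ν⁺} ∇^{ν⁻}`, `ν ∈ {-1,0,1}^m ∖ {0}`, where the last factor of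
`A_ν` is replaced by the value of `Q` at the last (possibly reflected) position of the chain.
They are built by recursion on the number of variables. -/
def chainOp (B : ℕ → ℝ) (b0 : ℝ) : ℕ → (ℝ → ℝ) → ((ℕ → ℝ) → ℝ) → (ℕ → ℝ) → ℝ
  | 0, _, _, _ => 0
  | m + 1, Q, f, x => chainOp B b0 m Q f x +
      Q (x m) / ((2 * x m + B m) * (2 * x m + B m + 1)) *
        ((x m + B m - b0) * (x m + B m) * (f (bump m 1 x) - f x) +
          chainOp B b0 m (quadPlus (B m) (x m)) (fun y => f (bump m 1 y) - f y) x) -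
      Q (-x m - B m) / ((2 * x m + B m) * (2 * x m + B m - 1)) *
        (x m * (x m + b0) * (f x - f (bump m (-1) x)) +
          chainOp B b0 m (quadMinus (x m)) (fun y => f y - f (bump m (-1) y)) x)

variable {B : ℕ → ℝ} {b0 : ℝ}

theorem chainOp_lin (m : ℕ) (Q : ℝ → ℝ) (a c : ℝ) (f g : (ℕ → ℝ) → ℝ) (x : ℕ → ℝ) :
    chainOp B b0 m Q (fun y => a * f y + c * g y) x =
      a * chainOp B b0 m Q f x + c * chainOp B b0 m Q g x := by
  induction m generalizing Q f g with
  | zero => simp [chainOp]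
  | succ m ih =>
    simp only [chainOp]
    have h1 : (fun y => a * f (bump m 1 y) + c * g (bump m 1 y) - (a * f y + c * g y)) =
        fun y => a * (f (bump m 1 y) - f y) + c * (g (bump m 1 y) - g y) := by ext y; ring
    have h2 : (fun y => a * f y + c * g y - (a * f (bump m (-1) y) + c * g (bump m (-1) y))) =
        fun y => a * (f y - f (bump m (-1) y)) + c * (g y - g (bump m (-1) y)) := by ext y; ring
    rw [h1, h2, ih, ih, ih]
    ring

theorem chainOp_smul (m : ℕ) (Q : ℝ → ℝ) (a : ℝ) (f : (ℕ → ℝ) → ℝ) (x : ℕ → ℝ) :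
    chainOp B b0 m Q (fun y => a * f y) x = a * chainOp B b0 m Q f x := by
  have := chainOp_lin (B := B) (b0 := b0) m Q a 0 f f x
  simpa using this

theorem chainOp_sub (m : ℕ) (Q : ℝ → ℝ) (f g : (ℕ → ℝ) → ℝ) (x : ℕ → ℝ) :
    chainOp B b0 m Q (fun y => f y - g y) x = chainOp B b0 m Q f x - chainOp B b0 m Q g x := by
  have := chainOp_lin (B := B) (b0 := b0) m Q 1 (-1) f g x
  simpa [← sub_eq_add_neg] using this

/-- `Q` enters only through its values at the positions and their reflections, one value per chain,
so the operator is linear in `Q`. -/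
theorem chainOp_quad (m : ℕ) (Q Q1 Q2 Q3 : ℝ → ℝ) (a1 a2 a3 : ℝ)
    (hQ : ∀ y, Q y = a1 * Q1 y + a2 * Q2 y + a3 * Q3 y) (f : (ℕ → ℝ) → ℝ) (x : ℕ → ℝ) :
    chainOp B b0 m Q f x = a1 * chainOp B b0 m Q1 f x + a2 * chainOp B b0 m Q2 f x +
      a3 * chainOp B b0 m Q3 f x := by
  induction m with
  | zero => simp [chainOp]
  | succ m ih =>
    simp only [chainOp]
    rw [ih, hQ, hQ]
    ring

/-- The points which `chainOp m` reaches from `x`. -/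
def Near (m : ℕ) (x y : ℕ → ℝ) : Prop :=
  (∀ i, m ≤ i → y i = x i) ∧ ∀ i, y i = x i ∨ y i = x i + 1 ∨ y i = x i - 1

theorem Near.refl (m : ℕ) (x : ℕ → ℝ) : Near m x x := ⟨fun _ _ => rfl, fun _ => Or.inl rfl⟩

theorem Near.succ {m : ℕ} {x y : ℕ → ℝ} (h : Near m x y) : Near (m + 1) x y :=
  ⟨fun i hi => h.1 i (by omega), h.2⟩

theorem Near.bump {m : ℕ} {x y : ℕ → ℝ} (h : Near m x y) {s : ℝ} (hs : s = 1 ∨ s = -1) :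
    Near (m + 1) x (bump m s y) := by
  refine ⟨fun i hi => ?_, fun i => ?_⟩
  · rw [Racah.bump, Function.update_of_ne (by omega)]; exact h.1 i (by omega)
  · by_cases hi : i = m
    · subst hi
      rw [Racah.bump, Function.update_self, h.1 _ le_rfl]
      rcases hs with rfl | rfl
      · exact Or.inr (Or.inl rfl)
      · exact Or.inr (Or.inr (by ring))
    · rw [Racah.bump, Function.update_of_ne hi]; exact h.2 i

theorem chainOp_congr (m : ℕ) (Q : ℝ → ℝ) (f g : (ℕ → ℝ) → ℝ) (x : ℕ → ℝ)
    (h : ∀ y, Near m x y → f y = g y) : chainOp B b0 m Q f x = chainOp B b0 m Q g x := by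
  induction m generalizing Q f g with
  | zero => simp [chainOp]
  | succ m ih =>
    simp only [chainOp]
    rw [ih Q f g fun y hy => h y hy.succ,
      ih _ (fun y => f (bump m 1 y) - f y) (fun y => g (bump m 1 y) - g y) fun y hy => by
        rw [h y hy.succ, h _ (hy.bump (Or.inl rfl))],
      ih _ (fun y => f y - f (bump m (-1) y)) (fun y => g y - g (bump m (-1) y)) fun y hy => by
        rw [h y hy.succ, h _ (hy.bump (Or.inr rfl))],
      h x (Near.refl _ _), h _ ((Near.refl m x).bump (Or.inl rfl)),
      h _ ((Near.refl m x).bump (Or.inr rfl))]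

theorem chainOp_eq_zero (m : ℕ) (Q : ℝ → ℝ) (f : (ℕ → ℝ) → ℝ) (x : ℕ → ℝ)
    (h : ∀ y, Near m x y → f y = 0) : chainOp B b0 m Q f x = 0 := by
  rw [chainOp_congr m Q f (fun y => 0 * f y) x fun y hy => by rw [h y hy, zero_mul],
    chainOp_smul, zero_mul]

/-- The operator with quadratic `quadPlus` together with its term of order `0`. -/
def raiseOp (B : ℕ → ℝ) (b0 : ℝ) (m : ℕ) (z : ℝ) (f : (ℕ → ℝ) → ℝ) (x : ℕ → ℝ) : ℝ :=
  (z + B m - b0) * (z + B m) * f x + chainOp B b0 m (quadPlus (B m) z) f x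

theorem raiseOp_congr (m : ℕ) (z : ℝ) (f g : (ℕ → ℝ) → ℝ) (x : ℕ → ℝ)
    (h : ∀ y, Near m x y → f y = g y) : raiseOp B b0 m z f x = raiseOp B b0 m z g x := by
  rw [raiseOp, raiseOp, chainOp_congr m _ f g x h, h x (Near.refl _ _)]

theorem raiseOp_smul (m : ℕ) (z a : ℝ) (f : (ℕ → ℝ) → ℝ) (x : ℕ → ℝ) :
    raiseOp B b0 m z (fun y => a * f y) x = a * raiseOp B b0 m z f x := by
  rw [raiseOp, raiseOp, chainOp_smul]; ring

/-- Interpolation at `x m` and `-x m - B m`, where `quadZero` vanishes and `quadPlus`, `quadMinus`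
each vanish at one of the points, writes `Q` as `u quadPlus + v quadMinus + (u + v - q2) quadZero`
with the `u` and `v` already present in the recursion; the last coefficient matches the leading
terms. With this expansion all terms in which `quadPlus` or `quadMinus` act on the unshifted `f`
cancel. -/
theorem chainOp_succ (m : ℕ) (q2 q1 q0 : ℝ) (Q : ℝ → ℝ) (hQ : ∀ y, Q y = q2 * y ^ 2 + q1 * y + q0)
    (f : (ℕ → ℝ) → ℝ) (x : ℕ → ℝ) (h0 : 2 * x m + B m ≠ 0)
    (h1 : 2 * x m + B m + 1 ≠ 0) (h2 : 2 * x m + B m - 1 ≠ 0) :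
    chainOp B b0 (m + 1) Q f x =
      Q (x m) / ((2 * x m + B m) * (2 * x m + B m + 1)) *
        raiseOp B b0 m (x m) (fun y => f (bump m 1 y)) x +
      Q (-x m - B m) / ((2 * x m + B m) * (2 * x m + B m - 1)) *
        raiseOp B b0 m (-x m - B m) (fun y => f (bump m (-1) y)) x +
      (Q (x m) / ((2 * x m + B m) * (2 * x m + B m + 1)) +
        Q (-x m - B m) / ((2 * x m + B m) * (2 * x m + B m - 1)) - q2) *
        chainOp B b0 m (quadZero (B m) (x m)) f x -
      (Q (x m) / ((2 * x m + B m) * (2 * x m + B m + 1)) * ((x m + B m - b0) * (x m + B m)) +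
        Q (-x m - B m) / ((2 * x m + B m) * (2 * x m + B m - 1)) * (x m * (x m + b0))) * f x := by
  have hu : (2 * x m + B m + 1) / ((2 * x m + B m) * (2 * x m + B m + 1)) = (2 * x m + B m)⁻¹ := by
    field_simp
  have hv : (2 * x m + B m - 1) / ((2 * x m + B m) * (2 * x m + B m - 1)) = (2 * x m + B m)⁻¹ := by
    field_simp
  have hw : (2 * x m + B m) * (2 * x m + B m)⁻¹ = 1 := mul_inv_cancel₀ h0
  have hQQ := chainOp_quad (B := B) (b0 := b0) m Q (quadPlus (B m) (x m)) (quadMinus (x m))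
    (quadZero (B m) (x m)) (Q (x m) / ((2 * x m + B m) * (2 * x m + B m + 1)))
    (Q (-x m - B m) / ((2 * x m + B m) * (2 * x m + B m - 1)))
    (Q (x m) / ((2 * x m + B m) * (2 * x m + B m + 1)) +
        Q (-x m - B m) / ((2 * x m + B m) * (2 * x m + B m - 1)) - q2) (by
      intro y
      simp only [hQ, quadPlus, quadMinus, quadZero]
      linear_combination (-(q2 * x m ^ 2 + q1 * x m + q0) * (y + x m + B m)) * hu +
        ((q2 * (-x m - B m) ^ 2 + q1 * (-x m - B m) + q0) * (y - x m)) * hv -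
        (q2 * y ^ 2 + q1 * y + q0 - q2 * (y + B m + x m) * (y - x m)) * hw) f x
  simp only [chainOp]
  rw [chainOp_sub, chainOp_sub, hQQ, raiseOp, raiseOp, ← quadMinus_eq]
  ring

/-! ### The eigenvalue equation -/

/-- The product of the first `m` factors of `R_p`. -/
def chainProd (n : ℕ → ℕ) (B : ℕ → ℝ) (b0 : ℝ) (m : ℕ) (x : ℕ → ℝ) : ℝ :=
  ∏ k ∈ Finset.range m, fac (n k) (∑ i ∈ Finset.range k, (n i : ℝ)) (B k) (B (k + 1)) b0 (x k) (x (k + 1))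

theorem fac_reflect (n : ℕ) (T b b' b0 x z : ℝ) : fac n T b b' b0 x (-z - b') = fac n T b b' b0 x z := by
  simp only [fac, hyp]
  refine Finset.sum_congr rfl fun k _ => ?_
  rw [show T + b' + (-z - b') = T - z by ring, show T - (-z - b') = T + b' + z by ring]
  ring

theorem chainProd_congr (n : ℕ → ℕ) (m : ℕ) (x y : ℕ → ℝ) (h : ∀ i ≤ m, x i = y i) :
    chainProd n B b0 m x = chainProd n B b0 m y := by
  unfold chainProd
  refine Finset.prod_congr rfl fun k hk => ?_
  have : k < m := Finset.mem_range.mp hk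
  rw [h k (by omega), h (k + 1) (by omega)]

theorem chainProd_update_succ (n : ℕ → ℕ) (m : ℕ) (y : ℕ → ℝ) (z : ℝ) :
    chainProd n B b0 (m + 1) (Function.update y (m + 1) z) =
      fac (n m) (∑ i ∈ Finset.range m, (n i : ℝ)) (B m) (B (m + 1)) b0 (y m) z *
        chainProd n B b0 m y := by
  rw [chainProd, Finset.prod_range_succ, mul_comm, Function.update_self,
    Function.update_of_ne (by omega)]
  congr 1
  exact chainProd_congr n m _ _ fun i hi => by rw [Function.update_of_ne (by omega)]

theorem chainProd_reflect (n : ℕ → ℕ) (m : ℕ) (y : ℕ → ℝ) (z : ℝ) :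
    chainProd n B b0 m (Function.update y m (-z - B m)) =
      chainProd n B b0 m (Function.update y m z) := by
  cases m with
  | zero => simp [chainProd]
  | succ m => rw [chainProd_update_succ, chainProd_update_succ, fac_reflect]

/-- The two statements need each other: by `chainOp_succ` each of them for `m + 1` variables uses
the eigenvalue equation and the raising relation for `m`. The value `z` overwrites the coordinate
after the last moving one, so it acts as a free parameter, and no lowering relation is needed
because the product is invariant under `z ↦ -z - B m`. -/
theorem chainProd_eigen (n : ℕ → ℕ) (m : ℕ) (x : ℕ → ℝ)
    (hx : ∀ i < m, 2 * x i + B i ≠ 0 ∧ 2 * x i + B i + 1 ≠ 0 ∧ 2 * x i + B i - 1 ≠ 0) (z : ℝ) :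
    chainOp B b0 m (quadZero (B m) z) (fun y => chainProd n B b0 m (Function.update y m z)) x =
        -(∑ i ∈ Finset.range m, (n i : ℝ)) * ((∑ i ∈ Finset.range m, (n i : ℝ)) - 1 + B m - b0) *
          chainProd n B b0 m (Function.update x m z) ∧
      raiseOp B b0 m z (fun y => chainProd n B b0 m (Function.update y m (z + 1))) x =
        (z + B m - b0 + ∑ i ∈ Finset.range m, (n i : ℝ)) * (z + B m + ∑ i ∈ Finset.range m, (n i : ℝ)) *
          chainProd n B b0 m (Function.update x m z) := by
  induction m generalizing z with
  | zero => simp [chainOp, raiseOp, chainProd]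
  | succ m ih =>
    have ih := ih fun i hi => hx i (by omega)
    obtain ⟨h0, h1, h2⟩ := hx m (by omega)
    set T := ∑ i ∈ Finset.range m, (n i : ℝ) with hT
    -- By the induction hypotheses the first `m` variables contribute only scalars, and `threeTerm`
    -- is precisely the operator left in the variable `x m`.
    have key : ∀ (q2 q1 q0 : ℝ) (Q : ℝ → ℝ) (z : ℝ), (∀ y, Q y = q2 * y ^ 2 + q1 * y + q0) →
        chainOp B b0 (m + 1) Q (fun y => chainProd n B b0 (m + 1) (Function.update y (m + 1) z)) x =
          threeTerm Q T (B m) b0 q2 (fun y => fac (n m) T (B m) (B (m + 1)) b0 y z) (x m) *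
            chainProd n B b0 m x := by
      intro q2 q1 q0 Q z hQ
      simp only [chainProd_update_succ]
      rw [chainOp_succ m q2 q1 q0 Q hQ _ x h0 h1 h2]
      have e1 : raiseOp B b0 m (x m) (fun y => fac (n m) T (B m) (B (m + 1)) b0 (bump m 1 y m) z *
          chainProd n B b0 m (bump m 1 y)) x =
          fac (n m) T (B m) (B (m + 1)) b0 (x m + 1) z *
            ((x m + B m - b0 + T) * (x m + B m + T) * chainProd n B b0 m x) := by
        have := (ih (x m)).2
        rw [Function.update_eq_self] at this
        rw [← this, ← raiseOp_smul]
        refine raiseOp_congr _ _ _ _ _ fun y hy => ?_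
        rw [bump, Function.update_self, hy.1 m le_rfl]
      -- Lowering `x m` by one raises its reflection `-x m - B m` by one, so the raising relation at
      -- the reflected parameter applies.
      have e2 : raiseOp B b0 m (-x m - B m) (fun y => fac (n m) T (B m) (B (m + 1)) b0 (bump m (-1) y m) z *
          chainProd n B b0 m (bump m (-1) y)) x =
          fac (n m) T (B m) (B (m + 1)) b0 (x m - 1) z *
            ((-x m - b0 + T) * (-x m + T) * chainProd n B b0 m x) := by
        have := (ih (-x m - B m)).2
        rw [chainProd_reflect, Function.update_eq_self] at this
        rw [show (-x m - b0 + T) * (-x m + T) * chainProd n B b0 m x =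
          (-x m - B m + B m - b0 + T) * (-x m - B m + B m + T) * chainProd n B b0 m x by ring, ← this,
          ← raiseOp_smul]
        refine raiseOp_congr _ _ _ _ _ fun y hy => ?_
        rw [show -x m - B m + 1 = -(x m - 1) - B m by ring, chainProd_reflect, bump,
          Function.update_self, hy.1 m le_rfl, sub_eq_add_neg (x m)]
      have e3 : chainOp B b0 m (quadZero (B m) (x m)) (fun y => fac (n m) T (B m) (B (m + 1)) b0 (y m) z *
          chainProd n B b0 m y) x =
          fac (n m) T (B m) (B (m + 1)) b0 (x m) z * (-T * (T - 1 + B m - b0) * chainProd n B b0 m x) := by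
        have := (ih (x m)).1
        rw [Function.update_eq_self] at this
        rw [← this, ← chainOp_smul]
        refine chainOp_congr _ _ _ _ _ fun y hy => ?_
        rw [← hy.1 m le_rfl, Function.update_eq_self]
      rw [e1, e2, e3, threeTerm]
      ring
    constructor
    · rw [key (-1) (-B (m + 1)) (z * (B (m + 1) + z)) _ z fun y => by rw [quadZero]; ring]
      have := threeTerm_fac (n m) T (B m) (B (m + 1)) b0 (x m) z h0 h1 h2
      rw [chainProd_update_succ, Finset.sum_range_succ, ← hT]
      unfold quadZero
      rw [this]
      ring
    · rw [raiseOp, key 1 (2 * (z + B (m + 1)) + 1) ((z + B (m + 1)) * (z + B (m + 1) + 1)) _ (z + 1)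
        fun y => by rw [quadPlus]; ring]
      have := threeTerm_fac_shift (n m) T (B m) (B (m + 1)) b0 (x m) z h0 h1 h2
      rw [chainProd_update_succ, chainProd_update_succ, Finset.sum_range_succ, ← hT]
      unfold quadPlus
      linear_combination (chainProd n B b0 m x) * this

/-! ### Vanishing of coefficients at the boundary -/

/-- The differences of consecutive `y_k + B_k`, `k ≤ m`, are natural numbers. -/
def GapsNat (B : ℕ → ℝ) (m : ℕ) (y : ℕ → ℝ) : Prop :=
  ∀ k < m, ∃ g : ℕ, y k + B k - (y (k + 1) + B (k + 1)) = g

theorem GapsNat.of_succ {m : ℕ} {y : ℕ → ℝ} {z : ℝ}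
    (h : GapsNat B (m + 1) (Function.update y (m + 1) z)) : GapsNat B m y := by
  intro k hk
  have := h k (by omega)
  rwa [Function.update_of_ne (by omega), Function.update_of_ne (by omega)] at this

theorem GapsNat.succ {m : ℕ} {y : ℕ → ℝ} {z : ℝ} (h : GapsNat B m y)
    (hz : ∃ g : ℕ, y m + B m - (z + B (m + 1)) = g) :
    GapsNat B (m + 1) (Function.update y (m + 1) z) := by
  intro k hk
  rw [Function.update_of_ne (by omega)]
  rcases Nat.lt_succ_iff_lt_or_eq.mp hk with h1 | rfl
  · rw [Function.update_of_ne (by omega)]; exact h k h1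
  · rw [Function.update_self]; exact hz

/-- The cone of sequences with natural gaps is invariant: a step leaving it has coefficient zero.
The same induction as for the eigenvalue equation works, with three clauses because the endpoint `z`
may stay, move up, or move down, the last being a raise of its reflection. -/
theorem chainOp_vanish (m : ℕ) (x : ℕ → ℝ)
    (hx : ∀ i < m, 2 * x i + B i ≠ 0 ∧ 2 * x i + B i + 1 ≠ 0 ∧ 2 * x i + B i - 1 ≠ 0)
    (z : ℝ) (f : (ℕ → ℝ) → ℝ) (hg : GapsNat B m (Function.update x m z)) :
    ((∀ y, Near m x y → GapsNat B m (Function.update y m z) → f y = 0) →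
      chainOp B b0 m (quadZero (B m) z) f x = 0) ∧
    ((∀ y, Near m x y → GapsNat B m (Function.update y m (z + 1)) → f y = 0) →
      raiseOp B b0 m z f x = 0) ∧
    ((∀ y, Near m x y → GapsNat B m (Function.update y m (z - 1)) → f y = 0) →
      raiseOp B b0 m (-z - B m) f x = 0) := by
  induction m generalizing z f with
  | zero =>
    have h0 : ∀ y, GapsNat B 0 y := fun y k hk => absurd hk (by omega)
    refine ⟨fun _ => rfl, fun h => ?_, fun h => ?_⟩ <;>
      simp [raiseOp, chainOp, h x (Near.refl _ _) (h0 _)]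
  | succ m ih =>
    have ih := ih fun i hi => hx i (by omega)
    obtain ⟨h0, h1, h2⟩ := hx m (by omega)
    obtain ⟨g, hg0⟩ := hg m (by omega)
    rw [Function.update_self, Function.update_of_ne (by omega)] at hg0
    have hgm : GapsNat B m x := hg.of_succ
    have hgm' : GapsNat B m (Function.update x m (x m)) := by rwa [Function.update_eq_self]
    -- the three kinds of terms in the recursion
    have plus : ∀ z', (∃ g : ℕ, x m + 1 + B m - (z' + B (m + 1)) = g) →
        (∀ y, Near (m + 1) x y → GapsNat B (m + 1) (Function.update y (m + 1) z') → f y = 0) →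
        raiseOp B b0 m (x m) (fun y => f (bump m 1 y)) x = 0 := by
      intro z' hz' hf
      refine (ih (x m) _ hgm').2.1 fun y hy hgy => hf _ (hy.bump (Or.inl rfl)) ?_
      rw [bump, hy.1 m le_rfl]
      exact hgy.succ (by rw [Function.update_self]; exact hz')
    have minus : ∀ z', (∃ g : ℕ, x m - 1 + B m - (z' + B (m + 1)) = g) →
        (∀ y, Near (m + 1) x y → GapsNat B (m + 1) (Function.update y (m + 1) z') → f y = 0) →
        raiseOp B b0 m (-x m - B m) (fun y => f (bump m (-1) y)) x = 0 := by
      intro z' hz' hf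
      refine (ih (x m) _ hgm').2.2 fun y hy hgy => hf _ (hy.bump (Or.inr rfl)) ?_
      rw [bump, hy.1 m le_rfl, ← sub_eq_add_neg]
      exact hgy.succ (by rw [Function.update_self]; exact hz')
    have zero : ∀ z', (∃ g : ℕ, x m + B m - (z' + B (m + 1)) = g) →
        (∀ y, Near (m + 1) x y → GapsNat B (m + 1) (Function.update y (m + 1) z') → f y = 0) →
        chainOp B b0 m (quadZero (B m) (x m)) f x = 0 ∧ f x = 0 := by
      intro z' hz' hf
      refine ⟨(ih (x m) _ hgm').1 fun y hy hgy => hf _ hy.succ ?_,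
        hf x (Near.refl _ _) (hgm.succ hz')⟩
      rw [← hy.1 m le_rfl, Function.update_eq_self] at hgy
      exact hgy.succ (by rw [hy.1 m le_rfl]; exact hz')
    refine ⟨fun hf => ?_, fun hf => ?_, fun hf => ?_⟩
    · obtain ⟨e1, e2⟩ := zero z ⟨g, hg0⟩ hf
      rw [chainOp_succ m (-1) (-B (m + 1)) (z * (B (m + 1) + z)) _ (fun y => by rw [quadZero]; ring)
        f x h0 h1 h2, plus z ⟨g + 1, by push_cast; linarith⟩ hf, e1, e2]
      -- With gap `0` a downward step of `x m` would leave the cone, but there the reflected value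
      -- of `quadZero` is zero.
      rcases Nat.eq_zero_or_pos g with rfl | hpos
      · have : quadZero (B (m + 1)) z (-x m - B m) = 0 := by
          rw [quadZero, show -x m - B m + B (m + 1) + z = 0 by push_cast at hg0; linarith, zero_mul]
        rw [this]; ring
      · rw [minus z ⟨g - 1, by rw [Nat.cast_sub hpos]; push_cast; linarith⟩ hf]
        ring
    · rw [raiseOp, chainOp_succ m 1 (2 * (z + B (m + 1)) + 1) ((z + B (m + 1)) * (z + B (m + 1) + 1)) _
        (fun y => by rw [quadPlus]; ring) f x h0 h1 h2, plus (z + 1) ⟨g, by linarith⟩ hf]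
      -- Raising the endpoint costs one unit of gap. With gap `0` only the simultaneous raise of `x
      -- m` is admissible: the quotient multiplying it is `1`, and the zero-order terms of `raiseOp`
      -- and of the recursion cancel.
      rcases Nat.eq_zero_or_pos g with rfl | hpos
      · have ez : z = x m + B m - B (m + 1) := by push_cast at hg0; linarith
        have e1 : quadPlus (B (m + 1)) z (-x m - B m) = 0 := by
          rw [quadPlus, ez]; ring
        have e2 : quadPlus (B (m + 1)) z (x m) = (2 * x m + B m) * (2 * x m + B m + 1) := by
          rw [quadPlus, ez]; ring
        rw [e1, e2, div_self (mul_ne_zero h0 h1), ez]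
        ring
      · obtain ⟨e1, e2⟩ := zero (z + 1) ⟨g - 1, by rw [Nat.cast_sub hpos]; push_cast; linarith⟩ hf
        rw [e1, e2]
        -- The downward step of `x m` together with the raised endpoint costs two units; at gap `1`
        -- its coefficient vanishes through the second factor of `quadPlus`.
        rcases Nat.eq_or_lt_of_le hpos with h | h
        · have : quadPlus (B (m + 1)) z (-x m - B m) = 0 := by
            rw [quadPlus, show -x m - B m + z + B (m + 1) + 1 = 0 by
              rw [← h] at hg0; push_cast at hg0; linarith, mul_zero]
          rw [this]; ring
        · rw [minus (z + 1) ⟨g - 2, by rw [Nat.cast_sub h]; push_cast; linarith⟩ hf]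
          ring
    · obtain ⟨e1, e2⟩ := zero (z - 1) ⟨g + 1, by push_cast; linarith⟩ hf
      rw [raiseOp, ← quadMinus_eq, chainOp_succ m 1 (-2 * z + 1) (z * (z - 1)) _
        (fun y => by rw [quadMinus]; ring) f x h0 h1 h2, plus (z - 1) ⟨g + 2, by push_cast; linarith⟩ hf,
        minus (z - 1) ⟨g, by linarith⟩ hf, e1, e2]
      ring

/-! ### Evaluation of rational functions -/

section Evaluation

variable {p : ℕ}

/-- `f` is defined at `v` with value `r`. -/
def HasVal (v : Ind p → ℝ) (f : RatFun p) (r : ℝ) : Prop :=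
  ∃ a b : Poly p, f = algebraMap (Poly p) (RatFun p) a / algebraMap (Poly p) (RatFun p) b ∧
    MvPolynomial.eval v b ≠ 0 ∧ r = MvPolynomial.eval v a / MvPolynomial.eval v b

variable {v v' : Ind p → ℝ} {f g : RatFun p} {r s : ℝ}

theorem HasVal.definedAt (h : HasVal v f r) : RatDefinedAt v f := by
  obtain ⟨a, b, rfl, hb, -⟩ := h
  exact (ratValue_div v a b hb).1

theorem HasVal.value_eq (h : HasVal v f r) : ratValue v f = r := by
  obtain ⟨a, b, rfl, hb, rfl⟩ := h
  exact (ratValue_div v a b hb).2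

theorem num_div_den (f : RatFun p) :
    f = algebraMap (Poly p) (RatFun p) (IsFractionRing.num (Poly p) f) /
      algebraMap (Poly p) (RatFun p) (IsFractionRing.den (Poly p) f : Poly p) :=
  (IsFractionRing.mk'_num_den' (Poly p) f).symm

theorem RatDefinedAt.hasVal (h : RatDefinedAt v f) : HasVal v f (ratValue v f) :=
  ⟨_, _, num_div_den f, h, rfl⟩

theorem hasVal_poly (v : Ind p → ℝ) (a : Poly p) :
    HasVal v (algebraMap (Poly p) (RatFun p) a) (MvPolynomial.eval v a) :=
  ⟨a, 1, by simp, by simp, by simp⟩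

theorem hasVal_zero (v : Ind p → ℝ) : HasVal v 0 0 := by
  simpa using hasVal_poly v 0

theorem hasVal_one (v : Ind p → ℝ) : HasVal v 1 1 := by
  simpa using hasVal_poly v 1

theorem hasVal_const (v : Ind p → ℝ) (c : ℝ) : HasVal v (algebraMap ℝ (RatFun p) c) c := by
  have := hasVal_poly v (MvPolynomial.C c)
  rw [MvPolynomial.eval_C] at this
  rwa [IsScalarTower.algebraMap_apply ℝ (Poly p) (RatFun p)]

theorem algebraMap_ne_zero_of_eval {b : Poly p} (hb : MvPolynomial.eval v b ≠ 0) :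
    algebraMap (Poly p) (RatFun p) b ≠ 0 := by
  have : b ≠ 0 := by rintro rfl; simp at hb
  simpa using this

theorem HasVal.add (hf : HasVal v f r) (hg : HasVal v g s) : HasVal v (f + g) (r + s) := by
  obtain ⟨a, b, rfl, hb, rfl⟩ := hf
  obtain ⟨c, d, rfl, hd, rfl⟩ := hg
  refine ⟨a * d + b * c, b * d, ?_, by simp [hb, hd], ?_⟩
  · rw [div_add_div _ _ (algebraMap_ne_zero_of_eval hb) (algebraMap_ne_zero_of_eval hd)]
    simp
  · rw [div_add_div _ _ hb hd]; simp

theorem HasVal.mul (hf : HasVal v f r) (hg : HasVal v g s) : HasVal v (f * g) (r * s) := by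
  obtain ⟨a, b, rfl, hb, rfl⟩ := hf
  obtain ⟨c, d, rfl, hd, rfl⟩ := hg
  refine ⟨a * c, b * d, ?_, by simp [hb, hd], ?_⟩
  · rw [div_mul_div_comm]; simp
  · rw [div_mul_div_comm]; simp

theorem HasVal.neg (hf : HasVal v f r) : HasVal v (-f) (-r) := by
  have := (hasVal_const v (-1)).mul hf
  simpa using this

theorem HasVal.sub (hf : HasVal v f r) (hg : HasVal v g s) : HasVal v (f - g) (r - s) := by
  rw [sub_eq_add_neg, sub_eq_add_neg]; exact hf.add hg.neg

theorem HasVal.inv (hf : HasVal v f r) (hr : r ≠ 0) : HasVal v f⁻¹ r⁻¹ := by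
  obtain ⟨a, b, rfl, hb, rfl⟩ := hf
  refine ⟨b, a, by rw [inv_div], fun h => hr (by rw [h, zero_div]), by rw [inv_div]⟩

theorem HasVal.div (hf : HasVal v f r) (hg : HasVal v g s) (hs : s ≠ 0) :
    HasVal v (f / g) (r / s) := by
  rw [div_eq_mul_inv, div_eq_mul_inv]; exact hf.mul (hg.inv hs)

theorem HasVal.pow (hf : HasVal v f r) (k : ℕ) : HasVal v (f ^ k) (r ^ k) := by
  induction k with
  | zero => simpa using hasVal_one v
  | succ k ih => rw [pow_succ, pow_succ]; exact ih.mul hf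

theorem hasVal_list_prod {α : Type*} (l : List α) (F : α → RatFun p) (R : α → ℝ)
    (h : ∀ a ∈ l, HasVal v (F a) (R a)) : HasVal v (l.map F).prod (l.map R).prod := by
  induction l with
  | nil => simpa using hasVal_one v
  | cons a l ih =>
    simp only [List.map_cons, List.prod_cons]
    exact (h a (by simp)).mul (ih fun b hb => h b (by simp [hb]))

theorem HasVal.map (φ : Poly p ≃ₐ[ℝ] Poly p)
    (hφ : ∀ q, MvPolynomial.eval v (φ q) = MvPolynomial.eval v' q) (hf : HasVal v' f r) :
    HasVal v (IsFractionRing.algEquivOfAlgEquiv φ f : RatFun p) r := by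
  obtain ⟨a, b, rfl, hb, rfl⟩ := hf
  exact ⟨φ a, φ b, by simp, by rwa [hφ], by rw [hφ, hφ]⟩

/-- Regularity at a point is transported by any automorphism that corresponds to a substitution of
points; it is used for shifts and for `𝔟`. -/
theorem hasVal_map_iff (φ : Poly p ≃ₐ[ℝ] Poly p)
    (hφ : ∀ q, MvPolynomial.eval v (φ q) = MvPolynomial.eval v' q) :
    HasVal v (IsFractionRing.algEquivOfAlgEquiv φ f : RatFun p) r ↔ HasVal v' f r := by
  refine ⟨fun h => ?_, fun h => h.map φ hφ⟩
  obtain ⟨a, b, hab, hb, rfl⟩ := h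
  refine ⟨φ.symm a, φ.symm b, ?_, ?_, ?_⟩
  · apply (IsFractionRing.algEquivOfAlgEquiv φ : RatFun p ≃ₐ[ℝ] RatFun p).injective
    simp [hab]
  · rwa [← hφ, AlgEquiv.apply_symm_apply]
  · rw [← hφ, ← hφ, AlgEquiv.apply_symm_apply, AlgEquiv.apply_symm_apply]

theorem eval_shiftPoly (x : Fin p → ℝ) (β : Fin (p + 2) → ℝ) (N : ℝ) (ν : Shift p) (q : Poly p) :
    MvPolynomial.eval (point x β N) (shiftPoly p ν q) =
      MvPolynomial.eval (point (fun i => x i + (ν.toAdd i : ℝ)) β N) q := by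
  change MvPolynomial.eval (point x β N) (MvPolynomial.aeval (shiftImage ν.toAdd) q) = _
  have : ((MvPolynomial.aeval (R := ℝ) (point x β N)).comp
      (MvPolynomial.aeval (shiftImage ν.toAdd))) =
      MvPolynomial.aeval (point (fun i => x i + (ν.toAdd i : ℝ)) β N) := by
    apply MvPolynomial.algHom_ext
    rintro (i | k | _) <;> simp [shiftImage, point]
  simpa [MvPolynomial.aeval_eq_eval] using DFunLike.congr_fun this q

theorem hasVal_smul_iff {x : Fin p → ℝ} {β : Fin (p + 2) → ℝ} {N : ℝ} (ν : Shift p) :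
    HasVal (point x β N) (ν • f) r ↔
      HasVal (point (fun i => x i + (ν.toAdd i : ℝ)) β N) f r :=
  hasVal_map_iff (shiftPoly p ν) (eval_shiftPoly x β N ν)

end Evaluation

/-! ### The action of difference operators -/

section Action

variable {p : ℕ}

theorem definedAt_iff {v : Ind p → ℝ} {L : DiffOp p} :
    DefinedAt v L ↔ ∀ ν, RatDefinedAt v (L.coeff ν) := by
  refine ⟨fun h ν => ?_, fun h ν _ => h ν⟩
  by_cases hν : ν ∈ L.support
  · exact h ν hν
  · rw [SkewMonoidAlgebra.notMem_support_iff.mp hν]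
    exact (hasVal_zero v).definedAt

theorem DefinedAt.hasVal {v : Ind p → ℝ} {L : DiffOp p} (h : DefinedAt v L) (ν : Shift p) :
    HasVal v (L.coeff ν) (ratValue v (L.coeff ν)) := (definedAt_iff.mp h ν).hasVal

theorem definedAt_zero (v : Ind p → ℝ) : DefinedAt v (0 : DiffOp p) := by
  rw [definedAt_iff]; intro ν; simpa using (hasVal_zero v).definedAt

theorem DefinedAt.add {v : Ind p → ℝ} {L M : DiffOp p} (hL : DefinedAt v L) (hM : DefinedAt v M) :
    DefinedAt v (L + M) := by
  rw [definedAt_iff]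
  intro ν
  rw [SkewMonoidAlgebra.coeff_add]
  exact ((hL.hasVal ν).add (hM.hasVal ν)).definedAt

theorem definedAt_single {v : Ind p → ℝ} {f : RatFun p} (ν : Shift p) (hf : RatDefinedAt v f) :
    DefinedAt v (SkewMonoidAlgebra.single ν f) := by
  classical
  rw [definedAt_iff]
  intro μ
  rw [SkewMonoidAlgebra.coeff_single_apply]
  split_ifs
  · exact hf
  · exact (hasVal_zero v).definedAt

theorem definedAt_sum {v : Ind p → ℝ} {ι : Type*} (S : Finset ι) (F : ι → DiffOp p)
    (h : ∀ i ∈ S, DefinedAt v (F i)) : DefinedAt v (∑ i ∈ S, F i) := by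
  classical
  induction S using Finset.induction_on with
  | empty => simpa using definedAt_zero v
  | insert a S ha ih =>
    rw [Finset.sum_insert ha]
    exact (h a (by simp)).add (ih fun b hb => h b (by simp [hb]))

theorem eq_sum_single (L : DiffOp p) :
    L = ∑ ν ∈ L.support, SkewMonoidAlgebra.single ν (L.coeff ν) :=
  (SkewMonoidAlgebra.sum_single L).symm

theorem ratValue_zero (v : Ind p → ℝ) : ratValue v (0 : RatFun p) = 0 := (hasVal_zero v).value_eq

variable {β : Fin (p + 2) → ℝ} {N : ℝ} {x : Fin p → ℝ}

theorem actX_eq_sum (L : DiffOp p) (S : Finset (Shift p)) (hS : L.support ⊆ S)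
    (f : (Fin p → ℝ) → ℝ) : actX L β N f x =
      ∑ ν ∈ S, ratValue (point x β N) (L.coeff ν) * f (fun i => x i + (ν.toAdd i : ℝ)) := by
  refine Finset.sum_subset hS fun ν _ hν => ?_
  rw [SkewMonoidAlgebra.notMem_support_iff.mp hν, ratValue_zero, zero_mul]

theorem actX_zero (f : (Fin p → ℝ) → ℝ) : actX (0 : DiffOp p) β N f x = 0 := by
  simp [actX]

theorem actX_add {L M : DiffOp p} (hL : DefinedAt (point x β N) L) (hM : DefinedAt (point x β N) M)
    (f : (Fin p → ℝ) → ℝ) : actX (L + M) β N f x = actX L β N f x + actX M β N f x := by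
  classical
  rw [actX_eq_sum (L + M) (L.support ∪ M.support) SkewMonoidAlgebra.support_add,
    actX_eq_sum L (L.support ∪ M.support) Finset.subset_union_left,
    actX_eq_sum M (L.support ∪ M.support) Finset.subset_union_right, ← Finset.sum_add_distrib]
  refine Finset.sum_congr rfl fun ν _ => ?_
  rw [SkewMonoidAlgebra.coeff_add, Finsupp.add_apply, ((hL.hasVal ν).add (hM.hasVal ν)).value_eq, add_mul]

theorem actX_sum {ι : Type*} (S : Finset ι) (F : ι → DiffOp p)
    (h : ∀ i ∈ S, DefinedAt (point x β N) (F i)) (f : (Fin p → ℝ) → ℝ) :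
    actX (∑ i ∈ S, F i) β N f x = ∑ i ∈ S, actX (F i) β N f x := by
  classical
  induction S using Finset.induction_on with
  | empty => simp [actX_zero]
  | insert a S ha ih =>
    rw [Finset.sum_insert ha, Finset.sum_insert ha, actX_add (h a (by simp))
      (definedAt_sum S F fun b hb => h b (by simp [hb])), ih fun b hb => h b (by simp [hb])]

theorem actX_single (ν : Shift p) (c : RatFun p) (f : (Fin p → ℝ) → ℝ) :
    actX (SkewMonoidAlgebra.single ν c) β N f x =
      ratValue (point x β N) c * f (fun i => x i + (ν.toAdd i : ℝ)) := by
  rw [actX_eq_sum (SkewMonoidAlgebra.single ν c) {ν} (by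
    intro μ hμ
    classical
    by_contra hne
    rw [SkewMonoidAlgebra.mem_support_iff, SkewMonoidAlgebra.coeff_single_apply,
      if_neg fun h => hne (by simp [h])] at hμ
    exact hμ rfl)]
  simp [SkewMonoidAlgebra.coeff_single]

theorem actX_congr (L : DiffOp p) (f g : (Fin p → ℝ) → ℝ)
    (h : ∀ ν ∈ L.support, f (fun i => x i + (ν.toAdd i : ℝ)) = g (fun i => x i + (ν.toAdd i : ℝ))) :
    actX L β N f x = actX L β N g x :=
  Finset.sum_congr rfl fun ν hν => by rw [h ν hν]

theorem actX_smul (L : DiffOp p) (c : ℝ) (f : (Fin p → ℝ) → ℝ) :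
    actX L β N (fun y => c * f y) x = c * actX L β N f x := by
  rw [actX, actX, Finset.mul_sum]
  exact Finset.sum_congr rfl fun ν _ => by ring

theorem mul_eq_sum (L M : DiffOp p) :
    L * M = ∑ ν ∈ L.support, ∑ μ ∈ M.support,
      SkewMonoidAlgebra.single (ν * μ) (L.coeff ν * ν • M.coeff μ) := by
  conv_lhs => rw [eq_sum_single L, eq_sum_single M]
  rw [Finset.sum_mul_sum]
  simp only [SkewMonoidAlgebra.single_mul_single]

theorem DefinedAt.mul {L M : DiffOp p} (hL : DefinedAt (point x β N) L)
    (hM : ∀ ν ∈ L.support, DefinedAt (point (fun i => x i + (ν.toAdd i : ℝ)) β N) M) :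
    DefinedAt (point x β N) (L * M) := by
  rw [mul_eq_sum]
  refine definedAt_sum _ _ fun ν hν => definedAt_sum _ _ fun μ _ => definedAt_single _ ?_
  exact ((hL.hasVal ν).mul ((hasVal_smul_iff ν).mpr ((hM ν hν).hasVal μ))).definedAt

theorem actX_mul {L M : DiffOp p} (hL : DefinedAt (point x β N) L)
    (hM : ∀ ν ∈ L.support, DefinedAt (point (fun i => x i + (ν.toAdd i : ℝ)) β N) M)
    (f : (Fin p → ℝ) → ℝ) :
    actX (L * M) β N f x = actX L β N (fun y => actX M β N f y) x := by
  have hv : ∀ ν ∈ L.support, ∀ μ, HasVal (point x β N) (L.coeff ν * ν • M.coeff μ)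
      (ratValue (point x β N) (L.coeff ν) *
        ratValue (point (fun i => x i + (ν.toAdd i : ℝ)) β N) (M.coeff μ)) := fun ν hν μ =>
    (hL.hasVal ν).mul ((hasVal_smul_iff ν).mpr ((hM ν hν).hasVal μ))
  rw [mul_eq_sum, actX_sum _ _ fun ν hν => definedAt_sum _ _ fun μ _ =>
    definedAt_single _ (hv ν hν μ).definedAt]
  conv_rhs => rw [actX]
  refine Finset.sum_congr rfl fun ν hν => ?_
  rw [actX_sum _ _ fun μ _ => definedAt_single _ (hv ν hν μ).definedAt, actX, Finset.mul_sum]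
  refine Finset.sum_congr rfl fun μ _ => ?_
  rw [actX_single, (hv ν hν μ).value_eq, mul_assoc]
  congr 3
  ext i
  simp [add_assoc]

/-- The points `x` with `2 x_i + β_i ∉ ℤ` for all `i`. -/
def Generic (x : Fin p → ℝ) (β : Fin (p + 2) → ℝ) : Prop :=
  ∀ (i : Fin p) (m : ℤ), 2 * x i + β i.castSucc.succ ≠ m

theorem Generic.add {x : Fin p → ℝ} {β : Fin (p + 2) → ℝ} (h : Generic x β) (ν : Fin p → ℤ) :
    Generic (fun i => x i + (ν i : ℝ)) β := by
  intro i m hm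
  refine h i (m - 2 * ν i) ?_
  push_cast
  linarith

/-- The algebra of operators whose coefficients are defined at all generic points. -/
def regularAlg (p : ℕ) : Subalgebra ℝ (DiffOp p) where
  carrier := {L | ∀ x β N, Generic x β → DefinedAt (point x β N) L}
  -- Products stay regular because genericity is invariant under integer shifts of `x`.
  mul_mem' hL hM x β N h := (hL x β N h).mul fun ν _ => hM _ β N (h.add ν.toAdd)
  add_mem' hL hM x β N h := (hL x β N h).add (hM x β N h)
  algebraMap_mem' r x β N _ := by
    rw [SkewMonoidAlgebra.coe_algebraMap]
    exact definedAt_single _ (hasVal_const _ r).definedAt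

theorem regularAlg_definedAt {L : DiffOp p} (hL : L ∈ regularAlg p) (h : Generic x β) :
    DefinedAt (point x β N) L := hL x β N h

theorem regularAlg_actX_mul {L M : DiffOp p} (hL : L ∈ regularAlg p) (hM : M ∈ regularAlg p)
    (h : Generic x β) (f : (Fin p → ℝ) → ℝ) :
    actX (L * M) β N f x = actX L β N (fun y => actX M β N f y) x :=
  actX_mul (hL x β N h) (fun ν _ => hM _ β N (h.add ν.toAdd)) f

end Action

/-! ### The operators `𝔏^x_j` as chain operators -/

section Chain

variable {p : ℕ}

/-- The sequence `x_1, …, x_p, N, N, …`. -/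
def seq {F : Type*} (x : Fin p → F) (N : F) (i : ℕ) : F := if h : i < p then x ⟨i, h⟩ else N

/-- The sequence `β_1, …, β_{p+1}, 0, 0, …`. -/
def seqB (β : Fin (p + 2) → ℝ) (i : ℕ) : ℝ := if h : i < p + 1 then β ⟨i + 1, by omega⟩ else 0

theorem seq_val {F : Type*} (x : Fin p → F) (N : F) (i : Fin p) : seq x N i = x i := by
  simp [seq]

theorem seqB_val (β : Fin (p + 2) → ℝ) (i : Fin p) : seqB β i = β i.castSucc.succ := by
  have : (i : ℕ) < p + 1 := by omega
  simp [seqB, this]; rfl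

theorem seqB_succ (β : Fin (p + 2) → ℝ) (i : Fin p) : seqB β (i + 1) = β i.succ.succ := by
  simp [seqB]; rfl

theorem extPos_succ_succ {F : Type*} [Zero F] (x : Fin p → F) (N : F) (j : Fin p) :
    extPos x N j.succ.succ = seq x N (j + 1) := by
  unfold extPos seq
  rw [Fin.cons_succ]
  by_cases h : (j : ℕ) + 1 < p
  · rw [dif_pos h]
    exact Fin.snoc_castSucc (α := fun _ => F) N x ⟨j + 1, h⟩
  · rw [dif_neg h]
    have : j.succ = Fin.last p := by ext; simp; omega
    rw [this, Fin.snoc_last]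

/-- `coefA` with the last factor replaced by the value of a function. -/
def chainCoef {F : Type*} [Field F] (y b : Fin p → F) (b0 : F) (Q : F → F) : List (Fin p) → F
  | [] => 0
  | a :: t =>
    (y a + b a - b0) * (y a + b a) *
      ((((a :: t).zip t).map fun q =>
          (y q.2 + y q.1 + b q.2) * (y q.2 + y q.1 + b q.2 + 1)).prod /
        ((a :: t).map fun i => (2 * y i + b i) * (2 * y i + b i + 1)).prod) *
      Q (y ((a :: t).getLast (List.cons_ne_nil a t)))

theorem zip_tail_append {α : Type*} (c a : α) (t : List α) :
    (c :: (t ++ [a])).zip (t ++ [a]) =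
      (c :: t).zip t ++ [((c :: t).getLast (List.cons_ne_nil c t), a)] := by
  induction t generalizing c with
  | nil => simp
  | cons d t ih =>
    have := ih d
    simp only [List.cons_append, List.zip_cons_cons, this, List.getLast_cons_cons]

/-- The link factor between the last two indices of a chain depends on the earlier one through a
quadratic, so it plays the role of `Q` for the chain without its last index. This is the recursion
built into `chainOp`. -/
theorem chainCoef_append {F : Type*} [Field F] (y b : Fin p → F) (b0 : F) (Q : F → F)
    (l : List (Fin p)) (a : Fin p) :
    chainCoef y b b0 Q (l ++ [a]) = Q (y a) / ((2 * y a + b a) * (2 * y a + b a + 1)) *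
      ((if l = [] then (y a + b a - b0) * (y a + b a) else 0) +
        chainCoef y b b0 (fun u => (u + y a + b a) * (u + y a + b a + 1)) l) := by
  cases l with
  | nil =>
    simp only [chainCoef, List.nil_append, List.zip_nil_right, List.map_nil, List.prod_nil, List.map_cons,
      List.prod_cons, List.getLast_singleton, if_true, div_eq_mul_inv, mul_inv]
    ring
  | cons c t =>
    simp only [List.cons_append, chainCoef, zip_tail_append, List.map_append, List.prod_append,
      List.map_cons, List.prod_cons, List.map_nil, List.prod_nil]
    have : (c :: (t ++ [a])).getLast (List.cons_ne_nil _ _) = a := by simp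
    rw [this]
    simp only [reduceCtorEq, if_false, div_eq_mul_inv, mul_inv]
    ring

theorem chainCoef_congr {F : Type*} [Field F] (y y' b : Fin p → F) (b0 : F) (Q : F → F)
    (l : List (Fin p)) (h : ∀ i ∈ l, y i = y' i) :
    chainCoef y b b0 Q l = chainCoef y' b b0 Q l := by
  cases l with
  | nil => rfl
  | cons a t =>
    simp only [chainCoef]
    rw [h a (by simp), h _ (List.getLast_mem (List.cons_ne_nil a t))]
    congr 3
    · congr 1
      refine List.map_congr_left fun q hq => ?_
      have := List.of_mem_zip (a := q.1) (b := q.2) hq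
      rw [h _ this.1, h _ (List.mem_cons_of_mem _ this.2)]
    · congr 1
      exact List.map_congr_left fun q hq => by rw [h q hq]

/-- The indices of the nonzero components, in increasing order. -/
def signList (ν : Fin p → SignType) : List (Fin p) := (List.finRange p).filter fun i => ν i ≠ 0

theorem mem_signList {ν : Fin p → SignType} {i : Fin p} : i ∈ signList ν ↔ ν i ≠ 0 := by
  simp [signList]

theorem signList_eq_nil {ν : Fin p → SignType} : signList ν = [] ↔ ν = 0 := by
  rw [List.eq_nil_iff_forall_not_mem]
  simp only [mem_signList, not_not]
  exact ⟨fun h => funext h, fun h i => by rw [h]; rfl⟩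

theorem signList_update {ν : Fin p → SignType} {m : Fin p} (hν : ∀ i, m ≤ i → ν i = 0) {s : SignType}
    (hs : s ≠ 0) : signList (Function.update ν m s) = signList ν ++ [m] := by
  have hlt : ∀ ν : Fin p → SignType, (signList ν).Pairwise (· < ·) := fun ν =>
    (List.pairwise_lt_finRange p).filter _
  have hm : ∀ i ∈ signList ν, i < m := fun i hi => by
    by_contra h
    exact mem_signList.mp hi (hν i (not_lt.mp h))
  have h2 : (signList ν ++ [m]).Pairwise (· < ·) := by
    rw [List.pairwise_append]
    exact ⟨hlt ν, by simp, fun a ha b hb => by rw [List.mem_singleton.mp hb]; exact hm a ha⟩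
  have nd : ∀ l : List (Fin p), l.Pairwise (· < ·) → l.Nodup := fun l h => h.imp (fun h => h.ne)
  refine List.Perm.eq_of_pairwise (le := (· < ·)) (fun a b _ _ hab hba => absurd hab hba.asymm) (hlt _) h2 ?_
  rw [List.perm_ext_iff_of_nodup (nd _ (hlt _)) (nd _ h2)]
  intro i
  rw [List.mem_append, mem_signList, mem_signList, List.mem_singleton]
  by_cases h : i = m
  · subst h; simp [hs]
  · simp [h]

theorem prod_map_filter {α M : Type*} [Monoid M] (l : List α) (P : α → Prop) [DecidablePred P]
    (F : α → M) (h : ∀ a ∈ l, ¬ P a → F a = 1) : (l.map F).prod = ((l.filter P).map F).prod := by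
  induction l with
  | nil => simp
  | cons a l ih =>
    have ih := ih fun b hb => h b (by simp [hb])
    by_cases ha : P a
    · rw [List.filter_cons_of_pos (by simpa using ha)]; simp [ih]
    · rw [List.filter_cons_of_neg (by simpa using ha)]; simp [ih, h a (by simp) ha]

theorem diffProd_eq (ν : Fin p → SignType) :
    diffProd ν = ((signList ν).map fun i => signDiff i (ν i)).prod :=
  prod_map_filter _ _ _ fun i _ hi => by rw [not_not.mp hi]; rfl

theorem diffProd_update {ν : Fin p → SignType} {m : Fin p} (hν : ∀ i, m ≤ i → ν i = 0)
    (s : SignType) : diffProd (Function.update ν m s) = diffProd ν * signDiff m s := by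
  by_cases hs : s = 0
  · rw [hs, ← hν m le_rfl, Function.update_eq_self, hν m le_rfl]
    exact (mul_one _).symm
  · rw [diffProd_eq, signList_update hν hs, List.map_append, List.prod_append, diffProd_eq]
    congr 2
    · refine List.map_congr_left fun i hi => ?_
      rw [Function.update_of_ne]
      rintro rfl
      exact mem_signList.mp hi (hν i le_rfl)
    · simp

/-- Operators with constant coefficients are defined everywhere. -/
theorem definedAt_singleShift (i : Fin p) (k : ℤ) (v : Ind p → ℝ) : DefinedAt v (singleShift i k) :=
  definedAt_single _ (hasVal_one v).definedAt

theorem definedAt_one (v : Ind p → ℝ) : DefinedAt v (1 : DiffOp p) :=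
  definedAt_single _ (hasVal_one v).definedAt

theorem DefinedAt.neg {v : Ind p → ℝ} {L : DiffOp p} (hL : DefinedAt v L) : DefinedAt v (-L) := by
  rw [definedAt_iff]
  intro ν
  rw [SkewMonoidAlgebra.coeff_neg]
  exact (hL.hasVal ν).neg.definedAt

theorem DefinedAt.sub {v : Ind p → ℝ} {L M : DiffOp p} (hL : DefinedAt v L) (hM : DefinedAt v M) :
    DefinedAt v (L - M) := by
  rw [sub_eq_add_neg]; exact hL.add hM.neg

theorem definedAt_signDiff (i : Fin p) (s : SignType) (v : Ind p → ℝ) : DefinedAt v (signDiff i s) := by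
  cases s
  · exact definedAt_one v
  · exact (definedAt_one v).sub (definedAt_singleShift _ _ v)
  · exact (definedAt_singleShift _ _ v).sub (definedAt_one v)

theorem definedAt_diffProd (ν : Fin p → SignType) (x : Fin p → ℝ) (β : Fin (p + 2) → ℝ) (N : ℝ) :
    DefinedAt (point x β N) (diffProd ν) := by
  rw [diffProd_eq]
  generalize signList ν = l
  induction l generalizing x with
  | nil => exact definedAt_one _
  | cons a l ih =>
    rw [List.map_cons, List.prod_cons]
    exact (definedAt_signDiff _ _ _).mul fun _ _ => ih _

variable {β : Fin (p + 2) → ℝ} {N : ℝ} {x : Fin p → ℝ}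

theorem definedAt_mulOp {v : Ind p → ℝ} {c : RatFun p} (hc : RatDefinedAt v c) :
    DefinedAt v (mulOp c) := definedAt_single _ hc

theorem actX_mulOp (c : RatFun p) (f : (Fin p → ℝ) → ℝ) :
    actX (mulOp c) β N f x = ratValue (point x β N) c * f x := by
  refine (actX_single 1 c f).trans ?_
  simp

theorem actX_one (f : (Fin p → ℝ) → ℝ) : actX (1 : DiffOp p) β N f x = f x := by
  refine (actX_single 1 1 f).trans ?_
  rw [(hasVal_one _).value_eq]
  simp

theorem actX_neg (L : DiffOp p) (hL : DefinedAt (point x β N) L) (f : (Fin p → ℝ) → ℝ) :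
    actX (-L) β N f x = - actX L β N f x := by
  have h := actX_add hL hL.neg f
  rw [add_neg_cancel, actX_zero] at h
  linarith

theorem actX_sub {L M : DiffOp p} (hL : DefinedAt (point x β N) L) (hM : DefinedAt (point x β N) M)
    (f : (Fin p → ℝ) → ℝ) : actX (L - M) β N f x = actX L β N f x - actX M β N f x := by
  rw [sub_eq_add_neg, actX_add hL hM.neg, actX_neg M hM, sub_eq_add_neg]

theorem actX_singleShift (i : Fin p) (k : ℤ) (f : (Fin p → ℝ) → ℝ) :
    actX (singleShift i k) β N f x = f (Function.update x i (x i + k)) := by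
  refine (actX_single _ 1 f).trans ?_
  rw [(hasVal_one _).value_eq, one_mul]
  congr 1
  ext l
  by_cases h : l = i
  · subst h; simp
  · simp [h]

theorem actX_signDiff_one (i : Fin p) (f : (Fin p → ℝ) → ℝ) :
    actX (signDiff i 1) β N f x = f (Function.update x i (x i + 1)) - f x := by
  have := actX_sub (β := β) (N := N) (x := x) (definedAt_singleShift i 1 _) (definedAt_one _) f
  rw [actX_singleShift, actX_one, Int.cast_one] at this
  exact this

theorem actX_signDiff_neg_one (i : Fin p) (f : (Fin p → ℝ) → ℝ) :
    actX (signDiff i (-1)) β N f x = f x - f (Function.update x i (x i + -1)) := by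
  have := actX_sub (β := β) (N := N) (x := x) (definedAt_one _) (definedAt_singleShift i (-1) _) f
  rw [actX_singleShift, actX_one, Int.cast_neg, Int.cast_one] at this
  exact this

/-- The real coefficient of `△^{ν⁺} ∇^{ν⁻}` in a chain operator. -/
def signedCoef (β : Fin (p + 2) → ℝ) (x : Fin p → ℝ) (Q : ℝ → ℝ) (ν : Fin p → SignType) : ℝ :=
  (-1) ^ (Finset.univ.filter fun i => ν i = -1).card *
    chainCoef (reflect ν x fun i => β i.castSucc.succ) (fun i => β i.castSucc.succ) (β 0) Q (signList ν)

theorem signedCoef_zero (Q : ℝ → ℝ) : signedCoef β x Q 0 = 0 := by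
  rw [signedCoef, signList_eq_nil.mpr rfl, chainCoef, mul_zero]

theorem reflect_update {ν : Fin p → SignType} {m : Fin p} {s : SignType} {b : Fin p → ℝ}
    {i : Fin p} (h : i ≠ m) : reflect (Function.update ν m s) x b i = reflect ν x b i := by
  simp [reflect, h]

theorem signedCoef_update_one {ν : Fin p → SignType} {m : Fin p} (hν : ∀ i, m ≤ i → ν i = 0)
    (Q : ℝ → ℝ) : signedCoef β x Q (Function.update ν m 1) =
      Q (x m) / ((2 * x m + β m.castSucc.succ) * (2 * x m + β m.castSucc.succ + 1)) *
        ((if ν = 0 then (x m + β m.castSucc.succ - β 0) * (x m + β m.castSucc.succ) else 0) +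
          signedCoef β x (quadPlus (β m.castSucc.succ) (x m)) ν) := by
  have hcard : (Finset.univ.filter fun i => Function.update ν m 1 i = -1) =
      Finset.univ.filter fun i => ν i = -1 := by
    ext i
    by_cases h : i = m
    · subst h; simp [hν i le_rfl]
    · simp [h]
  have hsign : ν = 0 → (Finset.univ.filter fun i => ν i = -1).card = 0 := by
    rintro rfl; simp
  rw [signedCoef, hcard, signList_update hν (by decide), chainCoef_append, signedCoef,
    chainCoef_congr (reflect (Function.update ν m 1) x _) (reflect ν x _) _ _ _ _ fun i hi =>
      reflect_update (by rintro rfl; exact mem_signList.mp hi (hν i le_rfl))]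
  have hr : reflect (Function.update ν m 1) x (fun i => β i.castSucc.succ) m = x m := by
    simp [reflect]
  have hQ : (fun u => (u + x m + β m.castSucc.succ) * (u + x m + β m.castSucc.succ + 1)) =
      quadPlus (β m.castSucc.succ) (x m) := rfl
  rw [hr, hQ]
  simp only [signList_eq_nil]
  by_cases h : ν = 0
  · rw [if_pos h, hsign h, pow_zero]; ring
  · rw [if_neg h]; ring

theorem signedCoef_update_neg_one {ν : Fin p → SignType} {m : Fin p} (hν : ∀ i, m ≤ i → ν i = 0)
    (Q : ℝ → ℝ) : signedCoef β x Q (Function.update ν m (-1)) =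
      -(Q (-x m - β m.castSucc.succ) /
          ((2 * x m + β m.castSucc.succ) * (2 * x m + β m.castSucc.succ - 1)) *
        ((if ν = 0 then x m * (x m + β 0) else 0) + signedCoef β x (quadMinus (x m)) ν)) := by
  have hcard : (Finset.univ.filter fun i => Function.update ν m (-1) i = -1).card =
      (Finset.univ.filter fun i => ν i = -1).card + 1 := by
    rw [← Finset.card_insert_of_notMem (a := m) (by simp [hν m le_rfl])]
    congr 1
    ext i
    by_cases h : i = m
    · subst h; simp
    · simp [h]
  have hsign : ν = 0 → (Finset.univ.filter fun i => ν i = -1).card = 0 := by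
    rintro rfl; simp
  rw [signedCoef, hcard, signList_update hν (by decide), chainCoef_append, signedCoef,
    chainCoef_congr (reflect (Function.update ν m (-1)) x _) (reflect ν x _) _ _ _ _ fun i hi =>
      reflect_update (by rintro rfl; exact mem_signList.mp hi (hν i le_rfl))]
  have hr : reflect (Function.update ν m (-1)) x (fun i => β i.castSucc.succ) m =
      -x m - β m.castSucc.succ := by
    simp [reflect]
  rw [hr]
  have hQ : (fun u => (u + (-x m - β m.castSucc.succ) + β m.castSucc.succ) *
      (u + (-x m - β m.castSucc.succ) + β m.castSucc.succ + 1)) = quadMinus (x m) := by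
    ext u; simp only [quadMinus]; ring
  have hd : (2 * (-x m - β m.castSucc.succ) + β m.castSucc.succ) *
      (2 * (-x m - β m.castSucc.succ) + β m.castSucc.succ + 1) =
      (2 * x m + β m.castSucc.succ) * (2 * x m + β m.castSucc.succ - 1) := by ring
  rw [hQ, hd]
  simp only [signList_eq_nil]
  by_cases h : ν = 0
  · rw [if_pos h, if_pos h, hsign h, pow_succ, pow_zero]; ring
  · rw [if_neg h, if_neg h, pow_succ]; ring

/-- The multi-indices in `{-1,0,1}^p` with zero components from the index `m` on. -/
def signVecs (p m : ℕ) : Finset (Fin p → SignType) :=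
  Finset.univ.filter fun ν => ∀ i : Fin p, m ≤ i → ν i = 0

theorem sum_signVecs_succ {m : ℕ} (hm : m < p) (g : (Fin p → SignType) → ℝ) :
    ∑ ν ∈ signVecs p (m + 1), g ν = ∑ ν ∈ signVecs p m,
      (g ν + g (Function.update ν ⟨m, hm⟩ 1) + g (Function.update ν ⟨m, hm⟩ (-1))) := by
  have hfib : ∀ s : SignType, ∑ ν ∈ signVecs p (m + 1) with ν ⟨m, hm⟩ = s, g ν =
      ∑ ν ∈ signVecs p m, g (Function.update ν ⟨m, hm⟩ s) := by
    intro s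
    refine Finset.sum_nbij' (fun ν => Function.update ν ⟨m, hm⟩ 0) (fun ν => Function.update ν ⟨m, hm⟩ s)
      ?_ ?_ ?_ ?_ ?_
    · intro ν hν
      simp only [signVecs, Finset.mem_filter, Finset.mem_univ, true_and] at hν ⊢
      intro i hi
      by_cases h : i = ⟨m, hm⟩
      · subst h; simp
      · rw [Function.update_of_ne h]
        refine hν.1 i ?_
        have : (i : ℕ) ≠ m := fun h' => h (Fin.ext h')
        omega
    · intro ν hν
      simp only [signVecs, Finset.mem_filter, Finset.mem_univ, true_and] at hν ⊢
      refine ⟨fun i hi => ?_, by simp⟩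
      rw [Function.update_of_ne]
      · exact hν i (by omega)
      · rintro rfl
        simp at hi
    · intro ν hν
      have := (Finset.mem_filter.mp hν).2
      simp only [Function.update_idem]
      rw [← this, Function.update_eq_self]
    · intro ν hν
      have := (Finset.mem_filter.mp hν).2 ⟨m, hm⟩ le_rfl
      simp only [Function.update_idem]
      rw [← this, Function.update_eq_self]
    · intro ν hν
      have := (Finset.mem_filter.mp hν).2
      simp only [Function.update_idem]
      rw [← this, Function.update_eq_self]
  rw [← Finset.sum_fiberwise (signVecs p (m + 1)) (fun ν => ν ⟨m, hm⟩) g, SignType.univ_eq,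
    Finset.sum_insert (by decide), Finset.sum_insert (by decide), Finset.sum_singleton, hfib, hfib, hfib,
    ← Finset.sum_add_distrib, ← Finset.sum_add_distrib]
  refine Finset.sum_congr rfl fun ν hν => ?_
  have := (Finset.mem_filter.mp hν).2 ⟨m, hm⟩ le_rfl
  rw [show Function.update ν ⟨m, hm⟩ 0 = ν by rw [← this, Function.update_eq_self]]
  ring

/-- A function of `x_1, …, x_p` as a function of sequences. -/
def onSeq (f : (Fin p → ℝ) → ℝ) (y : ℕ → ℝ) : ℝ := f fun i => y i

theorem update_seq (y : ℕ → ℝ) (m : Fin p) (s : ℝ) :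
    (fun i : Fin p => bump m s y i) = Function.update (fun i : Fin p => y i) m (y m + s) := by
  ext i
  by_cases h : i = m
  · subst h; simp [bump]
  · rw [Function.update_of_ne h, bump, Function.update_of_ne]
    exact fun h' => h (Fin.ext h')

/-- Splitting the sum according to the sign of the last component reproduces the three terms of the
recursion for `chainOp`. -/
theorem sum_signedCoef (m : ℕ) (hm : m ≤ p) (Q : ℝ → ℝ) (f : (Fin p → ℝ) → ℝ) :
    ∑ ν ∈ signVecs p m, signedCoef β x Q ν * actX (diffProd ν) β N f x =
      chainOp (seqB β) (β 0) m Q (onSeq f) (seq x N) := by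
  induction m generalizing Q f with
  | zero =>
    have : signVecs p 0 = {0} := by
      ext ν
      simp only [signVecs, Finset.mem_filter, Finset.mem_univ, true_and, Finset.mem_singleton]
      exact ⟨fun h => funext fun i => h i (by omega), fun h i _ => by rw [h]; rfl⟩
    rw [this, Finset.sum_singleton, signedCoef_zero, zero_mul, chainOp]
  | succ m ih =>
    have ih := ih (by omega)
    obtain ⟨k, rfl⟩ : ∃ k : Fin p, (k : ℕ) = m := ⟨⟨m, by omega⟩, rfl⟩
    have hz : ∀ ν ∈ signVecs p (k : ℕ), ∀ i, k ≤ i → ν i = 0 := fun ν hν i hi =>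
      (Finset.mem_filter.mp hν).2 i hi
    -- The empty chain has coefficient `0`, so a chain consisting of the new index alone is not
    -- produced by a shorter chain; the indicator of `ν = 0` supplies its head factor.
    have hsum0 : ∀ (c : ℝ) (g : (Fin p → ℝ) → ℝ),
        ∑ ν ∈ signVecs p (k : ℕ), (if ν = 0 then c else 0) * actX (diffProd ν) β N g x = c * g x := by
      intro c g
      rw [Finset.sum_eq_single 0]
      · rw [if_pos rfl, diffProd_eq, signList_eq_nil.mpr rfl, List.map_nil, List.prod_nil, actX_one]
      · intro ν _ h; rw [if_neg h, zero_mul]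
      · intro h; exact absurd (by simp [signVecs]) h
    rw [sum_signVecs_succ k.2, chainOp, ← ih]
    have hb : (fun y => onSeq f (bump k 1 y) - onSeq f y) =
        onSeq fun y => f (Function.update y k (y k + 1)) - f y := by
      ext y; simp only [onSeq, update_seq]
    have hb' : (fun y => onSeq f y - onSeq f (bump k (-1) y)) =
        onSeq fun y => f y - f (Function.update y k (y k + -1)) := by
      ext y; simp only [onSeq, update_seq]
    have e1 := congrFun hb (seq x N)
    have e2 := congrFun hb' (seq x N)
    rw [hb, hb', ← ih, ← ih, e1, e2, seq_val, seqB_val]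
    simp only [onSeq, seq_val]
    have h1 := hsum0 ((x k + β k.castSucc.succ - β 0) * (x k + β k.castSucc.succ))
      (fun y => f (Function.update y k (y k + 1)) - f y)
    have h2 := hsum0 (x k * (x k + β 0)) (fun y => f y - f (Function.update y k (y k + -1)))
    rw [← h1, ← h2,
      ← Finset.sum_add_distrib, ← Finset.sum_add_distrib, Finset.mul_sum, Finset.mul_sum,
      ← Finset.sum_add_distrib, ← Finset.sum_sub_distrib]
    refine Finset.sum_congr rfl fun ν hν => ?_
    rw [signedCoef_update_one (hz ν hν), signedCoef_update_neg_one (hz ν hν),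
      diffProd_update (hz ν hν), diffProd_update (hz ν hν),
      actX_mul (definedAt_diffProd _ _ _ _) (fun _ _ => definedAt_signDiff _ _ _),
      actX_mul (definedAt_diffProd _ _ _ _) (fun _ _ => definedAt_signDiff _ _ _)]
    simp only [actX_signDiff_one, actX_signDiff_neg_one]
    ring

/-! ### Coefficients of `𝔏^x_j` -/

theorem hasVal_chainCoef {v : Ind p → ℝ} {Y Bv : Fin p → RatFun p} {y b : Fin p → ℝ} {B0 : RatFun p}
    {b0 : ℝ} {Q : RatFun p → RatFun p} {q : ℝ → ℝ} (l : List (Fin p))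
    (hY : ∀ i ∈ l, HasVal v (Y i) (y i)) (hB : ∀ i, HasVal v (Bv i) (b i)) (hb0 : HasVal v B0 b0)
    (hQ : ∀ f r, HasVal v f r → HasVal v (Q f) (q r))
    (hd : ∀ i ∈ l, 2 * y i + b i ≠ 0 ∧ 2 * y i + b i + 1 ≠ 0) :
    HasVal v (chainCoef Y Bv B0 Q l) (chainCoef y b b0 q l) := by
  have h2 : HasVal v 2 2 := by
    have := (hasVal_one v).add (hasVal_one v)
    rwa [one_add_one_eq_two, one_add_one_eq_two] at this
  cases l with
  | nil => exact hasVal_zero v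
  | cons a t =>
    simp only [chainCoef]
    refine ((((hY a (by simp)).add (hB a)).sub hb0).mul ((hY a (by simp)).add (hB a))).mul ?_ |>.mul
      (hQ _ _ (hY _ (List.getLast_mem _)))
    refine (hasVal_list_prod _ _ _ fun q hq => ?_).div (hasVal_list_prod _ _ _ fun i hi => ?_) ?_
    · have hmem := List.of_mem_zip (a := q.1) (b := q.2) hq
      have h1 := ((hY _ (List.mem_cons_of_mem _ hmem.2)).add (hY _ hmem.1)).add (hB q.2)
      exact h1.mul (h1.add (hasVal_one v))
    · have h1 := (h2.mul (hY i hi)).add (hB i)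
      exact h1.mul (h1.add (hasVal_one v))
    · refine List.prod_ne_zero fun h0 => ?_
      obtain ⟨i, hi, h0⟩ := List.mem_map.mp h0
      refine absurd h0 (mul_ne_zero ?_ ?_)
      exacts [(hd i hi).1, (hd i hi).2]

theorem hasVal_posVar (i : Fin p) : HasVal (point x β N) (posVar i) (x i) := by
  simpa [point, posVar] using hasVal_poly (point x β N) (MvPolynomial.X (Ind.pos i))

theorem hasVal_parVar (k : Fin (p + 2)) : HasVal (point x β N) (parVar k) (β k) := by
  simpa [point, parVar] using hasVal_poly (point x β N) (MvPolynomial.X (Ind.par k))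

theorem hasVal_sizeVar : HasVal (point x β N) (sizeVar : RatFun p) N := by
  simpa [point, sizeVar] using hasVal_poly (point x β N) (MvPolynomial.X Ind.size)

theorem hasVal_seq (i : ℕ) : HasVal (point x β N) (seq posVar sizeVar i : RatFun p) (seq x N i) := by
  unfold seq
  split_ifs
  · exact hasVal_posVar _
  · exact hasVal_sizeVar

/-- The coefficient of `△^{ν⁺} ∇^{ν⁻}` in `𝔏^x_j`. -/
def opCoef (j : Fin p) (ν : Fin p → SignType) : RatFun p :=
  (-1) ^ (Finset.univ.filter fun i => ν i = -1).card *
      coefSigned ν posVar (fun i => parVar i.castSucc.succ) (parVar 0) (parVar j.succ.succ)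
        (extPos posVar sizeVar j.succ.succ)

theorem opX_eq (j : Fin p) : opX j = ∑ ν ∈ signVecs p (j + 1), mulOp (opCoef j ν) * diffProd ν := by
  unfold opX
  have h0 : opCoef j 0 = 0 := by
    have : (List.finRange p).filter (fun i => (0 : Fin p → SignType) i ≠ 0) = [] := by simp
    rw [opCoef, coefSigned, this, coefA, mul_zero]
  have hsub : (Finset.univ.filter fun ν : Fin p → SignType => ν ≠ 0 ∧ ∀ i, j < i → ν i = 0) ⊆
      signVecs p (j + 1) := by
    intro ν hν
    simp only [signVecs, Finset.mem_filter, Finset.mem_univ, true_and] at hν ⊢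
    exact fun i hi => hν.2 i hi
  refine Finset.sum_subset hsub fun ν hν hν' => ?_
  have : ν = 0 := by
    by_contra h
    refine hν' ?_
    simp only [signVecs, Finset.mem_filter, Finset.mem_univ, true_and] at hν ⊢
    exact ⟨h, fun i hi => hν i hi⟩
  rw [this]
  change mulOp (opCoef j 0) * _ = 0
  rw [h0, map_zero, zero_mul]

theorem hasVal_opCoef (j : Fin p) (ν : Fin p → SignType) (hν : ν ∈ signVecs p (j + 1))
    (hx : ∀ i ≤ j, 2 * x i + β i.castSucc.succ ≠ 0 ∧ 2 * x i + β i.castSucc.succ + 1 ≠ 0 ∧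
      2 * x i + β i.castSucc.succ - 1 ≠ 0) :
    HasVal (point x β N) (opCoef j ν)
      (signedCoef β x (quadZero (β j.succ.succ) (seq x N (j + 1))) ν) := by
  have hQ : ∀ (f : RatFun p) (r : ℝ), HasVal (point x β N) f r → HasVal (point x β N)
      ((f + parVar j.succ.succ + extPos posVar sizeVar j.succ.succ) *
        (extPos posVar sizeVar j.succ.succ - f)) (quadZero (β j.succ.succ) (seq x N (j + 1)) r) := by
    intro f r hf
    rw [extPos_succ_succ]
    exact ((hf.add (hasVal_parVar _)).add (hasVal_seq _)).mul ((hasVal_seq _).sub hf)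
  refine HasVal.mul ?_ ?_
  · have := (hasVal_const (point x β N) (-1)).pow (Finset.univ.filter fun i => ν i = -1).card
    simpa using this
  · have hform : ∀ (l : List (Fin p)) (y b : Fin p → RatFun p) (b0 bEnd M : RatFun p),
        coefA y b b0 bEnd M l = chainCoef y b b0 (fun u => (u + bEnd + M) * (M - u)) l := by
      intro l y b b0 bEnd M
      cases l with
      | nil => rfl
      | cons a t => simp only [coefA, chainCoef, mul_assoc]
    rw [coefSigned, hform]
    refine hasVal_chainCoef _ ?_ (fun i => hasVal_parVar _) (hasVal_parVar _) hQ ?_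
    · intro i _
      unfold reflect
      split_ifs
      · exact (hasVal_posVar i).neg.sub (hasVal_parVar _)
      · exact hasVal_posVar i
    · intro i hi
      have hij : i ≤ j := by
        by_contra h
        exact mem_signList.mp hi ((Finset.mem_filter.mp hν).2 i (by
          have : (j : ℕ) < i := by simpa using h
          omega))
      obtain ⟨h1, h2, h3⟩ := hx i hij
      unfold reflect
      -- Reflection turns `2y + b` and `2y + b + 1` into `-(2x + b)` and `-(2x + b - 1)`; hence the
      -- three excluded values of `2x + b`.
      split_ifs
      · refine ⟨fun h => h1 (by linarith), fun h => h3 (by linarith)⟩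
      · exact ⟨h1, h2⟩

theorem definedAt_opX (j : Fin p)
    (hx : ∀ i ≤ j, 2 * x i + β i.castSucc.succ ≠ 0 ∧ 2 * x i + β i.castSucc.succ + 1 ≠ 0 ∧
      2 * x i + β i.castSucc.succ - 1 ≠ 0) : DefinedAt (point x β N) (opX j) := by
  rw [opX_eq]
  exact definedAt_sum _ _ fun ν hν => (definedAt_mulOp (hasVal_opCoef j ν hν hx).definedAt).mul
    fun _ _ => definedAt_diffProd _ _ _ _

theorem actX_opX (j : Fin p)
    (hx : ∀ i ≤ j, 2 * x i + β i.castSucc.succ ≠ 0 ∧ 2 * x i + β i.castSucc.succ + 1 ≠ 0 ∧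
      2 * x i + β i.castSucc.succ - 1 ≠ 0) (f : (Fin p → ℝ) → ℝ) :
    actX (opX j) β N f x = chainOp (seqB β) (β 0) (j + 1)
      (quadZero (seqB β (j + 1)) (seq x N (j + 1))) (onSeq f) (seq x N) := by
  rw [opX_eq, actX_sum _ _ (fun ν hν => (definedAt_mulOp (hasVal_opCoef j ν hν hx).definedAt).mul
    fun _ _ => definedAt_diffProd _ _ _ _), ← sum_signedCoef (j + 1) (by omega)]
  refine Finset.sum_congr rfl fun ν hν => ?_
  rw [actX_mul (definedAt_mulOp (hasVal_opCoef j ν hν hx).definedAt)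
    (fun _ _ => definedAt_diffProd _ _ _ _), actX_mulOp, (hasVal_opCoef j ν hν hx).value_eq, seqB_succ]

end Chain

section Eigen

variable {p : ℕ}

/-! ### The polynomials as products over sequences -/

theorem seq_apply_map {F G : Type*} (φ : F → G) (x : Fin p → F) (N : F) (i : ℕ) :
    φ (seq x N i) = seq (fun i => φ (x i)) (φ N) i := by
  unfold seq; split_ifs <;> rfl

theorem sum_filter_eq_sum_range {M : Type*} [AddCommMonoid M] (a : Fin p → M) (k : ℕ) (hk : k ≤ p) :
    ∑ i ∈ Finset.univ.filter (fun i : Fin p => (i : ℕ) < k), a i = ∑ i ∈ Finset.range k, seq a 0 i := by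
  rw [Finset.sum_filter]
  have : ∀ i : Fin p, (if (i : ℕ) < k then a i else 0) =
      (fun i : ℕ => if i < k then seq a 0 i else 0) i := by
    intro i; simp only [seq_val]
  rw [Finset.sum_congr rfl fun i _ => this i,
    Fin.sum_univ_eq_sum_range (fun i : ℕ => if i < k then seq a 0 i else 0) p, ← Finset.sum_filter]
  congr 1
  ext i; simp; omega

theorem before_eq (n : Fin p → ℕ) (k : Fin p) :
    (before n k : ℝ) = ∑ i ∈ Finset.range k, ((seq n 0 i : ℕ) : ℝ) := by
  rw [before, ← Nat.cast_sum, ← sum_filter_eq_sum_range n k k.2.le]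
  rfl

theorem psum_eq {M : Type*} [AddCommMonoid M] (a : Fin p → M) (j : Fin p) :
    psum a j = ∑ i ∈ Finset.range (j + 1), seq a 0 i := by
  rw [psum, ← sum_filter_eq_sum_range a (j + 1) j.2]
  exact Finset.sum_congr (Finset.filter_congr fun i _ => Nat.lt_succ_iff.symm) fun _ _ => rfl

theorem total_eq (n : Fin p → ℕ) : total n = ∑ i ∈ Finset.range p, seq n 0 i := by
  rw [total, ← sum_filter_eq_sum_range n p le_rfl]
  exact Finset.sum_congr (Finset.filter_true_of_mem fun i _ => i.2).symm fun _ _ => rfl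

theorem racah1_eq_fac (n : ℕ) (T b b' b0 x z : ℝ) :
    racah1 n (2 * T + b - b0 - 1) (b' - b - 1) (T - z - 1) (T + b + z) (-T + x) = fac n T b b' b0 x z := by
  unfold racah1 fac hyp
  refine Finset.sum_congr rfl fun k _ => ?_
  rw [show (n : ℝ) + (2 * T + b - b0 - 1) + (b' - b - 1) + 1 = n + 2 * T + b' - b0 - 1 by ring,
    show -(-T + x) = T - x by ring, show -T + x + (T - z - 1) + (T + b + z) + 1 = T + x + b by ring,
    show 2 * T + b - b0 - 1 + 1 + k = 2 * T + b - b0 + k by ring,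
    show b' - b - 1 + (T + b + z) + 1 + k = T + b' + z + k by ring,
    show T - z - 1 + 1 + k = T - z + k by ring]

variable {β : Fin (p + 2) → ℝ} {N : ℝ} {x : Fin p → ℝ}

theorem racah_eq_chainProd (n : Fin p → ℕ) (x : Fin p → ℝ) (β : Fin (p + 2) → ℝ) (N : ℝ) :
    racah n x β N = chainProd (seq n 0) (seqB β) (β 0) p (seq x N) := by
  rw [racah, chainProd, Finset.prod_range]
  refine Finset.prod_congr rfl fun k _ => ?_
  rw [extPos_succ_succ, racah1_eq_fac, before_eq, seq_val n 0 k, seq_val, seqB_val, seqB_succ]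

theorem onSeq_racah (n : Fin p → ℕ) (y : ℕ → ℝ) (hy : y p = N) :
    onSeq (fun y => racah n y β N) y = chainProd (seq n 0) (seqB β) (β 0) p y := by
  rw [onSeq, racah_eq_chainProd]
  refine chainProd_congr _ _ _ _ fun i hi => ?_
  rcases hi.lt_or_eq with h | rfl
  · simp [seq, h]
  · simp [seq, hy]

/-- The factors of `R_p` with index beyond `j` involve only coordinates that the operator does not
move. They are constants `r` for it, and `chainProd_eigen` applies to the remaining product. -/
theorem actX_opX_racah (n : Fin p → ℕ) (j : Fin p)
    (hx : ∀ i ≤ j, 2 * x i + β i.castSucc.succ ≠ 0 ∧ 2 * x i + β i.castSucc.succ + 1 ≠ 0 ∧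
      2 * x i + β i.castSucc.succ - 1 ≠ 0) :
    actX (opX j) β N (fun y => racah n y β N) x = eigenMu j n β * racah n x β N := by
  have hj : (j : ℕ) + 1 ≤ p := j.2
  rw [actX_opX j hx]
  set X := seq x N with hX
  set r := ∏ k ∈ Finset.Ico ((j : ℕ) + 1) p, fac (seq n 0 k) (∑ i ∈ Finset.range k, ((seq n 0 i : ℕ) : ℝ))
    (seqB β k) (seqB β (k + 1)) (β 0) (X k) (X (k + 1)) with hr
  have hfac : ∀ y, Near (j + 1) X y → chainProd (seq n 0) (seqB β) (β 0) p y =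
      r * chainProd (seq n 0) (seqB β) (β 0) (j + 1) y := by
    intro y hy
    rw [chainProd, ← Finset.prod_range_mul_prod_Ico _ hj, mul_comm]
    congr 1
    refine Finset.prod_congr rfl fun k hk => ?_
    have := (Finset.mem_Ico.mp hk).1
    rw [hy.1 k this, hy.1 (k + 1) (by omega)]
  have hXp : X p = N := by simp [hX, seq]
  rw [chainOp_congr (g := fun y => r * chainProd (seq n 0) (seqB β) (β 0) (j + 1)
    (Function.update y (j + 1) (X (j + 1)))), chainOp_smul, (chainProd_eigen _ _ _ _ _).1,
    Function.update_eq_self, racah_eq_chainProd, ← hX, hfac X (Near.refl _ _), eigenMu, psum_eq,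
    Nat.cast_sum, seqB_succ]
  · ring
  · intro i hi
    have := hx ⟨i, by omega⟩ (Fin.le_def.mpr (by simp; omega))
    rw [hX, seqB_val β ⟨i, by omega⟩, seq_val x N ⟨i, by omega⟩]
    exact this
  · intro y hy
    rw [onSeq_racah n y (by rw [hy.1 p hj, hXp]), hfac y hy, ← hy.1 (j + 1) le_rfl,
      Function.update_eq_self]

/-! ### The algebra `𝓐_x` -/

theorem Generic.ne (h : Generic x β) (i : Fin p) : 2 * x i + β i.castSucc.succ ≠ 0 ∧
    2 * x i + β i.castSucc.succ + 1 ≠ 0 ∧ 2 * x i + β i.castSucc.succ - 1 ≠ 0 := by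
  refine ⟨fun h0 => h i 0 (by simpa using h0), fun h0 => h i (-1) ?_, fun h0 => h i 1 ?_⟩ <;>
  push_cast <;> linarith

theorem algX_le_regularAlg : algX p ≤ regularAlg p := by
  refine Algebra.adjoin_le ?_
  rintro _ ⟨j, rfl⟩ x β N h
  exact definedAt_opX j fun i _ => h.ne i

theorem actX_algebraMap (r : ℝ) (f : (Fin p → ℝ) → ℝ) :
    actX (algebraMap ℝ (DiffOp p) r) β N f x = r * f x := by
  rw [SkewMonoidAlgebra.coe_algebraMap]
  refine (actX_single 1 _ f).trans ?_
  rw [(hasVal_const _ _).value_eq]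
  simp

/-- Eigenvalues multiply under composition because they do not depend on `x` and the equations hold
at all shifts of a generic point. -/
theorem algX_generic_eigen {L : DiffOp p} (hL : L ∈ algX p) :
    ∃ μ : (Fin p → ℕ) → (Fin (p + 2) → ℝ) → ℝ → ℝ, ∀ n β N x, Generic x β →
      actX L β N (fun y => racah n y β N) x = μ n β N * racah n x β N := by
  have hreg : ∀ {L : DiffOp p}, L ∈ algX p → L ∈ regularAlg p := fun h => algX_le_regularAlg h
  refine Algebra.adjoin_induction (p := fun L _ => ∃ μ : (Fin p → ℕ) → (Fin (p + 2) → ℝ) → ℝ → ℝ,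
    ∀ n β N x, Generic x β → actX L β N (fun y => racah n y β N) x = μ n β N * racah n x β N)
    ?_ ?_ ?_ ?_ hL
  · rintro _ ⟨j, rfl⟩
    exact ⟨fun n β _ => eigenMu j n β, fun n β N x h => actX_opX_racah n j fun i _ => h.ne i⟩
  · exact fun r => ⟨fun _ _ _ => r, fun n β N x _ => actX_algebraMap r _⟩
  · rintro L M hL hM ⟨μ, hμ⟩ ⟨κ, hκ⟩
    refine ⟨fun n β N => μ n β N + κ n β N, fun n β N x h => ?_⟩
    rw [actX_add (hreg hL x β N h) (hreg hM x β N h), hμ n β N x h, hκ n β N x h, add_mul]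
  · rintro L M hL hM ⟨μ, hμ⟩ ⟨κ, hκ⟩
    refine ⟨fun n β N => κ n β N * μ n β N, fun n β N x h => ?_⟩
    rw [regularAlg_actX_mul (hreg hL) (hreg hM) h,
      actX_congr L _ (fun y => κ n β N * racah n y β N) fun ν _ => hκ n β N _ (h.add _),
      actX_smul, hμ n β N x h, mul_assoc]

/-! ### Continuity -/

theorem ratValue_continuousAt {X : Type*} [TopologicalSpace X] {v : X → Ind p → ℝ} {t : X}
    (hv : ContinuousAt v t) {f : RatFun p} (hf : RatDefinedAt (v t) f) :
    ContinuousAt (fun s => ratValue (v s) f) t :=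
  (((MvPolynomial.continuous_eval _).continuousAt).comp hv).div
    (((MvPolynomial.continuous_eval _).continuousAt).comp hv) hf

theorem continuous_point {X : Type*} [TopologicalSpace X] {x : X → Fin p → ℝ}
    {β : X → Fin (p + 2) → ℝ} {N : X → ℝ} (hx : Continuous x) (hβ : Continuous β) (hN : Continuous N) :
    Continuous fun s => point (x s) (β s) (N s) := by
  refine continuous_pi fun i => ?_
  rcases i with i | k | _
  · exact (continuous_apply i).comp hx
  · exact (continuous_apply k).comp hβ
  · exact hN

@[fun_prop]
theorem continuous_poch (m : ℕ) : Continuous fun a => poch a m := (ascPochhammer ℝ m).continuous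

theorem continuous_hyp {X : Type*} [TopologicalSpace X] (n : ℕ) {a b c d e f : X → ℝ}
    (ha : Continuous a) (hb : Continuous b) (hc : Continuous c) (hd : Continuous d)
    (he : Continuous e) (hf : Continuous f) :
    Continuous fun s => hyp n (a s) (b s) (c s) (d s) (e s) (f s) := by
  have hp : ∀ (k : ℕ) {g : X → ℝ}, Continuous g → Continuous fun s => poch (g s) k :=
    fun k g hg => (continuous_poch k).comp hg
  unfold hyp
  refine continuous_finsetSum _ fun k _ => Continuous.mul ?_ ?_
  · exact (((continuous_const.mul (hp k ha)).mul (hp k hb)).mul (hp k hc)).div_const _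
  · exact ((hp _ (hd.add continuous_const)).mul (hp _ (he.add continuous_const))).mul
      (hp _ (hf.add continuous_const))

theorem continuous_seq {X : Type*} [TopologicalSpace X] {x : X → Fin p → ℝ} {N : X → ℝ}
    (hx : Continuous x) (hN : Continuous N) (i : ℕ) : Continuous fun s => seq (x s) (N s) i := by
  unfold seq
  split_ifs
  · exact (continuous_apply _).comp hx
  · exact hN

theorem continuous_seqB {X : Type*} [TopologicalSpace X] {β : X → Fin (p + 2) → ℝ}
    (hβ : Continuous β) (i : ℕ) : Continuous fun s => seqB (β s) i := by
  unfold seqB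
  split_ifs
  · exact (continuous_apply _).comp hβ
  · exact continuous_const

theorem continuous_racah {X : Type*} [TopologicalSpace X] (n : Fin p → ℕ) {x : X → Fin p → ℝ}
    {β : X → Fin (p + 2) → ℝ} {N : X → ℝ} (hx : Continuous x) (hβ : Continuous β) (hN : Continuous N) :
    Continuous fun s => racah n (x s) (β s) (N s) := by
  simp only [racah_eq_chainProd, chainProd, fac]
  have h1 := fun i => continuous_seq hx hN i
  have h2 := fun i => continuous_seqB hβ i
  have h3 : Continuous fun s => β s 0 := (continuous_apply 0).comp hβ
  refine continuous_finsetProd _ fun k _ => continuous_hyp _ ?_ ?_ ?_ ?_ ?_ ?_ <;> fun_prop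

theorem continuous_normalizer {X : Type*} [TopologicalSpace X] (n : Fin p → ℕ)
    {β : X → Fin (p + 2) → ℝ} {N : X → ℝ} (hβ : Continuous β) (hN : Continuous N) :
    Continuous fun s => normalizer n (β s) (N s) := by
  have h := fun k => (continuous_apply k).comp hβ
  simp only [Function.comp_def] at h
  have hp : ∀ (k : ℕ) {g : X → ℝ}, Continuous g → Continuous fun s => poch (g s) k :=
    fun k g hg => (continuous_poch k).comp hg
  unfold normalizer
  refine ((hp _ hN.neg).mul (hp _ (hN.neg.sub (h 0)))).mul
    (continuous_finsetProd _ fun k _ => hp _ ((h _).sub (h _)))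

theorem eq_of_eq_off_countable {f g : ℝ → ℝ} {t : ℝ} (hf : ContinuousAt f t) (hg : ContinuousAt g t)
    {S : Set ℝ} (hS : S.Countable) (h : ∀ s, s ∉ S → f s = g s) : f t = g t := by
  have hd : Dense Sᶜ := hS.dense_compl ℝ
  have : (𝓝[Sᶜ] t).NeBot := mem_closure_iff_nhdsWithin_neBot.mp (hd t)
  have h1 : Tendsto f (𝓝[Sᶜ] t) (𝓝 (f t)) := hf.mono_left nhdsWithin_le_nhds
  have h2 : Tendsto g (𝓝[Sᶜ] t) (𝓝 (g t)) := hg.mono_left nhdsWithin_le_nhds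
  refine tendsto_nhds_unique (h1.congr' ?_) h2
  filter_upwards [self_mem_nhdsWithin] with s hs using h s hs

theorem countable_affine_int (a c : ℝ) (hc : c ≠ 0) : {t : ℝ | ∃ m : ℤ, a + c * t = m}.Countable := by
  have : {t : ℝ | ∃ m : ℤ, a + c * t = m} = (fun t => a + c * t) ⁻¹' Set.range ((↑) : ℤ → ℝ) := by
    ext t; simp [eq_comm]
  rw [this]
  refine (Set.countable_range _).preimage_of_injOn fun s _ t _ hst => ?_
  simpa [hc] using hst

/-- An eigenvalue equation for `L` on generic points holds wherever `L` is defined. -/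
theorem actX_eq_of_generic {L : DiffOp p} {n : Fin p → ℕ} {μ : ℝ}
    (h : ∀ y, Generic y β → actX L β N (fun y => racah n y β N) y = μ * racah n y β N)
    (hL : DefinedAt (point x β N) L) :
    actX L β N (fun y => racah n y β N) x = μ * racah n x β N := by
  -- All coordinates are moved simultaneously along the diagonal; the points with `2x_i + β_i + 2t ∈
  -- ℤ` for some `i` form a countable set.
  have hx : Continuous fun (t : ℝ) (i : Fin p) => x i + t := by fun_prop
  have key := eq_of_eq_off_countable (t := 0)
    (f := fun t => actX L β N (fun y => racah n y β N) (fun i => x i + t))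
    (g := fun t => μ * racah n (fun i => x i + t) β N) ?_ ?_
    (S := ⋃ i : Fin p, {t : ℝ | ∃ m : ℤ, (2 * x i + β i.castSucc.succ) + 2 * t = m})
    (Set.countable_iUnion fun i => countable_affine_int _ _ two_ne_zero) ?_
  · simpa using key
  · refine tendsto_finsetSum _ fun ν hν => Tendsto.mul ?_ ?_
    · refine ratValue_continuousAt (v := fun t : ℝ => point (fun i => x i + t) β N)
        (continuous_point hx continuous_const continuous_const).continuousAt ?_
      simpa using hL ν hν
    · refine (continuous_racah n ?_ continuous_const continuous_const).continuousAt
      fun_prop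
  · exact (continuous_const.mul (continuous_racah n hx continuous_const continuous_const)).continuousAt
  · intro t ht
    refine h _ fun i m hm => ht ?_
    simp only [Set.mem_iUnion, Set.mem_ofPred_eq]
    exact ⟨i, m, by linarith⟩

theorem actX_racahHat {L : DiffOp p} {n : Fin p → ℕ} {μ : ℝ}
    (h : actX L β N (fun y => racah n y β N) x = μ * racah n x β N) :
    actX L β N (fun y => racahHat n y β N) x = μ * racahHat n x β N := by
  have : (fun y => racahHat n y β N) = fun y => (normalizer n β N)⁻¹ * racah n y β N := by
    ext y; rw [racahHat]; ring
  rw [this, actX_smul, h, racahHat]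
  ring

end Eigen

/-! ### Duality -/

theorem poch_neg_nat_eq_zero {n k : ℕ} (h : n < k) : poch (-n) k = 0 := by
  rw [poch_eq_zero_iff]; exact ⟨n, h, by simp⟩

theorem hyp_eq_sum_range {n M : ℕ} (h : n ≤ M) (a b c d e f : ℝ) :
    hyp n a b c d e f =
      ∑ k ∈ Finset.range (M + 1), poch (-n) k * poch a k * poch b k * poch c k / (k.factorial : ℝ) *
    (poch (d + k) (n - k) * poch (e + k) (n - k) * poch (f + k) (n - k)) := by
  refine Finset.sum_subset (Finset.range_subset_range.mpr (by omega)) fun k _ hk => ?_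
  rw [poch_neg_nat_eq_zero (by simpa [Nat.lt_succ_iff] using hk)]
  simp

theorem hyp_swap (n : ℕ) (a b c d e f : ℝ) : hyp n a b c d e f = hyp n a b c e d f := by
  unfold hyp; exact Finset.sum_congr rfl fun k _ => by ring

/-- The symmetry of a terminating `₄F₃` sum in two upper parameters `-n` and `-m`. -/
theorem hyp_symm (n m : ℕ) (a c d e f : ℝ) :
    hyp n a (-m) c d e f * (poch d m * poch e m * poch f m) =
      hyp m c (-n) a d e f * (poch d n * poch e n * poch f n) := by
  rw [hyp_eq_sum_range (Nat.le_add_right n m), hyp_eq_sum_range (Nat.le_add_left m n), Finset.sum_mul,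
    Finset.sum_mul]
  refine Finset.sum_congr rfl fun k _ => ?_
  rcases Nat.lt_or_ge n k with h | h
  · rw [poch_neg_nat_eq_zero h]; ring
  rcases Nat.lt_or_ge m k with h' | h'
  · rw [poch_neg_nat_eq_zero h']; ring
  obtain ⟨i, rfl⟩ := Nat.exists_eq_add_of_le h
  obtain ⟨j, rfl⟩ := Nat.exists_eq_add_of_le h'
  rw [Nat.add_sub_cancel_left, Nat.add_sub_cancel_left]
  -- The sums agree term by term: `(d)_m (d+k)_{n-k} = (d)_k (d+k)_{m-k} (d+k)_{n-k}` is symmetric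
  -- in `n` and `m`, and similarly for `e` and `f`.
  simp only [poch_add _ k]
  ring

/-- Whipple's transformation of a factor of `R_p`. -/
theorem fac_eq_hyp (n : ℕ) (T b b' b0 N s s' : ℝ) :
    fac n T b b' b0 (s - b - N) (s' - b' - N) =
      hyp n (n + 2 * T + b' - b0 - 1) (-(s - s')) (s + s' - b - 2 * N) (T + s' - N) (b' - b)
        (T + s' - N - b0) := by
  rw [fac, hyp_swap, whipple _ _ _ _ _ _ _ (by ring)]
  have hc : ∀ A B C d e f, hyp n A B C d e f = hyp n A C B d e f := fun A B C d e f => by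
    unfold hyp; exact Finset.sum_congr rfl fun k _ => by ring
  rw [hc]
  congr 1 <;> ring

/-- The product of the lower Pochhammer symbols of a factor. -/
def lowerPoch (N b0 δ : ℝ) (r m : ℕ) : ℝ := poch (-N + r) m * poch δ m * poch (-N - b0 + r) m

/-- Telescoping along the staircase that in step `k` adds `a k` and removes `c (p - 1 - k)`. With
`r` the common offset of the step, both ways of writing `(u)_{r + a + c}`-type products rest on
`(u)_{r+a} = (u)_r (u+r)_a`. It reconciles the Pochhammer factors of the single factors with those
of the normalizers. -/
theorem poch_chain (u : ℝ) (p : ℕ) (a c : ℕ → ℕ) :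
    poch u (∑ i ∈ Finset.range p, c i) * ∏ k ∈ Finset.range p,
      poch (u + (∑ i ∈ Finset.range k, a i + ∑ i ∈ Finset.range (p - 1 - k), c i : ℕ)) (a k) =
    poch u (∑ i ∈ Finset.range p, a i) * ∏ k ∈ Finset.range p,
      poch (u + (∑ i ∈ Finset.range k, a i + ∑ i ∈ Finset.range (p - 1 - k), c i : ℕ)) (c (p - 1 - k)) := by
  have key : ∀ j ≤ p, poch u (∑ i ∈ Finset.range p, c i) * ∏ k ∈ Finset.range j,
      poch (u + (∑ i ∈ Finset.range k, a i + ∑ i ∈ Finset.range (p - 1 - k), c i : ℕ)) (a k) =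
    poch u (∑ i ∈ Finset.range j, a i + ∑ i ∈ Finset.range (p - j), c i) * ∏ k ∈ Finset.range j,
      poch (u + (∑ i ∈ Finset.range k, a i + ∑ i ∈ Finset.range (p - 1 - k), c i : ℕ)) (c (p - 1 - k)) := by
    intro j
    induction j with
    | zero => intro _; simp
    | succ j ih =>
      intro hj
      rw [Finset.prod_range_succ, ← mul_assoc, ih (by omega), Finset.prod_range_succ,
        show p - j = p - 1 - j + 1 by omega, Finset.sum_range_succ c, Finset.sum_range_succ a,
        show p - (j + 1) = p - 1 - j by omega]
      set A := ∑ i ∈ Finset.range j, a i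
      set C := ∑ i ∈ Finset.range (p - 1 - j), c i
      rw [show A + (C + c (p - 1 - j)) = (A + C) + c (p - 1 - j) by ring,
        show A + a j + C = (A + C) + a j by ring, poch_add u (A + C), poch_add u (A + C)]
      ring
  have := key p le_rfl
  rwa [Nat.sub_self, Finset.range_zero, Finset.sum_empty, add_zero] at this

section

variable {p : ℕ}

/-- The parameters `𝔟(β)`. -/
def dualB (β : Fin (p + 2) → ℝ) (N : ℝ) (k : Fin (p + 2)) : ℝ :=
  Fin.cases (β 0) (fun k' : Fin (p + 1) => β 0 - β k'.rev.succ - 2 * N + 1) k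

/-- The positions `𝔟(x)`. -/
def dualX (n : Fin p → ℝ) (β : Fin (p + 2) → ℝ) (N : ℝ) (i : Fin p) : ℝ :=
  psum n i.rev + β i.rev.succ.succ - β 0 + N - 1

/-- The point `x` with `𝔟⁻¹(n) = u`, i.e. `x_k + β_k + N = u_1 + ⋯ + u_{p+1-k}`. -/
def latticeX (u : Fin p → ℝ) (β : Fin (p + 2) → ℝ) (N : ℝ) (i : Fin p) : ℝ :=
  psum u i.rev - β i.castSucc.succ - N

theorem eval_dualPoly (n : Fin p → ℝ) (β : Fin (p + 2) → ℝ) (N : ℝ) (q : Poly p) :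
    MvPolynomial.eval (point n β N) (dualPoly p q) =
      MvPolynomial.eval (point (dualX n β N) (dualB β N) N) q := by
  change MvPolynomial.eval (point n β N) (MvPolynomial.aeval dualImage q) = _
  have : ((MvPolynomial.aeval (R := ℝ) (point n β N)).comp (MvPolynomial.aeval dualImage)) =
      MvPolynomial.aeval (point (dualX n β N) (dualB β N) N) := by
    apply MvPolynomial.algHom_ext
    rintro (i | k | _)
    · simp [dualImage, point, dualX, map_psum]
    · refine Fin.cases ?_ (fun k => ?_) k
      · simp [dualImage, point, dualB]
      · simp [dualImage, point, dualB, map_ofNat]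
    · simp [dualImage, point]
  simpa [MvPolynomial.aeval_eq_eval] using DFunLike.congr_fun this q

theorem seqB_dualB (β : Fin (p + 2) → ℝ) (N : ℝ) (i : ℕ) (hi : i ≤ p) :
    seqB (dualB β N) i = β 0 - seqB β (p - i) - 2 * N + 1 := by
  have h1 : i < p + 1 := by omega
  have h2 : p - i < p + 1 := by omega
  simp only [seqB, dif_pos h1, dif_pos h2]
  have : (⟨i + 1, by omega⟩ : Fin (p + 2)) = Fin.succ (⟨i, h1⟩ : Fin (p + 1)) := rfl
  rw [this, dualB, Fin.cases_succ]
  congr 4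
  ext
  simp [Fin.rev]

theorem dualB_zero (β : Fin (p + 2) → ℝ) (N : ℝ) : dualB β N 0 = β 0 := rfl

/-- At lattice points consecutive values of `x_k + β_k + N` differ by natural numbers, so after
Whipple's transformation each factor carries a second negative integer `-c` upstairs. -/
theorem racah_latticeX (n c : Fin p → ℕ) (β : Fin (p + 2) → ℝ) (N : ℝ) :
    racah n (latticeX (fun i => (c i : ℝ)) β N) β N =
      ∏ k ∈ Finset.range p, hyp (seq n 0 k)
        ((seq n 0 k : ℕ) + 2 * ((∑ i ∈ Finset.range k, seq n 0 i : ℕ) : ℝ) + seqB β (k + 1) - β 0 - 1)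
        (-((seq c 0 (p - 1 - k) : ℕ) : ℝ))
        ((seq c 0 (p - 1 - k) : ℕ) + 2 * ((∑ i ∈ Finset.range (p - 1 - k), seq c 0 i : ℕ) : ℝ) -
          seqB β k - 2 * N)
        (-N + ((∑ i ∈ Finset.range k, seq n 0 i + ∑ i ∈ Finset.range (p - 1 - k), seq c 0 i : ℕ) : ℝ))
        (seqB β (k + 1) - seqB β k)
        (-N - β 0 + ((∑ i ∈ Finset.range k, seq n 0 i +
          ∑ i ∈ Finset.range (p - 1 - k), seq c 0 i : ℕ) : ℝ)) := by
  set X : ℕ → ℝ := fun k => ((∑ i ∈ Finset.range (p - k), seq c 0 i : ℕ) : ℝ) - seqB β k - N with hX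
  have hXe : ∀ i < p, seq (latticeX (fun i => (c i : ℝ)) β N) N i = X i := by
    intro i hi
    rw [hX]
    simp only [seq, dif_pos hi, latticeX]
    rw [psum_eq, Nat.cast_sum, ← seqB_val β ⟨i, hi⟩]
    have : ((Fin.rev (⟨i, hi⟩ : Fin p) : Fin p) : ℕ) + 1 = p - i := by simp [Fin.rev]; omega
    rw [this]
    congr 2
    refine Finset.sum_congr rfl fun k _ => ?_
    have := seq_apply_map (Nat.cast : ℕ → ℝ) c 0 k
    rw [Nat.cast_zero] at this
    exact this.symm
  have h1 : racah n (latticeX (fun i => (c i : ℝ)) β N) β N =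
      chainProd (seq n 0) (seqB β) (β 0) p X := by
    rw [racah_eq_chainProd]
    -- The lattice pattern continued to index `p` gives `-N - β_{p+1}` instead of `N`; the last
    -- factor is invariant under this reflection.
    have hp : X p = -N - seqB β p := by simp [hX]; ring
    have h2 : chainProd (seq n 0) (seqB β) (β 0) p X =
        chainProd (seq n 0) (seqB β) (β 0) p (Function.update X p N) := by
      rw [← chainProd_reflect, ← hp, Function.update_eq_self]
    rw [h2]
    refine chainProd_congr _ _ _ _ fun i hi => ?_
    rcases hi.lt_or_eq with h | rfl
    · rw [hXe i h, Function.update_of_ne h.ne]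
    · simp [seq]
  rw [h1, chainProd]
  refine Finset.prod_congr rfl fun k hk => ?_
  have hk : k < p := Finset.mem_range.mp hk
  rw [hX]
  simp only
  rw [fac_eq_hyp, show p - k = p - 1 - k + 1 by omega, Finset.sum_range_succ,
    show p - (k + 1) = p - 1 - k by omega]
  push_cast
  congr 1 <;> ring

/-- Factor `k` is exchanged with factor `p - 1 - k` of the dual polynomial by `hyp_symm`. The common
product of `lowerPoch` is left on both sides so that the identity holds without any condition on the
parameters; for `c = 0` this product is `1`. -/
theorem duality_mul (n c : Fin p → ℕ) (β : Fin (p + 2) → ℝ) (N : ℝ) :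
    (∏ k ∈ Finset.range p, lowerPoch N (β 0) (seqB β (k + 1) - seqB β k)
      (∑ i ∈ Finset.range k, seq n 0 i + ∑ i ∈ Finset.range (p - 1 - k), seq c 0 i) (seq c 0 (p - 1 - k))) *
      (normalizer c (dualB β N) N * racah n (latticeX (fun i => (c i : ℝ)) β N) β N) =
    (∏ k ∈ Finset.range p, lowerPoch N (β 0) (seqB β (k + 1) - seqB β k)
      (∑ i ∈ Finset.range k, seq n 0 i + ∑ i ∈ Finset.range (p - 1 - k), seq c 0 i) (seq c 0 (p - 1 - k))) *
      (normalizer n β N * racah c (dualX (fun i => (n i : ℝ)) β N) (dualB β N) N) := by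
  have hnorm : ∀ (n : Fin p → ℕ) (β : Fin (p + 2) → ℝ), normalizer n β N =
      poch (-N) (∑ i ∈ Finset.range p, seq n 0 i) * poch (-N - β 0) (∑ i ∈ Finset.range p, seq n 0 i) *
        ∏ k ∈ Finset.range p, poch (seqB β (k + 1) - seqB β k) (seq n 0 k) := by
    intro n β
    rw [normalizer, total_eq, Finset.prod_range]
    congr 1
    refine Finset.prod_congr rfl fun k _ => ?_
    rw [seqB_val, seqB_succ, seq_val]
  have hdualX : dualX (fun i => (n i : ℝ)) β N = latticeX (fun i => (n i : ℝ)) (dualB β N) N := by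
    ext i
    rw [dualX, latticeX, ← seqB_val (dualB β N) i, seqB_dualB _ _ _ (by omega), ← seqB_succ β i.rev]
    have : p - (i : ℕ) = (i.rev : ℕ) + 1 := by simp [Fin.rev]; omega
    rw [this]; ring
  rw [hdualX, racah_latticeX, racah_latticeX, hnorm, hnorm, dualB_zero]
  rw [← Finset.prod_range_reflect (fun k => poch (seqB (dualB β N) (k + 1) - seqB (dualB β N) k) (seq c 0 k)) p]
  rw [← Finset.prod_range_reflect (fun k => hyp (seq c 0 k) _ _ _ _ _ _) p]
  have hdB : ∀ k ∈ Finset.range p, poch (seqB (dualB β N) (p - 1 - k + 1) - seqB (dualB β N) (p - 1 - k))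
      (seq c 0 (p - 1 - k)) = poch (seqB β (k + 1) - seqB β k) (seq c 0 (p - 1 - k)) := by
    intro k hk
    have hk : k < p := Finset.mem_range.mp hk
    rw [seqB_dualB _ _ _ (by omega), seqB_dualB _ _ _ (by omega),
      show p - (p - 1 - k + 1) = k by omega, show p - (p - 1 - k) = k + 1 by omega]
    congr 1; ring
  rw [Finset.prod_congr rfl hdB]
  have hF : ∀ k ∈ Finset.range p, hyp (seq c 0 (p - 1 - k))
        ((seq c 0 (p - 1 - k) : ℕ) + 2 * ((∑ i ∈ Finset.range (p - 1 - k), seq c 0 i : ℕ) : ℝ) +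
          seqB (dualB β N) (p - 1 - k + 1) - β 0 - 1)
        (-((seq n 0 (p - 1 - (p - 1 - k)) : ℕ) : ℝ))
        ((seq n 0 (p - 1 - (p - 1 - k)) : ℕ) + 2 * ((∑ i ∈ Finset.range (p - 1 - (p - 1 - k)), seq n 0 i : ℕ) : ℝ) -
          seqB (dualB β N) (p - 1 - k) - 2 * N)
        (-N + ((∑ i ∈ Finset.range (p - 1 - k), seq c 0 i +
          ∑ i ∈ Finset.range (p - 1 - (p - 1 - k)), seq n 0 i : ℕ) : ℝ))
        (seqB (dualB β N) (p - 1 - k + 1) - seqB (dualB β N) (p - 1 - k))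
        (-N - β 0 + ((∑ i ∈ Finset.range (p - 1 - k), seq c 0 i +
          ∑ i ∈ Finset.range (p - 1 - (p - 1 - k)), seq n 0 i : ℕ) : ℝ)) =
      hyp (seq c 0 (p - 1 - k))
        ((seq c 0 (p - 1 - k) : ℕ) + 2 * ((∑ i ∈ Finset.range (p - 1 - k), seq c 0 i : ℕ) : ℝ) -
          seqB β k - 2 * N)
        (-((seq n 0 k : ℕ) : ℝ))
        ((seq n 0 k : ℕ) + 2 * ((∑ i ∈ Finset.range k, seq n 0 i : ℕ) : ℝ) + seqB β (k + 1) - β 0 - 1)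
        (-N + ((∑ i ∈ Finset.range k, seq n 0 i + ∑ i ∈ Finset.range (p - 1 - k), seq c 0 i : ℕ) : ℝ))
        (seqB β (k + 1) - seqB β k)
        (-N - β 0 + ((∑ i ∈ Finset.range k, seq n 0 i +
          ∑ i ∈ Finset.range (p - 1 - k), seq c 0 i : ℕ) : ℝ)) := by
    intro k hk
    have hk : k < p := Finset.mem_range.mp hk
    rw [seqB_dualB _ _ _ (by omega), seqB_dualB _ _ _ (by omega),
      show p - (p - 1 - k + 1) = k by omega, show p - (p - 1 - k) = k + 1 by omega,
      show p - 1 - (p - 1 - k) = k by omega,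
      add_comm (∑ i ∈ Finset.range (p - 1 - k), seq c 0 i)]
    congr 1 <;> ring
  rw [Finset.prod_congr rfl hF]
  have hsymm := Finset.prod_congr (rfl : Finset.range p = Finset.range p) fun k _ =>
    hyp_symm (seq n 0 k) (seq c 0 (p - 1 - k))
        ((seq n 0 k : ℕ) + 2 * ((∑ i ∈ Finset.range k, seq n 0 i : ℕ) : ℝ) + seqB β (k + 1) - β 0 - 1)
        ((seq c 0 (p - 1 - k) : ℕ) + 2 * ((∑ i ∈ Finset.range (p - 1 - k), seq c 0 i : ℕ) : ℝ) -
          seqB β k - 2 * N)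
        (-N + ((∑ i ∈ Finset.range k, seq n 0 i + ∑ i ∈ Finset.range (p - 1 - k), seq c 0 i : ℕ) : ℝ))
        (seqB β (k + 1) - seqB β k)
        (-N - β 0 + ((∑ i ∈ Finset.range k, seq n 0 i +
          ∑ i ∈ Finset.range (p - 1 - k), seq c 0 i : ℕ) : ℝ))
  have h1 := poch_chain (-N) p (seq n 0) (seq c 0)
  have h2 := poch_chain (-N - β 0) p (seq n 0) (seq c 0)
  simp only [lowerPoch, Finset.prod_mul_distrib] at hsymm ⊢
  set F := ∏ k ∈ Finset.range p, hyp (seq n 0 k) _ _ _ _ _ _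
  set G := ∏ k ∈ Finset.range p, hyp (seq c 0 (p - 1 - k)) _ _ _ _ _ _
  set A1 := ∏ k ∈ Finset.range p, poch (-N + _) (seq c 0 (p - 1 - k))
  set A2 := ∏ k ∈ Finset.range p, poch (seqB β (k + 1) - seqB β k) (seq c 0 (p - 1 - k))
  set A3 := ∏ k ∈ Finset.range p, poch (-N - β 0 + _) (seq c 0 (p - 1 - k))
  set C1 := ∏ k ∈ Finset.range p, poch (-N + _) (seq n 0 k)
  set C2 := ∏ k ∈ Finset.range p, poch (seqB β (k + 1) - seqB β k) (seq n 0 k)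
  set C3 := ∏ k ∈ Finset.range p, poch (-N - β 0 + _) (seq n 0 k)
  set c1 := poch (-N) (∑ i ∈ Finset.range p, seq c 0 i)
  set c3 := poch (-N - β 0) (∑ i ∈ Finset.range p, seq c 0 i)
  set n1 := poch (-N) (∑ i ∈ Finset.range p, seq n 0 i)
  set n3 := poch (-N - β 0) (∑ i ∈ Finset.range p, seq n 0 i)
  linear_combination (c1 * c3 * A2) * hsymm + (c3 * C3 * A2 * C2 * G) * h1 + (n1 * A1 * A2 * C2 * G) * h2

/-- The parameters for which all normalizers are nonzero. -/
def Regular (β : Fin (p + 2) → ℝ) (N : ℝ) : Prop :=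
  (∀ (k : Fin p) (m : ℕ), β k.succ.succ - β k.castSucc.succ + m ≠ 0) ∧
    ∀ m : ℕ, N ≠ m ∧ N + β 0 ≠ m

theorem normalizer_ne_zero {n : Fin p → ℕ} {β : Fin (p + 2) → ℝ} {N : ℝ}
    (h1 : ∀ (k : Fin p) (m : ℕ), β k.succ.succ - β k.castSucc.succ + m ≠ 0)
    (h2 : ∀ m : ℕ, m < total n → N ≠ m ∧ N + β 0 ≠ m) : normalizer n β N ≠ 0 := by
  refine mul_ne_zero (mul_ne_zero ?_ ?_) (Finset.prod_ne_zero_iff.mpr fun k _ => ?_)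
  · exact poch_ne_zero _ fun i hi h => (h2 i hi).1 (by linarith)
  · exact poch_ne_zero _ fun i hi h => (h2 i hi).2 (by linarith)
  · exact poch_ne_zero _ fun i _ => h1 k i

theorem Regular.normalizer_ne_zero {n : Fin p → ℕ} {β : Fin (p + 2) → ℝ} {N : ℝ}
    (h : Regular β N) : normalizer n β N ≠ 0 :=
  Racah.normalizer_ne_zero h.1 fun m _ => h.2 m

theorem Regular.dual {β : Fin (p + 2) → ℝ} {N : ℝ} (h : Regular β N) : Regular (dualB β N) N := by
  refine ⟨fun k m => ?_, h.2⟩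
  have := h.1 k.rev m
  rw [← seqB_val β, ← seqB_succ β] at this
  rw [← seqB_val (dualB β N), ← seqB_succ (dualB β N)]
  rw [seqB_dualB _ _ _ (by omega), seqB_dualB _ _ _ (by omega)]
  have e1 : p - ((k : ℕ) + 1) = (k.rev : ℕ) := by simp [Fin.rev]
  have e2 : p - (k : ℕ) = (k.rev : ℕ) + 1 := by simp [Fin.rev]; omega
  rw [e1, e2]
  intro h0
  exact this (by linarith)

theorem racahHat_duality (n c : Fin p → ℕ) {β : Fin (p + 2) → ℝ} {N : ℝ} (h : Regular β N) :
    racahHat n (latticeX (fun i => (c i : ℝ)) β N) β N =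
      racahHat c (dualX (fun i => (n i : ℝ)) β N) (dualB β N) N := by
  rw [racahHat, racahHat, div_eq_div_iff h.normalizer_ne_zero h.dual.normalizer_ne_zero]
  have := duality_mul n c β N
  have hne : (∏ k ∈ Finset.range p, lowerPoch N (β 0) (seqB β (k + 1) - seqB β k)
      (∑ i ∈ Finset.range k, seq n 0 i + ∑ i ∈ Finset.range (p - 1 - k), seq c 0 i)
      (seq c 0 (p - 1 - k))) ≠ 0 := by
    refine Finset.prod_ne_zero_iff.mpr fun k hk => mul_ne_zero (mul_ne_zero ?_ ?_) ?_
    · refine poch_ne_zero _ fun i _ h0 => (h.2 (∑ i ∈ Finset.range k, seq n 0 i +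
        ∑ i ∈ Finset.range (p - 1 - k), seq c 0 i + i)).1 ?_
      push_cast at h0 ⊢; linarith
    · have := h.1 ⟨k, Finset.mem_range.mp hk⟩
      rw [← seqB_val β, ← seqB_succ β] at this
      exact poch_ne_zero _ fun i _ => this i
    · refine poch_ne_zero _ fun i _ h0 => (h.2 (∑ i ∈ Finset.range k, seq n 0 i +
        ∑ i ∈ Finset.range (p - 1 - k), seq c 0 i + i)).2 ?_
      push_cast at h0 ⊢; linarith
  have := mul_left_cancel₀ hne this
  linarith

theorem racahHat_zero (x : Fin p → ℝ) (β : Fin (p + 2) → ℝ) (N : ℝ) : racahHat 0 x β N = 1 := by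
  have h1 : racah 0 x β N = 1 := by
    unfold racah racah1
    exact Finset.prod_eq_one fun k _ => by simp [poch_zero]
  have h2 : normalizer (0 : Fin p → ℕ) β N = 1 := by
    simp [normalizer, total, poch_zero]
  rw [racahHat, h1, h2, div_one]

/-- At the lattice point `c = 0` duality with the polynomial of degree zero shows that the
unnormalized polynomial equals its normalizer. -/
theorem exists_racahHat_ne_zero (n : Fin p → ℕ) (β : Fin (p + 2) → ℝ) (N : ℝ)
    (h : normalizer n β N ≠ 0) : ∃ x : Fin p → ℝ, racahHat n x β N ≠ 0 := by
  have hd := duality_mul n 0 β N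
  have hz : ∀ k, seq (0 : Fin p → ℕ) 0 k = 0 := fun k => by unfold seq; split_ifs <;> rfl
  have h0 := racahHat_zero (dualX (fun i => (n i : ℝ)) β N) (dualB β N) N
  have hn : normalizer (0 : Fin p → ℕ) (dualB β N) N = 1 := by
    simp [normalizer, total, poch_zero]
  rw [racahHat, hn, div_one] at h0
  simp only [hz, lowerPoch, poch_zero, mul_one, Finset.prod_const_one, one_mul, hn, h0] at hd
  exact ⟨_, by rw [racahHat, hd, div_self h]; exact one_ne_zero⟩

end

section DualAction

variable {p : ℕ}

/-! ### The action of the dual operators -/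

theorem coeff_dualIso (L : DiffOp p) (ν : Shift p) :
    (dualIso p L).coeff (dualShift p ν) = dualRat p (L.coeff ν) := by
  classical
  induction L using SkewMonoidAlgebra.induction_on with
  | zero => simp
  | single g a =>
    rw [dualIso_single, SkewMonoidAlgebra.coeff_single_apply, SkewMonoidAlgebra.coeff_single_apply]
    simp only [EmbeddingLike.apply_eq_iff_eq]
    split_ifs <;> simp
  | add f g hf hg =>
    rw [map_add, SkewMonoidAlgebra.coeff_add, SkewMonoidAlgebra.coeff_add, Finsupp.add_apply,
      Finsupp.add_apply, hf, hg, map_add]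

theorem mem_support_dualIso {L : DiffOp p} {ν : Shift p} :
    dualShift p ν ∈ (dualIso p L).support ↔ ν ∈ L.support := by
  rw [SkewMonoidAlgebra.mem_support_iff, SkewMonoidAlgebra.mem_support_iff, coeff_dualIso]
  simp

theorem support_dualIso (L : DiffOp p) :
    (dualIso p L).support = L.support.map (dualShift p).toEquiv.toEmbedding := by
  ext ν
  obtain ⟨μ, rfl⟩ := (dualShift p).surjective ν
  rw [mem_support_dualIso, Finset.mem_map_equiv]
  simp

variable {β : Fin (p + 2) → ℝ} {N : ℝ} {n : Fin p → ℝ}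

theorem hasVal_coeff_dualIso {L : DiffOp p} {ν : Shift p} {r : ℝ} :
    HasVal (point n β N) ((dualIso p L).coeff (dualShift p ν)) r ↔
      HasVal (point (dualX n β N) (dualB β N) N) (L.coeff ν) r := by
  rw [coeff_dualIso]
  exact hasVal_map_iff (dualPoly p) (eval_dualPoly n β N)

theorem ratDefinedAt_iff_exists {v : Ind p → ℝ} {f : RatFun p} : RatDefinedAt v f ↔ ∃ r, HasVal v f r :=
  ⟨fun h => ⟨_, h.hasVal⟩, fun ⟨_, h⟩ => h.definedAt⟩

theorem definedAt_dualIso {L : DiffOp p} : DefinedAt (point n β N) (dualIso p L) ↔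
    DefinedAt (point (dualX n β N) (dualB β N) N) L := by
  rw [definedAt_iff, definedAt_iff, (dualShift p).surjective.forall]
  simp only [ratDefinedAt_iff_exists, hasVal_coeff_dualIso]

theorem ratValue_coeff_dualIso {L : DiffOp p} {ν : Shift p}
    (h : DefinedAt (point (dualX n β N) (dualB β N) N) L) :
    ratValue (point n β N) ((dualIso p L).coeff (dualShift p ν)) =
      ratValue (point (dualX n β N) (dualB β N) N) (L.coeff ν) :=
  (hasVal_coeff_dualIso.mpr (h.hasVal ν)).value_eq

/-- The image of an integer point under `𝔟`. -/
def gridPoint (β : Fin (p + 2) → ℝ) (N : ℝ) (m : Fin p → ℤ) : Fin p → ℝ :=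
  dualX (fun i => (m i : ℝ)) β N

theorem gridPoint_injective (β : Fin (p + 2) → ℝ) (N : ℝ) : Function.Injective (gridPoint β N) := by
  intro m m' h
  rw [← diffs_psum m, ← diffs_psum m']
  congr 1
  ext i
  have := congrFun h i.rev
  simp only [gridPoint, dualX, Fin.rev_rev] at this
  have e : ∀ m : Fin p → ℤ, psum (fun i => (m i : ℝ)) i = ((psum m i : ℤ) : ℝ) := fun m => by
    simp [psum]
  rw [e, e] at this
  exact_mod_cast (by linarith : ((psum m i : ℤ) : ℝ) = ((psum m' i : ℤ) : ℝ))

theorem gridPoint_add (m : Fin p → ℤ) (ν : Shift p) :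
    (fun i => gridPoint β N m i + (ν.toAdd i : ℝ)) = gridPoint β N (m + (dualShift p ν).toAdd) := by
  ext i
  have h1 : psum (fun l => (((m + (dualShift p ν).toAdd) l : ℤ) : ℝ)) i.rev =
      psum (fun l => (m l : ℝ)) i.rev + ν.toAdd i := by
    have h2 := congrFun (psum_diffs fun i : Fin p => ν.toAdd i.rev) i.rev
    rw [Fin.rev_rev] at h2
    have h3 : ∀ a : Fin p → ℤ, psum (fun l => (a l : ℝ)) i.rev = ((psum a i.rev : ℤ) : ℝ) :=
      fun a => by simp [psum]
    rw [← h2, ← h3, ← psum_add_fun]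
    simp only [Pi.add_apply, Int.cast_add]
    rfl
  simp only [gridPoint, dualX, h1]
  ring

/-- An operator in `n` is an operator in `x` read on the grid `𝔟(ℤ^p)` with dual parameters; the
equations in `n` are proved on that side. -/
theorem actN_dualIso {L : DiffOp p} {m : Fin p → ℤ}
    (h : DefinedAt (point (gridPoint β N m) (dualB β N) N) L) (g : (Fin p → ℤ) → ℝ)
    (f : (Fin p → ℝ) → ℝ) (hf : ∀ m, f (gridPoint β N m) = g m) :
    actN (dualIso p L) β N g m = actX L (dualB β N) N f (gridPoint β N m) := by
  rw [actN, actX, support_dualIso, Finset.sum_map]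
  refine Finset.sum_congr rfl fun ν _ => ?_
  rw [gridPoint_add, hf]
  congr 1
  exact ratValue_coeff_dualIso h

/-- The parameters with `β_k - β_0 ∉ ℤ` for `k ≥ 2`. -/
def DualGeneric (β : Fin (p + 2) → ℝ) : Prop := ∀ (i : Fin p) (m : ℤ), β i.succ.succ - β 0 ≠ m

/-- `N` drops out, so genericity of the dual point is a condition on `β` and `n` only. This leaves
`N` free for the limit. -/
theorem two_mul_dualX (n : Fin p → ℝ) (β : Fin (p + 2) → ℝ) (N : ℝ) (i : Fin p) :
    2 * dualX n β N i + dualB β N i.castSucc.succ = 2 * psum n i.rev + β i.rev.succ.succ - β 0 - 1 := by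
  rw [dualX, dualB, Fin.cases_succ, rev_castSucc']
  ring

theorem DualGeneric.generic (h : DualGeneric β) (m : Fin p → ℤ) :
    Generic (gridPoint β N m) (dualB β N) := by
  intro i k hk
  rw [gridPoint, two_mul_dualX] at hk
  refine h i.rev (k + 1 - 2 * psum m i.rev) ?_
  have e : psum (fun i => (m i : ℝ)) i.rev = ((psum m i.rev : ℤ) : ℝ) := by simp [psum]
  rw [e] at hk
  push_cast
  linarith

/-- The image of a point of `ℕ^p` under `𝔟`. -/
def natPoint (β : Fin (p + 2) → ℝ) (N : ℝ) (n : Fin p → ℕ) : Fin p → ℝ :=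
  gridPoint β N fun i => (n i : ℤ)

theorem natPoint_eq (n : Fin p → ℕ) : natPoint β N n = dualX (fun i => (n i : ℝ)) β N := by
  simp [natPoint, gridPoint]

theorem DualGeneric.natGeneric (h : DualGeneric β) (n : Fin p → ℕ) :
    Generic (natPoint β N n) (dualB β N) := h.generic _

theorem natPoint_injective (β : Fin (p + 2) → ℝ) (N : ℝ) : Function.Injective (natPoint β N) := by
  intro n m h
  have := gridPoint_injective β N h
  ext i
  exact_mod_cast congrFun this i

/-! ### Boundary terms -/

/-- In the coordinates `x_i + β_i` the dual points are partial sums of `n` up to translation by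
`-N`, so `n ∈ ℕ^p` becomes the condition that consecutive gaps are natural numbers. -/
theorem natPoint_add_dualB (n : Fin p → ℕ) (i : ℕ) (hi : i < p) :
    seq (natPoint β N n) N i + seqB (dualB β N) i =
      ((∑ k ∈ Finset.range (p - i), seq n 0 k : ℕ) : ℝ) - N := by
  have h1 := seq_val (natPoint β N n) N ⟨i, hi⟩
  have h2 := seqB_val (dualB β N) ⟨i, hi⟩
  simp only at h1 h2
  rw [h1, h2, natPoint_eq, dualX, dualB, Fin.cases_succ, rev_castSucc', psum_eq, Nat.cast_sum,
    show ((Fin.rev (⟨i, hi⟩ : Fin p) : Fin p) : ℕ) + 1 = p - i by simp [Fin.rev]; omega]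
  have : ∀ k, seq (fun i => (n i : ℝ)) 0 k = ((seq n 0 k : ℕ) : ℝ) := fun k => by
    have := seq_apply_map (Nat.cast : ℕ → ℝ) n 0 k
    rw [Nat.cast_zero] at this
    exact this.symm
  simp only [this]
  ring

theorem gapsNat_natPoint (n : Fin p → ℕ) : GapsNat (seqB (dualB β N)) p
    (Function.update (seq (natPoint β N n) N) p (-N - seqB (dualB β N) p)) := by
  intro k hk
  rw [Function.update_of_ne hk.ne, natPoint_add_dualB n k hk]
  rcases Nat.lt_or_ge (k + 1) p with h | h
  · rw [Function.update_of_ne h.ne, natPoint_add_dualB n (k + 1) h,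
      show p - k = p - (k + 1) + 1 by omega, Finset.sum_range_succ]
    exact ⟨_, by push_cast; ring⟩
  · obtain rfl : k + 1 = p := by omega
    rw [Function.update_self]
    exact ⟨_, by ring⟩

theorem exists_natPoint {y : ℕ → ℝ} (h : GapsNat (seqB (dualB β N)) p
    (Function.update y p (-N - seqB (dualB β N) p))) :
    ∃ n : Fin p → ℕ, (fun i : Fin p => y i) = natPoint β N n := by
  choose g hg using h
  set n : Fin p → ℕ := fun i => g i.rev i.rev.2 with hn
  refine ⟨n, ?_⟩
  have key : ∀ d ≤ p, Function.update y p (-N - seqB (dualB β N) p) (p - d) +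
      seqB (dualB β N) (p - d) = ((∑ k ∈ Finset.range d, seq n 0 k : ℕ) : ℝ) - N := by
    intro d
    induction d with
    | zero => intro _; simp
    | succ d ih =>
      intro hd
      have h1 := ih (by omega)
      have h2 := hg (p - (d + 1)) (by omega)
      rw [show p - (d + 1) + 1 = p - d by omega] at h2
      have h3 : seq n 0 d = g (p - (d + 1)) (by omega) := by
        rw [seq_val n 0 ⟨d, by omega⟩]
        simp [hn, Fin.rev]
      rw [Finset.sum_range_succ, h3]
      push_cast at h1 ⊢
      linarith
  ext i
  have h1 := key (p - i) (by omega)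
  rw [show p - (p - (i : ℕ)) = i by omega, Function.update_of_ne i.2.ne] at h1
  have h2 := natPoint_add_dualB (β := β) (N := N) n i i.2
  rw [seq_val] at h2
  linarith

theorem quadZero_reflect (b z : ℝ) : quadZero b (-z - b) = quadZero b z := by
  ext y; simp only [quadZero]; ring

/-- `𝔏^x_j` preserves the functions that vanish on the image of `ℕ^p`. -/
theorem actX_opX_eq_zero (h : DualGeneric β) (j : Fin p) (f : (Fin p → ℝ) → ℝ)
    (hf : ∀ n, f (natPoint β N n) = 0) (n : Fin p → ℕ) :
    actX (opX j) (dualB β N) N f (natPoint β N n) = 0 := by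
  have hgen : Generic (natPoint β N n) (dualB β N) := h.natGeneric n
  rw [actX_opX j fun i _ => hgen.ne i]
  set X := seq (natPoint β N n) N with hX
  set B := seqB (dualB β N) with hB
  have hx : ∀ i < (j : ℕ) + 1, 2 * X i + B i ≠ 0 ∧ 2 * X i + B i + 1 ≠ 0 ∧ 2 * X i + B i - 1 ≠ 0 := by
    intro i hi
    have := hgen.ne ⟨i, by omega⟩
    rwa [← seqB_val (dualB β N), ← seq_val (natPoint β N n) N] at this
  have hgap := gapsNat_natPoint (β := β) (N := N) n
  rw [← hX, ← hB] at hgap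
  have hfy : ∀ y : ℕ → ℝ, GapsNat B p (Function.update y p (-N - B p)) → onSeq f y = 0 := by
    intro y hy
    obtain ⟨m, hm⟩ := exists_natPoint hy
    rw [onSeq, hm, hf]
  have hXp : X p = N := by simp [hX, seq]
  -- For `j + 1 < p` the fixed endpoint is a coordinate of the grid point. For the last operator it
  -- is `N`, which does not fit the gap pattern and is replaced by `-N - B p`, under which
  -- `quadZero` is invariant.
  rcases Nat.lt_or_ge ((j : ℕ) + 1) p with hj | hj
  · refine (chainOp_vanish _ X hx _ _ ?_).1 fun y hy hg => hfy y ?_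
    · rw [Function.update_eq_self]
      intro k hk
      have := hgap k (by omega)
      rwa [Function.update_of_ne (by omega), Function.update_of_ne (by omega)] at this
    · rw [← hy.1 _ le_rfl, Function.update_eq_self] at hg
      intro k hk
      rcases Nat.lt_or_ge k ((j : ℕ) + 1) with hk' | hk'
      · rw [Function.update_of_ne (by omega), Function.update_of_ne (by omega)]
        exact hg k hk'
      · have := hgap k hk
        rw [Function.update_of_ne (by omega), ← hy.1 k hk'] at this
        rw [Function.update_of_ne (by omega)]
        rcases Nat.lt_or_ge (k + 1) p with h1 | h1
        · rw [Function.update_of_ne (by omega), ← hy.1 (k + 1) (by omega)] at this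
          rwa [Function.update_of_ne (by omega)]
        · obtain rfl : k + 1 = p := by omega
          rw [Function.update_self] at this ⊢
          exact this
  · have hjp : (j : ℕ) + 1 = p := by omega
    rw [hjp, hXp, ← quadZero_reflect]
    rw [hjp] at hx
    exact (chainOp_vanish _ X hx _ _ hgap).1 fun y _ hg => hfy y hg

theorem actX_algX_eq_zero {L : DiffOp p} (hL : L ∈ algX p) (h : DualGeneric β) (f : (Fin p → ℝ) → ℝ)
    (hf : ∀ n, f (natPoint β N n) = 0) (n : Fin p → ℕ) :
    actX L (dualB β N) N f (natPoint β N n) = 0 := by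
  have hreg : ∀ {L : DiffOp p}, L ∈ algX p → L ∈ regularAlg p := fun h => algX_le_regularAlg h
  have hgen : ∀ n, Generic (natPoint β N n) (dualB β N) := h.natGeneric
  revert f n
  refine Algebra.adjoin_induction (p := fun L _ => ∀ f : (Fin p → ℝ) → ℝ,
    (∀ n, f (natPoint β N n) = 0) → ∀ n, actX L (dualB β N) N f (natPoint β N n) = 0) ?_ ?_ ?_ ?_ hL
  · rintro _ ⟨j, rfl⟩ f hf n
    exact actX_opX_eq_zero h j f hf n
  · intro r f hf n
    rw [actX_algebraMap, hf, mul_zero]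
  · intro L M hL hM h1 h2 f hf n
    rw [actX_add (hreg hL _ _ N (hgen n)) (hreg hM _ _ N (hgen n)), h1 f hf, h2 f hf, add_zero]
  · intro L M hL hM h1 h2 f hf n
    rw [regularAlg_actX_mul (hreg hL) (hreg hM) (hgen n)]
    exact h1 _ (h2 f hf) n

theorem actX_fun_lin (L : DiffOp p) (β : Fin (p + 2) → ℝ) (N : ℝ) (x : Fin p → ℝ) (a : ℝ)
    (f g : (Fin p → ℝ) → ℝ) :
    actX L β N (fun y => f y - a * g y) x = actX L β N f x - a * actX L β N g x := by
  simp only [actX, Finset.mul_sum, ← Finset.sum_sub_distrib]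
  exact Finset.sum_congr rfl fun ν _ => by ring

/-- It allows the function extended by zero to be replaced by a polynomial agreeing with it on the
image of `ℕ^p`. -/
theorem actX_algX_congr {L : DiffOp p} (hL : L ∈ algX p) (h : DualGeneric β) {f g : (Fin p → ℝ) → ℝ}
    (hf : ∀ n, f (natPoint β N n) = g (natPoint β N n)) (n : Fin p → ℕ) :
    actX L (dualB β N) N f (natPoint β N n) = actX L (dualB β N) N g (natPoint β N n) := by
  have := actX_algX_eq_zero hL h (fun y => f y - 1 * g y) (fun n => by rw [hf]; ring) n
  rw [actX_fun_lin] at this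
  linarith

/-! ### Polynomial functions -/

/-- The algebra of polynomial functions on `ℝ^p`. -/
def polyFun (p : ℕ) : Subalgebra ℝ ((Fin p → ℝ) → ℝ) :=
  (MvPolynomial.aeval (R := ℝ) fun (i : Fin p) (u : Fin p → ℝ) => u i).range

theorem coord_mem_polyFun (i : Fin p) : (fun u : Fin p → ℝ => u i) ∈ polyFun p :=
  ⟨MvPolynomial.X i, by simp⟩

theorem const_mem_polyFun (c : ℝ) : (fun _ : Fin p → ℝ => c) ∈ polyFun p :=
  (polyFun p).algebraMap_mem c

theorem polyFun_eq_of_nat {f g : (Fin p → ℝ) → ℝ} (hf : f ∈ polyFun p) (hg : g ∈ polyFun p)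
    (h : ∀ c : Fin p → ℕ, f (fun i => (c i : ℝ)) = g fun i => (c i : ℝ)) : f = g := by
  obtain ⟨P, rfl⟩ := hf
  obtain ⟨Q, rfl⟩ := hg
  have hev : ∀ (P : MvPolynomial (Fin p) ℝ) (u : Fin p → ℝ),
      MvPolynomial.aeval (R := ℝ) (fun (i : Fin p) (u : Fin p → ℝ) => u i) P u =
        MvPolynomial.eval u P := by
    intro P u
    have : ((Pi.evalAlgHom ℝ (fun _ : Fin p → ℝ => ℝ) u).comp
        (MvPolynomial.aeval (R := ℝ) fun (i : Fin p) (u : Fin p → ℝ) => u i)) =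
        MvPolynomial.aeval u := by
      apply MvPolynomial.algHom_ext
      intro i; simp
    simpa [MvPolynomial.aeval_eq_eval] using DFunLike.congr_fun this P
  congr 1
  refine MvPolynomial.funext_set (fun _ => Set.range ((↑) : ℕ → ℝ))
    (fun _ => Set.infinite_range_of_injective Nat.cast_injective) fun x hx => ?_
  choose c hc using fun i => hx i trivial
  obtain rfl : (fun i => (c i : ℝ)) = x := funext hc
  have := h c
  simpa [hev] using this

theorem add_mem_polyFun {f g : (Fin p → ℝ) → ℝ} (hf : f ∈ polyFun p) (hg : g ∈ polyFun p) :
    (fun u => f u + g u) ∈ polyFun p := (polyFun p).add_mem hf hg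

theorem sub_mem_polyFun {f g : (Fin p → ℝ) → ℝ} (hf : f ∈ polyFun p) (hg : g ∈ polyFun p) :
    (fun u => f u - g u) ∈ polyFun p := (polyFun p).sub_mem hf hg

theorem mul_mem_polyFun {f g : (Fin p → ℝ) → ℝ} (hf : f ∈ polyFun p) (hg : g ∈ polyFun p) :
    (fun u => f u * g u) ∈ polyFun p := (polyFun p).mul_mem hf hg

theorem poch_mem_polyFun {f : (Fin p → ℝ) → ℝ} (hf : f ∈ polyFun p) (m : ℕ) :
    (fun u => poch (f u) m) ∈ polyFun p := by
  induction m with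
  | zero => simpa [poch_zero] using const_mem_polyFun 1
  | succ m ih =>
    simp only [poch_succ]
    exact (polyFun p).mul_mem ih ((polyFun p).add_mem hf (const_mem_polyFun _))

theorem hyp_mem_polyFun (n : ℕ) {a b c d e f : (Fin p → ℝ) → ℝ} (ha : a ∈ polyFun p)
    (hb : b ∈ polyFun p) (hc : c ∈ polyFun p) (hd : d ∈ polyFun p) (he : e ∈ polyFun p)
    (hf : f ∈ polyFun p) : (fun u => hyp n (a u) (b u) (c u) (d u) (e u) (f u)) ∈ polyFun p := by
  have hsum : ∀ {ι : Type} (s : Finset ι) (F : ι → (Fin p → ℝ) → ℝ), (∀ i ∈ s, F i ∈ polyFun p) →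
      (fun u => ∑ i ∈ s, F i u) ∈ polyFun p := fun s F h => by
    have := (polyFun p).sum_mem h
    rwa [show ∑ i ∈ s, F i = fun u => ∑ i ∈ s, F i u by ext u; simp] at this
  have hadd : ∀ {g : (Fin p → ℝ) → ℝ} (r : ℝ), g ∈ polyFun p → (fun u => g u + r) ∈ polyFun p :=
    fun r hg => (polyFun p).add_mem hg (const_mem_polyFun r)
  unfold hyp
  refine hsum _ _ fun k _ => ?_
  simp only [div_eq_mul_inv]
  refine (polyFun p).mul_mem ((polyFun p).mul_mem ((polyFun p).mul_mem ((polyFun p).mul_mem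
    ((polyFun p).mul_mem (const_mem_polyFun _) ?_) ?_) ?_) (const_mem_polyFun _))
    ((polyFun p).mul_mem ((polyFun p).mul_mem ?_ ?_) ?_)
  exacts [poch_mem_polyFun ha _, poch_mem_polyFun hb _, poch_mem_polyFun hc _,
    poch_mem_polyFun (hadd _ hd) _, poch_mem_polyFun (hadd _ he) _, poch_mem_polyFun (hadd _ hf) _]

theorem latticeX_mem_polyFun (β : Fin (p + 2) → ℝ) (N : ℝ) (i : Fin p) :
    (fun u => latticeX u β N i) ∈ polyFun p := by
  refine (polyFun p).sub_mem ((polyFun p).sub_mem ?_ (const_mem_polyFun _)) (const_mem_polyFun _)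
  have := (polyFun p).sum_mem (t := Finset.univ.filter (fun l : Fin p => l ≤ i.rev))
    (f := fun l u => u l) fun l _ => coord_mem_polyFun l
  rwa [show (∑ l ∈ Finset.univ.filter (fun l : Fin p => l ≤ i.rev), fun u : Fin p → ℝ => u l) =
    fun u => psum u i.rev by ext u; simp [psum]] at this

theorem racahHat_mem_polyFun (n : Fin p → ℕ) (β : Fin (p + 2) → ℝ) (N : ℝ) :
    (fun u => racahHat n (latticeX u β N) β N) ∈ polyFun p := by
  have hseq : ∀ i, (fun u => seq (latticeX u β N) N i) ∈ polyFun p := by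
    intro i
    unfold seq
    split_ifs
    · exact latticeX_mem_polyFun β N _
    · exact const_mem_polyFun _
  have hc := fun c : ℝ => const_mem_polyFun (p := p) c
  simp only [racahHat, div_eq_mul_inv, racah_eq_chainProd, chainProd, fac]
  refine (polyFun p).mul_mem ?_ (hc _)
  have := (polyFun p).prod_mem (t := Finset.range p) (f := fun k u => fac (seq n 0 k)
    (∑ i ∈ Finset.range k, ((seq n 0 i : ℕ) : ℝ)) (seqB β k) (seqB β (k + 1)) (β 0)
    (seq (latticeX u β N) N k) (seq (latticeX u β N) N (k + 1))) fun k _ => by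
      exact hyp_mem_polyFun _ (hc _) (sub_mem_polyFun (hc _) (hseq _))
        (add_mem_polyFun (add_mem_polyFun (hc _) (hseq _)) (hc _)) (hc _)
        (add_mem_polyFun (hc _) (hseq _)) (sub_mem_polyFun (hc _) (hseq _))
  convert this using 1
  ext u
  simp [fac]

theorem exists_latticeX (x : Fin p → ℝ) (β : Fin (p + 2) → ℝ) (N : ℝ) : ∃ u, x = latticeX u β N := by
  refine ⟨diffs fun i => x i.rev + β i.rev.castSucc.succ + N, ?_⟩
  ext i
  rw [latticeX, psum_diffs, Fin.rev_rev]
  ring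

/-! ### The equations in `n` -/

/-- The function of `y` which is `R̂_p(n;x;β;N)` at the image of `n` and `0` outside the image of
`ℕ^p`. -/
def dualFun (x : Fin p → ℝ) (β : Fin (p + 2) → ℝ) (N : ℝ) : (Fin p → ℝ) → ℝ :=
  Function.extend (natPoint β N) (fun n => racahHat n x β N) 0

theorem dualFun_natPoint (x : Fin p → ℝ) (n : Fin p → ℕ) :
    dualFun x β N (natPoint β N n) = racahHat n x β N :=
  (natPoint_injective β N).extend_apply _ _ _

theorem dualFun_gridPoint (x : Fin p → ℝ) (m : Fin p → ℤ) :
    dualFun x β N (gridPoint β N m) = racahHatZ x β N m := by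
  unfold racahHatZ
  split_ifs with h
  · rw [← dualFun_natPoint]
    congr 1
    rw [natPoint]
    congr 1
    ext i
    exact (Int.toNat_of_nonneg (h i)).symm
  · refine Function.extend_apply' _ _ _ ?_
    rintro ⟨n, hn⟩
    refine h fun i => ?_
    have := gridPoint_injective β N hn
    rw [← this]
    positivity

theorem dualFun_mem_polyFun (β : Fin (p + 2) → ℝ) (N : ℝ) (y : Fin p → ℝ) :
    (fun u => dualFun (latticeX u β N) β N y) ∈ polyFun p := by
  by_cases h : ∃ n, natPoint β N n = y
  · obtain ⟨n, rfl⟩ := h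
    simp only [dualFun_natPoint]
    exact racahHat_mem_polyFun n β N
  · have : ∀ x, dualFun x β N y = 0 := fun x => Function.extend_apply' _ _ _ h
    simp only [this]
    exact const_mem_polyFun 0

theorem eigenKappa_latticeX (j : Fin p) (c : Fin p → ℕ) (β : Fin (p + 2) → ℝ) (N : ℝ) :
    eigenMu j c (dualB β N) = eigenKappa j (latticeX (fun i => (c i : ℝ)) β N) β N := by
  have e : psum (fun i => (c i : ℝ)) j = ((psum c j : ℕ) : ℝ) := by simp [psum]
  rw [eigenMu, eigenKappa, latticeX, Fin.rev_rev, e, dualB_zero, dualB, Fin.cases_succ, rev_succ']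
  ring

/-- With `x` parametrized by `u`, both sides are polynomials in `u`, so `u = c ∈ ℕ^p` suffices.
There duality makes the left-hand function a Racah polynomial of degree `c` in the dual position,
and the equation is the one already known in `x`, with eigenvalue `μ_j(c) = κ_j(x)`. -/
theorem actX_opX_dualFun (h : DualGeneric β) (hr : Regular β N) (j : Fin p) (x : Fin p → ℝ)
    (n : Fin p → ℕ) : actX (opX j) (dualB β N) N (dualFun x β N) (natPoint β N n) =
      eigenKappa j x β N * racahHat n x β N := by
  obtain ⟨u, rfl⟩ := exists_latticeX x β N
  have hgen : Generic (natPoint β N n) (dualB β N) := h.natGeneric n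
  have hop : opX j ∈ algX p := Algebra.subset_adjoin ⟨j, rfl⟩
  refine congrFun (polyFun_eq_of_nat (f := fun u => actX (opX j) (dualB β N) N
    (dualFun (latticeX u β N) β N) (natPoint β N n)) (g := fun u => eigenKappa j (latticeX u β N) β N *
      racahHat n (latticeX u β N) β N) ?_ ?_ fun c => ?_) u
  · have := (polyFun p).sum_mem (t := (opX j).support) (f := fun ν u =>
      ratValue (point (natPoint β N n) (dualB β N) N) ((opX j).coeff ν) *
        dualFun (latticeX u β N) β N (fun i => natPoint β N n i + (ν.toAdd i : ℝ)))
      fun ν _ => (polyFun p).mul_mem (const_mem_polyFun _) (dualFun_mem_polyFun _ _ _)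
    convert this using 1
    ext u
    simp [actX]
  · refine (polyFun p).mul_mem ?_ (racahHat_mem_polyFun n β N)
    have hl := latticeX_mem_polyFun β N j.rev
    exact add_mem_polyFun ((polyFun p).neg_mem (mul_mem_polyFun hl (add_mem_polyFun hl
      (const_mem_polyFun _)))) (const_mem_polyFun _)
  · rw [actX_algX_congr hop h (g := fun y => racahHat c y (dualB β N) N) fun n => ?_,
      actX_racahHat (actX_opX_racah c j fun i _ => hgen.ne i), eigenKappa_latticeX,
      racahHat_duality n c hr, natPoint_eq]
    rw [dualFun_natPoint, racahHat_duality n c hr, natPoint_eq]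

theorem eigenKappa_update (j : Fin p) (x : Fin p → ℝ) (β : Fin (p + 2) → ℝ) (N t : ℝ) :
    eigenKappa j x (Function.update β 0 t) N = eigenKappa j x β N := by
  simp [eigenKappa]

/-- The operators of `𝓐_x` act on the dual functions by scalars. -/
theorem exists_kappa {L : DiffOp p} (hL : L ∈ algX p) :
    ∃ κ : (Fin p → ℝ) → (Fin (p + 2) → ℝ) → ℝ → ℝ,
      (∀ x β N t, κ x (Function.update β 0 t) N = κ x β N) ∧
      (∀ x β, Continuous (κ x β)) ∧
      ∀ x β N, DualGeneric β → Regular β N → ∀ n,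
        actX L (dualB β N) N (dualFun x β N) (natPoint β N n) = κ x β N * racahHat n x β N := by
  have hreg : ∀ {L : DiffOp p}, L ∈ algX p → L ∈ regularAlg p := fun h => algX_le_regularAlg h
  refine Algebra.adjoin_induction (p := fun L _ => ∃ κ : (Fin p → ℝ) → (Fin (p + 2) → ℝ) → ℝ → ℝ,
      (∀ x β N t, κ x (Function.update β 0 t) N = κ x β N) ∧
      (∀ x β, Continuous (κ x β)) ∧
      ∀ x β N, DualGeneric β → Regular β N → ∀ n,
        actX L (dualB β N) N (dualFun x β N) (natPoint β N n) = κ x β N * racahHat n x β N)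
    ?_ ?_ ?_ ?_ hL
  · rintro _ ⟨j, rfl⟩
    -- Independence of `β_0` and continuity in `N` are carried through the induction because
    -- exceptional parameters are later reached by moving `β_0` and by letting `N' → N`.
    refine ⟨eigenKappa j, fun x β N t => eigenKappa_update j x β N t, fun x β => ?_,
      fun x β N h hr n => actX_opX_dualFun h hr j x n⟩
    unfold eigenKappa
    fun_prop
  · refine fun r => ⟨fun _ _ _ => r, fun _ _ _ _ => rfl, fun _ _ => continuous_const,
      fun x β N _ _ n => ?_⟩
    rw [actX_algebraMap, dualFun_natPoint]
  · rintro L M hL hM ⟨κ, h1, h2, h3⟩ ⟨κ', h1', h2', h3'⟩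
    refine ⟨fun x β N => κ x β N + κ' x β N, fun x β N t => by simp only [h1, h1'],
      fun x β => (h2 x β).add (h2' x β), fun x β N h hr n => ?_⟩
    rw [actX_add (hreg hL _ _ N (h.natGeneric n)) (hreg hM _ _ N (h.natGeneric n)), h3 x β N h hr,
      h3' x β N h hr, add_mul]
  · rintro L M hL hM ⟨κ, h1, h2, h3⟩ ⟨κ', h1', h2', h3'⟩
    refine ⟨fun x β N => κ' x β N * κ x β N, fun x β N t => by simp only [h1, h1'],
      fun x β => (h2' x β).mul (h2 x β), fun x β N h hr n => ?_⟩
    rw [regularAlg_actX_mul (hreg hL) (hreg hM) (h.natGeneric n),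
      actX_algX_congr hL h (g := fun y => κ' x β N * dualFun x β N y) fun n => ?_, actX_smul,
      h3 x β N h hr, mul_assoc]
    rw [h3' x β N h hr, dualFun_natPoint]

end DualAction

section Commutativity

variable {p : ℕ}

/-! ### Rational functions vanishing at generic points -/

/-- Every point is a limit of points satisfying `G` on the line through it in direction `d`, so the
polynomial vanishes everywhere by continuity. -/
theorem poly_eq_zero_of_line (P : Poly p) (G : (Ind p → ℝ) → Prop) (d : Ind p → ℝ)
    (hG : ∀ v : Ind p → ℝ, {t : ℝ | ¬ G fun i => v i + t * d i}.Countable)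
    (h : ∀ v, G v → MvPolynomial.eval v P = 0) : P = 0 := by
  refine MvPolynomial.funext fun v => ?_
  have := eq_of_eq_off_countable (t := 0) (f := fun t : ℝ => MvPolynomial.eval (fun i => v i + t * d i) P)
    (g := fun _ => 0) ?_ continuousAt_const (hG v) fun s hs => h _ (not_not.mp hs)
  · simpa using this
  · have hc : Continuous fun (t : ℝ) (i : Ind p) => v i + t * d i := by fun_prop
    exact ((MvPolynomial.continuous_eval P).comp hc).continuousAt

/-- A direction along which no excluded affine form is constant. -/
def lineDir : Ind p → ℝ
  | .pos _ => 1
  | .par k => (k : ℕ)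
  | .size => 1

theorem eq_point (v : Ind p → ℝ) :
    v = point (fun i => v (Ind.pos i)) (fun k => v (Ind.par k)) (v Ind.size) := by
  ext (i | k | _) <;> rfl

/-- The points at which all the eigenvalue equations hold. -/
def GenericPoint (v : Ind p → ℝ) : Prop :=
  Generic (fun i => v (Ind.pos i)) (fun k => v (Ind.par k)) ∧ DualGeneric (fun k => v (Ind.par k)) ∧
    Regular (fun k => v (Ind.par k)) (v Ind.size)

theorem countable_not_genericPoint (v : Ind p → ℝ) :
    {t : ℝ | ¬ GenericPoint fun i => v i + t * lineDir i}.Countable := by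
  have h1 : (⋃ i : Fin p, {t : ℝ | ∃ m : ℤ, (2 * v (Ind.pos i) + v (Ind.par i.castSucc.succ)) +
      (2 + ((i.castSucc.succ : Fin (p + 2)) : ℕ)) * t = m}).Countable :=
    Set.countable_iUnion fun i => countable_affine_int _ _ (by positivity)
  have h2 : (⋃ i : Fin p, {t : ℝ | ∃ m : ℤ, (v (Ind.par i.succ.succ) - v (Ind.par 0)) +
      ((i.succ.succ : Fin (p + 2)) : ℕ) * t = m}).Countable :=
    Set.countable_iUnion fun i => countable_affine_int _ _ (by simp; positivity)
  have h3 : (⋃ i : Fin p, {t : ℝ | ∃ m : ℤ, (v (Ind.par i.succ.succ) - v (Ind.par i.castSucc.succ)) +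
      1 * t = m}).Countable :=
    Set.countable_iUnion fun i => countable_affine_int _ _ one_ne_zero
  have h4 : {t : ℝ | ∃ m : ℤ, v Ind.size + 1 * t = m}.Countable := countable_affine_int _ _ one_ne_zero
  have h5 : {t : ℝ | ∃ m : ℤ, (v Ind.size + v (Ind.par 0)) + 1 * t = m}.Countable :=
    countable_affine_int _ _ one_ne_zero
  refine ((((h1.union h2).union h3).union h4).union h5).mono fun t ht => ?_
  by_contra hc
  simp only [Set.mem_union, Set.mem_iUnion, Set.mem_ofPred_eq, not_or, not_exists] at hc
  obtain ⟨⟨⟨⟨c1, c2⟩, c3⟩, c4⟩, c5⟩ := hc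
  refine ht ⟨fun i m h => c1 i m ?_, fun i m h => c2 i m ?_, fun k m h => c3 k (-m) ?_, fun m =>
    ⟨fun h => c4 m ?_, fun h => c5 m ?_⟩⟩ <;> simp [lineDir] at h ⊢ <;> linarith

theorem num_eval_eq_zero {v : Ind p → ℝ} {f : RatFun p} (hf : RatDefinedAt v f)
    (h : ratValue v f = 0) : MvPolynomial.eval v (IsFractionRing.num (Poly p) f) = 0 := by
  rw [ratValue, div_eq_zero_iff] at h
  exact h.resolve_right hf

theorem ratFun_eq_zero {f : RatFun p} (hf : ∀ v, GenericPoint v → RatDefinedAt v f ∧ ratValue v f = 0) :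
    f = 0 := by
  have : IsFractionRing.num (Poly p) f = 0 := poly_eq_zero_of_line _ GenericPoint lineDir
    countable_not_genericPoint fun v hv => num_eval_eq_zero (hf v hv).1 (hf v hv).2
  rw [num_div_den f, this, map_zero, zero_div]

theorem diffOp_eq_zero {L : DiffOp p}
    (hL : ∀ v, GenericPoint v → DefinedAt v L ∧ ∀ ν ∈ L.support, ratValue v (L.coeff ν) = 0) : L = 0 := by
  by_contra h
  obtain ⟨ν, hν⟩ := Finset.nonempty_iff_ne_empty.mpr (mt SkewMonoidAlgebra.support_eq_empty.mp h)
  exact SkewMonoidAlgebra.mem_support_iff.mp hν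
    (ratFun_eq_zero fun v hv => ⟨(hL v hv).1 ν hν, (hL v hv).2 ν hν⟩)

/-! ### Commutativity -/

theorem actX_fun_sum {ι : Type*} (L : DiffOp p) (β : Fin (p + 2) → ℝ) (N : ℝ) (x : Fin p → ℝ)
    (S : Finset ι) (a : ι → ℝ) (f : ι → (Fin p → ℝ) → ℝ) :
    actX L β N (fun y => ∑ i ∈ S, a i * f i y) x = ∑ i ∈ S, a i * actX L β N (f i) x := by
  simp only [actX, Finset.mul_sum]
  rw [Finset.sum_comm]
  exact Finset.sum_congr rfl fun i _ => Finset.sum_congr rfl fun ν _ => by ring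

variable {x : Fin p → ℝ} {β : Fin (p + 2) → ℝ} {N : ℝ}

/-- Two arguments with equal value of the quadratic `y(y + β_i)` are equal or reflections of each
other; a reflection would make `2x_i + β_i` an integer. -/
theorem eigenKappa_injective (hx : Generic x β) {ν μ : Shift p}
    (h : ∀ j, eigenKappa j (fun i => x i + (ν.toAdd i : ℝ)) β N =
      eigenKappa j (fun i => x i + (μ.toAdd i : ℝ)) β N) : ν = μ := by
  apply Multiplicative.toAdd.injective
  ext i
  have := h i.rev
  simp only [eigenKappa, Fin.rev_rev] at this
  have h1 : ((ν.toAdd i : ℝ) - μ.toAdd i) *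
      (2 * x i + β i.castSucc.succ + (ν.toAdd i + μ.toAdd i)) = 0 := by linear_combination -this
  rcases mul_eq_zero.mp h1 with h2 | h2
  · exact_mod_cast sub_eq_zero.mp h2
  · refine absurd ?_ (hx i (-(ν.toAdd i + μ.toAdd i)))
    push_cast
    linarith

/-- The functions `n ↦ R̂_p(n;x+ν;β;N)`, `ν ∈ ℤ^p`, are linearly independent for generic `x`. -/
theorem racahHat_shift_independent (hx : Generic x β) (hd : DualGeneric β) (hr : Regular β N)
    (S : Finset (Shift p)) (a : Shift p → ℝ)
    (h : ∀ n, ∑ ν ∈ S, a ν * racahHat n (fun i => x i + (ν.toAdd i : ℝ)) β N = 0) :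
    ∀ ν ∈ S, a ν = 0 := by
  classical
  induction S using Finset.induction_on generalizing a with
  | empty => simp
  | insert ν₀ S hν₀ ih =>
    have hop : ∀ j, opX j ∈ algX p := fun j => Algebra.subset_adjoin ⟨j, rfl⟩
    -- Applying the dual operator to the relation multiplies each term by its eigenvalue.
    -- Subtracting `κ_j(x + ν₀)` times the relation removes `ν₀` and leaves a shorter one, as in the
    -- independence of eigenvectors.
    have key : ∀ j n, ∑ ν ∈ insert ν₀ S, a ν * (eigenKappa j (fun i => x i + (ν.toAdd i : ℝ)) β N *
        racahHat n (fun i => x i + (ν.toAdd i : ℝ)) β N) = 0 := by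
      intro j n
      have := actX_algX_eq_zero (N := N) (hop j) hd (fun y => ∑ ν ∈ insert ν₀ S, a ν *
        dualFun (fun i => x i + (ν.toAdd i : ℝ)) β N y) (fun n => by simpa [dualFun_natPoint] using h n) n
      rw [actX_fun_sum] at this
      simpa only [actX_opX_dualFun hd hr] using this
    have hS : ∀ ν ∈ S, a ν = 0 := by
      intro ν hν
      by_contra ha
      refine hν₀ ((eigenKappa_injective (N := N) hx fun j => ?_ : ν = ν₀) ▸ hν)
      have := ih (fun ν => a ν * (eigenKappa j (fun i => x i + (ν.toAdd i : ℝ)) β N -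
        eigenKappa j (fun i => x i + (ν₀.toAdd i : ℝ)) β N)) (fun n => by
          have h1 := key j n
          have h2 := h n
          rw [Finset.sum_insert hν₀] at h1 h2
          have h3 : ∑ ν ∈ S, a ν * (eigenKappa j (fun i => x i + (ν.toAdd i : ℝ)) β N -
              eigenKappa j (fun i => x i + (ν₀.toAdd i : ℝ)) β N) *
              racahHat n (fun i => x i + (ν.toAdd i : ℝ)) β N =
            ∑ ν ∈ S, a ν * (eigenKappa j (fun i => x i + (ν.toAdd i : ℝ)) β N *
              racahHat n (fun i => x i + (ν.toAdd i : ℝ)) β N) -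
            eigenKappa j (fun i => x i + (ν₀.toAdd i : ℝ)) β N * ∑ ν ∈ S, a ν *
              racahHat n (fun i => x i + (ν.toAdd i : ℝ)) β N := by
            rw [Finset.mul_sum, ← Finset.sum_sub_distrib]
            exact Finset.sum_congr rfl fun ν _ => by ring
          rw [h3]
          linear_combination h1 - eigenKappa j (fun i => x i + (ν₀.toAdd i : ℝ)) β N * h2) ν hν
      exact sub_eq_zero.mp ((mul_eq_zero.mp this).resolve_left ha)
    intro ν hν
    rcases Finset.mem_insert.mp hν with rfl | hν
    -- Only the term `ν₀` is left, and `R̂` of degree `0` is `1`.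
    · have := h 0
      rw [Finset.sum_insert hν₀, Finset.sum_eq_zero fun μ hμ => by rw [hS μ hμ, zero_mul],
        racahHat_zero] at this
      simpa using this
    · exact hS ν hν

/-- Both products act on `R̂(n; ·)` by the product of the eigenvalues. The resulting relation among
the values `R̂(n; x + ν)` forces the coefficients of the commutator to vanish at generic points,
hence identically. -/
theorem algX_commute {L M : DiffOp p} (hL : L ∈ algX p) (hM : M ∈ algX p) : L * M = M * L := by
  rw [← sub_eq_zero]
  have hreg : ∀ {L : DiffOp p}, L ∈ algX p → L ∈ regularAlg p := fun h => algX_le_regularAlg h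
  have hK : L * M - M * L ∈ algX p := (algX p).sub_mem ((algX p).mul_mem hL hM) ((algX p).mul_mem hM hL)
  refine diffOp_eq_zero fun v hv => ?_
  obtain ⟨hx, hd, hr⟩ := hv
  rw [eq_point v]
  have hdef := regularAlg_definedAt (N := v Ind.size) (hreg hK) hx
  refine ⟨hdef, racahHat_shift_independent hx hd hr _ _ fun n => ?_⟩
  obtain ⟨μ, hμ⟩ := algX_generic_eigen hL
  obtain ⟨κ, hκ⟩ := algX_generic_eigen hM
  have hmul : ∀ {L M : DiffOp p} {μ κ : (Fin p → ℕ) → (Fin (p + 2) → ℝ) → ℝ → ℝ}, L ∈ algX p →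
      M ∈ algX p → (∀ n β N x, Generic x β →
        actX L β N (fun y => racah n y β N) x = μ n β N * racah n x β N) →
      (∀ n β N x, Generic x β →
        actX M β N (fun y => racah n y β N) x = κ n β N * racah n x β N) →
      ∀ n β N x, Generic x β → actX (L * M) β N (fun y => racah n y β N) x =
        κ n β N * μ n β N * racah n x β N := by
    intro L M μ κ hL hM hμ hκ n β N x h
    rw [regularAlg_actX_mul (hreg hL) (hreg hM) h,
      actX_congr L _ (fun y => κ n β N * racah n y β N) fun ν _ => hκ n β N _ (h.add _),
      actX_smul, hμ n β N x h, mul_assoc]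
  refine (actX_racahHat (μ := 0) ?_).trans (zero_mul _)
  rw [actX_sub (regularAlg_definedAt (hreg ((algX p).mul_mem hL hM)) hx)
    (regularAlg_definedAt (hreg ((algX p).mul_mem hM hL)) hx), hmul hL hM hμ hκ _ _ _ _ hx,
    hmul hM hL hκ hμ _ _ _ _ hx]
  ring

theorem algN_commute {L M : DiffOp p} (hL : L ∈ algN p) (hM : M ∈ algN p) : L * M = M * L := by
  obtain ⟨L, hL, rfl⟩ := hL
  obtain ⟨M, hM, rfl⟩ := hM
  have := congrArg (dualIso p) (algX_commute hL hM)
  simpa using this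

theorem algN_eq_adjoin : algN p = Algebra.adjoin ℝ (Set.range opN) := by
  rw [algN, algX, AlgHom.map_adjoin, ← Set.range_comp]
  rfl

end Commutativity

section Walls

/-! ### Invariant half-spaces -/

/-- Only the upward step of the first variable can leave the half-space. Its coefficient contains
`(x_1 + β_1 - β_0)(x_1 + β_1)`, which is zero on the wall for either choice of `a`; all other steps
preserve or lower `x_1`. -/
theorem chainOp_eq_zero_of_wall {B : ℕ → ℝ} {b0 a : ℝ} (ha : a = 0 ∨ a = b0) (m : ℕ) (Q : ℝ → ℝ)
    (f : (ℕ → ℝ) → ℝ) (x : ℕ → ℝ) (hx : ∃ t : ℕ, x 0 + B 0 - a = -t)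
    (hf : ∀ y : ℕ → ℝ, (∃ t : ℕ, y 0 + B 0 - a = -t) → f y = 0) : chainOp B b0 m Q f x = 0 := by
  induction m generalizing Q f with
  | zero => rfl
  | succ m ih =>
    have hdown : ∀ y : ℕ → ℝ, (∃ t : ℕ, y 0 + B 0 - a = -t) → f (bump m (-1) y) = 0 := by
      rintro y ⟨t, ht⟩
      rcases Nat.eq_zero_or_pos m with rfl | hm
      · exact hf _ ⟨t + 1, by rw [bump, Function.update_self]; push_cast; linarith⟩
      · exact hf _ ⟨t, by rw [bump, Function.update_of_ne hm.ne, ht]⟩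
    have hdown' : chainOp B b0 m (quadMinus (x m)) (fun y => f y - f (bump m (-1) y)) x = 0 :=
      ih _ _ fun y hy => by rw [hf y hy, hdown y hy, sub_zero]
    have hup : chainOp B b0 m (quadPlus (B m) (x m)) (fun y => f (bump m 1 y) - f y) x = 0 := by
      rcases Nat.eq_zero_or_pos m with rfl | hm
      · rfl
      · refine ih _ _ ?_
        rintro y ⟨t, ht⟩
        rw [hf y ⟨t, ht⟩, hf _ ⟨t, by rw [bump, Function.update_of_ne hm.ne, ht]⟩, sub_zero]
    have hup' : (x m + B m - b0) * (x m + B m) * f (bump m 1 x) = 0 := by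
      obtain ⟨t, ht⟩ := hx
      rcases Nat.eq_zero_or_pos m with rfl | hm
      · rcases Nat.eq_zero_or_pos t with rfl | h0
        · rcases ha with rfl | rfl
          · rw [show x 0 + B 0 = 0 by push_cast at ht; linarith]; ring
          · rw [show x 0 + B 0 - a = 0 by push_cast at ht; linarith]; ring
        · rw [hf _ ⟨t - 1, ?_⟩, mul_zero]
          rw [bump, Function.update_self, Nat.cast_sub h0]; push_cast; linarith
      · rw [hf _ ⟨t, by rw [bump, Function.update_of_ne hm.ne, ht]⟩, mul_zero]
    rw [chainOp, ih Q f hf, hup, hdown', hf x hx, hdown x hx, sub_zero, hup']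
    ring

variable {p : ℕ} {β : Fin (p + 2) → ℝ} {N : ℝ} {x : Fin p → ℝ}

/-- The half-space `x_1 + β_1 - a ∈ -ℕ`. -/
def OnWall (hp : 0 < p) (β : Fin (p + 2) → ℝ) (a : ℝ) (x : Fin p → ℝ) : Prop :=
  ∃ t : ℕ, x ⟨0, hp⟩ + β (Fin.castSucc ⟨0, hp⟩).succ - a = -t

theorem actX_eq_zero_of_wall (hp : 0 < p) {L : DiffOp p} (hL : L ∈ algX p) {a : ℝ}
    (ha : a = 0 ∨ a = β 0) (f : (Fin p → ℝ) → ℝ) (hf : ∀ y, OnWall hp β a y → f y = 0)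
    (hx : Generic x β) (hw : OnWall hp β a x) : actX L β N f x = 0 := by
  have hreg : ∀ {L : DiffOp p}, L ∈ algX p → L ∈ regularAlg p := fun h => algX_le_regularAlg h
  have key : ∀ f : (Fin p → ℝ) → ℝ, (∀ y, Generic y β → OnWall hp β a y → f y = 0) →
      ∀ x, Generic x β → OnWall hp β a x → actX L β N f x = 0 := by
    refine Algebra.adjoin_induction (p := fun L _ => ∀ f : (Fin p → ℝ) → ℝ,
      (∀ y, Generic y β → OnWall hp β a y → f y = 0) →
      ∀ x, Generic x β → OnWall hp β a x → actX L β N f x = 0) ?_ ?_ ?_ ?_ hL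
    · rintro _ ⟨j, rfl⟩ f hf x hx hw
      classical
      set f' : (Fin p → ℝ) → ℝ := fun y => if OnWall hp β a y then 0 else f y with hf'
      have hcongr : actX (opX j) β N f x = actX (opX j) β N f' x := by
        refine actX_congr _ _ _ fun ν _ => ?_
        simp only [hf']
        split_ifs with h
        · exact hf _ (hx.add _) h
        · rfl
      rw [hcongr, actX_opX j fun i _ => hx.ne i]
      have hB : seqB β 0 = β (Fin.castSucc ⟨0, hp⟩).succ := seqB_val β ⟨0, hp⟩
      refine chainOp_eq_zero_of_wall ha _ _ _ _ ?_ ?_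
      · rwa [hB, show seq x N 0 = x ⟨0, hp⟩ from seq_val x N ⟨0, hp⟩]
      · intro y hy
        rw [hB] at hy
        exact if_pos hy
    · intro r f hf x hx hw
      rw [actX_algebraMap, hf x hx hw, mul_zero]
    · intro L M hL hM h1 h2 f hf x hx hw
      rw [actX_add (hreg hL _ _ N hx) (hreg hM _ _ N hx), h1 f hf x hx hw, h2 f hf x hx hw, add_zero]
    · intro L M hL hM h1 h2 f hf x hx hw
      rw [regularAlg_actX_mul (hreg hL) (hreg hM) hx]
      exact h1 _ (h2 f hf) x hx hw
  exact key f (fun y _ => hf y) x hx hw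

/-- The indicator function of `{x + ν}`. -/
def shiftIndicator (x : Fin p → ℝ) (ν : Shift p) (y : Fin p → ℝ) : ℝ :=
  open Classical in if y = fun i => x i + (ν.toAdd i : ℝ) then 1 else 0

theorem actX_shiftIndicator (L : DiffOp p) (ν : Shift p) :
    actX L β N (shiftIndicator x ν) x = ratValue (point x β N) (L.coeff ν) := by
  classical
  rw [actX_eq_sum L (insert ν L.support) (Finset.subset_insert _ _),
    Finset.sum_eq_single_of_mem ν (Finset.mem_insert_self _ _)]
  · simp [shiftIndicator]
  · intro μ _ hμ
    rw [shiftIndicator, if_neg, mul_zero]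
    intro h
    refine hμ (Multiplicative.toAdd.injective ?_)
    ext i
    simpa using congrFun h i

/-- The coefficient is extracted by acting on the indicator of `x + ν`, a point outside the
half-space when `ν_1 > t`. Invariance of the half-space then makes it zero. -/
theorem ratValue_coeff_of_wall (hp : 0 < p) {L : DiffOp p} (hL : L ∈ algX p) {a : ℝ}
    (ha : a = 0 ∨ a = β 0) (hx : Generic x β) {t : ℕ}
    (hw : x ⟨0, hp⟩ + β (Fin.castSucc ⟨0, hp⟩).succ - a = -t) {ν : Shift p}
    (hν : (t : ℤ) < ν.toAdd ⟨0, hp⟩) : ratValue (point x β N) (L.coeff ν) = 0 := by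
  rw [← actX_shiftIndicator]
  refine actX_eq_zero_of_wall hp hL ha _ ?_ hx ⟨t, hw⟩
  rintro y ⟨s, hs⟩
  refine if_neg ?_
  rintro rfl
  have h1 : (t : ℝ) < ν.toAdd ⟨0, hp⟩ := by exact_mod_cast hν
  have h2 : (0 : ℝ) ≤ s := s.cast_nonneg
  linarith

/-! ### Divisibility of the numerators -/

/-- The linear form `x_1 + β_1 - s β_0 + t`. -/
def wallForm (hp : 0 < p) (a : ℕ × ℕ) : Poly p :=
  MvPolynomial.X (Ind.pos ⟨0, hp⟩) + MvPolynomial.X (Ind.par (Fin.castSucc ⟨0, hp⟩).succ) -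
    MvPolynomial.C (a.1 : ℝ) * MvPolynomial.X (Ind.par 0) + MvPolynomial.C (a.2 : ℝ)

/-- The images of the indeterminates under the projection to the zero set of a linear form. -/
def wallImage (hp : 0 < p) (a : ℕ × ℕ) : Ind p → Poly p
  | .pos i => if i = ⟨0, hp⟩ then MvPolynomial.X (Ind.pos i) - wallForm hp a else MvPolynomial.X (Ind.pos i)
  | i => MvPolynomial.X i

theorem dvd_sub_aeval {σ R : Type*} [CommRing R] {ℓ : MvPolynomial σ R} {g : σ → MvPolynomial σ R}
    (h : ∀ i, ℓ ∣ MvPolynomial.X i - g i) (P : MvPolynomial σ R) : ℓ ∣ P - MvPolynomial.aeval g P := by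
  induction P using MvPolynomial.induction_on with
  | C a => simp [MvPolynomial.algebraMap_eq]
  | add P Q hP hQ =>
    rw [map_add, add_sub_add_comm]
    exact dvd_add hP hQ
  | mul_X P i hP =>
    rw [map_mul, MvPolynomial.aeval_X, show P * MvPolynomial.X i - MvPolynomial.aeval g P * g i =
      (P - MvPolynomial.aeval g P) * MvPolynomial.X i +
        MvPolynomial.aeval g P * (MvPolynomial.X i - g i) by ring]
    exact dvd_add (hP.mul_right _) ((h i).mul_left _)

theorem eval_aeval_poly (v : Ind p → ℝ) (g : Ind p → Poly p) (P : Poly p) :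
    MvPolynomial.eval v (MvPolynomial.aeval g P) =
      MvPolynomial.eval (fun i => MvPolynomial.eval v (g i)) P := by
  have : ((MvPolynomial.aeval (R := ℝ) v).comp (MvPolynomial.aeval g)) =
      MvPolynomial.aeval fun i => MvPolynomial.eval v (g i) := by
    apply MvPolynomial.algHom_ext
    intro i
    simp [MvPolynomial.aeval_eq_eval]
  simpa [MvPolynomial.aeval_eq_eval] using DFunLike.congr_fun this P

theorem wallForm_dvd_sub (hp : 0 < p) (a : ℕ × ℕ) (i : Ind p) :
    wallForm hp a ∣ MvPolynomial.X i - wallImage hp a i := by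
  rcases i with i | k | _
  · rw [wallImage]
    split_ifs <;> simp
  · simp [wallImage]
  · simp [wallImage]

theorem aeval_wallImage_wallForm (hp : 0 < p) {a b : ℕ × ℕ} (ha : a.1 < 2) (hb : b.1 < 2) (hab : a ≠ b) :
    MvPolynomial.aeval (wallImage hp a) (wallForm hp b) ≠ 0 := by
  intro h
  -- At `β_0 = 1/2` and all else `0`, vanishing would mean that `2t - s` has the same value for both
  -- pairs `(s, t)`; with `s < 2` the parity of this number determines `s`.
  have h1 := congrArg (MvPolynomial.eval (point (fun _ : Fin p => (0 : ℝ))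
    (fun k => if k = 0 then (1 / 2 : ℝ) else 0) 0)) h
  simp [wallForm, wallImage, point] at h1
  have h2 : (2 * b.2 + a.1 : ℝ) = 2 * a.2 + b.1 := by linarith
  have h3 : 2 * b.2 + a.1 = 2 * a.2 + b.1 := by exact_mod_cast h2
  exact hab (Prod.ext (by omega) (by omega))

/-- The factor theorem, one linear form at a time: no form vanishes identically on the zero set of
another, so the quotient already obtained still vanishes on the next wall. -/
theorem prod_wallForm_dvd (hp : 0 < p) (S : Finset (ℕ × ℕ)) (hS : ∀ a ∈ S, a.1 < 2) (P : Poly p)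
    (hP : ∀ a ∈ S, MvPolynomial.aeval (wallImage hp a) P = 0) : ∏ a ∈ S, wallForm hp a ∣ P := by
  induction S using Finset.induction_on with
  | empty => simp
  | insert a S ha ih =>
    obtain ⟨Q, rfl⟩ := ih (fun b hb => hS b (by simp [hb])) fun b hb => hP b (by simp [hb])
    have h1 := hP a (by simp)
    rw [map_mul, map_prod, mul_eq_zero, Finset.prod_eq_zero_iff] at h1
    have h2 : MvPolynomial.aeval (wallImage hp a) Q = 0 := by
      refine h1.resolve_left ?_
      rintro ⟨b, hb, h⟩
      exact aeval_wallImage_wallForm hp (hS a (by simp)) (hS b (by simp [hb]))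
        (fun h => ha (h ▸ hb)) h
    have h3 := dvd_sub_aeval (wallForm_dvd_sub hp a) Q
    rw [h2, sub_zero] at h3
    rw [Finset.prod_insert ha, mul_comm]
    exact mul_dvd_mul_left _ h3

/-- A coefficient moving `x_1` up by at least `k` crosses the walls `t = 0, …, k - 1` of both
families, and on generic points of each of them it is zero. -/
theorem wallForm_dvd_num (hp : 0 < p) {L : DiffOp p} (hL : L ∈ algX p) {ν : Shift p} {k : ℕ}
    (hk : (k : ℤ) ≤ ν.toAdd ⟨0, hp⟩) :
    ∏ a ∈ Finset.range 2 ×ˢ Finset.range k, wallForm hp a ∣ IsFractionRing.num (Poly p) (L.coeff ν) := by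
  refine prod_wallForm_dvd hp _ (fun a ha => Finset.mem_range.mp (Finset.mem_product.mp ha).1) _ fun a ha => ?_
  obtain ⟨ha1, ha2⟩ : a.1 < 2 ∧ a.2 < k := by simpa using ha
  set proj : (Ind p → ℝ) → Ind p → ℝ := fun v i => MvPolynomial.eval v (wallImage hp a i) with hproj
  have e0 : ∀ v, proj v (Ind.pos ⟨0, hp⟩) =
      -v (Ind.par (Fin.castSucc ⟨0, hp⟩).succ) + a.1 * v (Ind.par 0) - a.2 := fun v => by
    simp [hproj, wallImage, wallForm]; ring
  have e1 : ∀ v k, proj v (Ind.par k) = v (Ind.par k) := fun v k => by simp [hproj, wallImage]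
  have e2 : ∀ v i, i ≠ ⟨0, hp⟩ → proj v (Ind.pos i) = v (Ind.pos i) := fun v i hi => by
    simp [hproj, wallImage, hi]
  -- Genericity is required of the projection onto the wall. There `2x_1 + β_1` becomes `-β_1 +
  -- 2(sβ_0 - t)`, which is still nonconstant along `lineDir`.
  refine poly_eq_zero_of_line _ (fun v => Generic (fun i => proj v (Ind.pos i))
    fun k => proj v (Ind.par k)) lineDir (fun v => ?_) fun v hv => ?_
  · have h1 : (⋃ i : Fin p, {t : ℝ | ∃ m : ℤ, (2 * v (Ind.pos i) + v (Ind.par i.castSucc.succ)) +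
        (2 + ((i.castSucc.succ : Fin (p + 2)) : ℕ)) * t = m}).Countable :=
      Set.countable_iUnion fun i => countable_affine_int _ _ (by positivity)
    have h2 : {t : ℝ | ∃ m : ℤ, (-v (Ind.par (Fin.castSucc ⟨0, hp⟩).succ) +
        2 * (a.1 * v (Ind.par 0) - a.2)) + (-1) * t = m}.Countable := countable_affine_int _ _ (by norm_num)
    refine (h1.union h2).mono fun t ht => ?_
    by_contra hc
    simp only [Set.mem_union, Set.mem_iUnion, Set.mem_ofPred_eq, not_or, not_exists] at hc
    refine ht fun i m h => ?_
    dsimp only at h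
    by_cases hi : i = ⟨0, hp⟩
    · subst hi
      rw [e0, e1] at h
      refine hc.2 m ?_
      simp [lineDir] at h ⊢
      linarith
    · rw [e2 _ i hi, e1] at h
      refine hc.1 i m ?_
      simp [lineDir] at h ⊢
      linarith
  · rw [eval_aeval_poly]
    change MvPolynomial.eval (proj v) _ = 0
    rw [eq_point (proj v)]
    refine num_eval_eq_zero (definedAt_iff.mp (algX_le_regularAlg hL _ _ _ hv) ν) ?_
    obtain ⟨s, t⟩ := a
    refine ratValue_coeff_of_wall hp hL (a := s * proj v (Ind.par 0)) ?_ hv (t := t) ?_ (by omega)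
    · have : s = 0 ∨ s = 1 := by dsimp only at ha1; omega
      rcases this with rfl | rfl <;> simp
    · rw [e0, e1, e1]
      ring

theorem prod_range_add (u : ℝ) (k : ℕ) : ∏ t ∈ Finset.range k, (u + t) = poch u k := by
  induction k with
  | zero => simp [poch_zero]
  | succ k ih => rw [Finset.prod_range_succ, ih, poch_succ]

theorem sum_dualShift (hp : 0 < p) (ν : Shift p) : ∑ i, (dualShift p ν).toAdd i = ν.toAdd ⟨0, hp⟩ := by
  have h := congrFun (psum_diffs fun i : Fin p => ν.toAdd i.rev) (Fin.rev ⟨0, hp⟩)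
  rw [Fin.rev_rev, psum, Finset.filter_true_of_mem] at h
  · exact h
  · intro i _
    rw [Fin.le_def]; simp [Fin.rev]; omega

theorem total_add_dualShift (hp : 0 < p) {ν : Shift p} {n n' : Fin p → ℕ}
    (hn : (fun i => (n' i : ℤ)) = (fun i => (n i : ℤ)) + (dualShift p ν).toAdd) :
    (total n' : ℤ) = total n + ν.toAdd ⟨0, hp⟩ := by
  rw [← sum_dualShift hp, total, total, Nat.cast_sum, Nat.cast_sum, ← Finset.sum_add_distrib]
  exact Finset.sum_congr rfl fun i _ => congrFun hn i

/-- The numerators of the coefficients contain the factors that compensate the zeros of the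
normalizer. -/
theorem exists_cofactor {L : DiffOp p} (hL : L ∈ algX p) (ν : Shift p) (n n' : Fin p → ℕ)
    (hn : (fun i => (n' i : ℤ)) = (fun i => (n i : ℤ)) + (dualShift p ν).toAdd) :
    ∃ q : Poly p, ∀ (β : Fin (p + 2) → ℝ) (N : ℝ),
      MvPolynomial.eval (point (natPoint β N n) (dualB β N) N) (IsFractionRing.num (Poly p) (L.coeff ν)) =
        poch (-N + total n) (total n' - total n) * poch (-N - β 0 + total n) (total n' - total n) *
          MvPolynomial.eval (point (natPoint β N n) (dualB β N) N) q := by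
  rcases Nat.eq_zero_or_pos (total n' - total n) with h0 | hpos
  · exact ⟨_, fun β N => by rw [h0, poch_zero, poch_zero, one_mul, one_mul]⟩
  have hp : 0 < p := by
    rcases Nat.eq_zero_or_pos p with rfl | h
    · simp [total] at hpos
    · exact h
  have hk : ((total n' - total n : ℕ) : ℤ) ≤ ν.toAdd ⟨0, hp⟩ := by
    have := total_add_dualShift hp hn
    omega
  obtain ⟨q, hq⟩ := wallForm_dvd_num hp hL hk
  refine ⟨q, fun β N => ?_⟩
  rw [hq, map_mul, map_prod, Finset.prod_product, Finset.prod_range_succ, Finset.prod_range_one]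
  -- Under `𝔟` the form `x_1 + β_1` becomes `|n| - N`, so the two families of walls turn into the
  -- Pochhammer factors in `-N` and `-N - β_0`.
  have hx : natPoint β N n ⟨0, hp⟩ + dualB β N (Fin.castSucc ⟨0, hp⟩).succ = total n - N := by
    have h1 := natPoint_add_dualB (β := β) (N := N) n 0 hp
    rw [show seq (natPoint β N n) N 0 = natPoint β N n ⟨0, hp⟩ from seq_val _ N ⟨0, hp⟩,
      show seqB (dualB β N) 0 = _ from seqB_val (dualB β N) ⟨0, hp⟩, Nat.sub_zero, ← total_eq] at h1
    exact h1
  have e : ∀ s t : ℕ, MvPolynomial.eval (point (natPoint β N n) (dualB β N) N) (wallForm hp (s, t)) =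
      (total n - N - s * β 0) + t := fun s t => by
    simp only [wallForm, map_add, map_sub, map_mul, MvPolynomial.eval_X, MvPolynomial.eval_C, point,
      dualB_zero]
    rw [hx]
  simp only [e]
  rw [prod_range_add, prod_range_add]
  congr 3 <;> push_cast <;> ring

end Walls

section DualEquations

variable {p : ℕ} {β : Fin (p + 2) → ℝ} {N : ℝ}

/-! ### Perturbation of `β_0` -/

/-- The parameters with `β_0` replaced by `β_0 + t`. -/
def moveZero (β : Fin (p + 2) → ℝ) (t : ℝ) : Fin (p + 2) → ℝ := Function.update β 0 (β 0 + t)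

theorem moveZero_zero (β : Fin (p + 2) → ℝ) : moveZero β 0 = β := by
  simp [moveZero]

theorem moveZero_succ (β : Fin (p + 2) → ℝ) (t : ℝ) (k : Fin (p + 1)) : moveZero β t k.succ = β k.succ := by
  simp [moveZero]

theorem continuous_moveZero (β : Fin (p + 2) → ℝ) : Continuous (moveZero β) :=
  continuous_const.update 0 (continuous_const.add continuous_id)

theorem countable_not_dualGeneric (β : Fin (p + 2) → ℝ) : {t : ℝ | ¬ DualGeneric (moveZero β t)}.Countable := by
  refine (Set.countable_iUnion fun i : Fin p =>
    countable_affine_int (β i.succ.succ - β 0) (-1) (by norm_num)).mono fun t ht => ?_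
  by_contra hc
  simp only [Set.mem_iUnion, Set.mem_ofPred_eq, not_exists] at hc
  refine ht fun i m h => hc i m ?_
  rw [moveZero_succ, moveZero, Function.update_self] at h
  linarith

theorem countable_not_regular (h : Regular β N) : {t : ℝ | ¬ Regular (moveZero β t) N}.Countable := by
  refine (countable_affine_int (N + β 0) 1 one_ne_zero).mono fun t ht => ?_
  by_contra hc
  simp only [Set.mem_ofPred_eq, not_exists] at hc
  refine ht ⟨fun k m => ?_, fun m => ⟨(h.2 m).1, fun h => hc m ?_⟩⟩
  · rw [moveZero_succ, moveZero_succ]; exact h.1 k m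
  · rw [moveZero, Function.update_self] at h
    push_cast
    linarith

/-! ### Continuity in the parameters -/

theorem continuousAt_racahHatZ {X : Type*} [TopologicalSpace X] {B : X → Fin (p + 2) → ℝ} {M : X → ℝ}
    (hB : Continuous B) (hM : Continuous M) (x : Fin p → ℝ) (m : Fin p → ℤ) (t : X)
    (h : (∀ i, 0 ≤ m i) → normalizer (fun i => (m i).toNat) (B t) (M t) ≠ 0) :
    ContinuousAt (fun s => racahHatZ x (B s) (M s) m) t := by
  unfold racahHatZ
  split_ifs with h0
  · exact (continuous_racah _ continuous_const hB hM).continuousAt.div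
      (continuous_normalizer _ hB hM).continuousAt (h h0)
  · exact continuousAt_const

theorem continuousAt_coeffN {X : Type*} [TopologicalSpace X] {B : X → Fin (p + 2) → ℝ} {M : X → ℝ}
    (hB : Continuous B) (hM : Continuous M) {L : DiffOp p} {m : Fin p → ℤ} {t : X} {ν : Shift p}
    (h : RatDefinedAt (point (fun i => (m i : ℝ)) (B t) (M t)) (L.coeff ν)) :
    ContinuousAt (fun s => coeffN L (B s) (M s) m ν) t :=
  ratValue_continuousAt (v := fun s => point (fun i => (m i : ℝ)) (B s) (M s))
    (continuous_point continuous_const hB hM).continuousAt h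

theorem racahHatZ_natCast (x : Fin p → ℝ) (n : Fin p → ℕ) :
    racahHatZ x β N (fun i => (n i : ℤ)) = racahHat n x β N := by
  rw [← dualFun_gridPoint]
  exact dualFun_natPoint x n

/-! ### The equations at regular parameters -/

theorem definedAt_natCast {L : DiffOp p} {n : Fin p → ℕ} :
    DefinedAt (point (fun i => (((fun i => (n i : ℤ)) i : ℤ) : ℝ)) β N) L ↔
      DefinedAt (point (fun i => (n i : ℝ)) β N) L := by
  simp

theorem DualGeneric.definedAt {L : DiffOp p} (hL : L ∈ algX p) (h : DualGeneric β) (n : Fin p → ℕ) :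
    DefinedAt (point (fun i => (n i : ℝ)) β N) (dualIso p L) := by
  rw [definedAt_dualIso, ← natPoint_eq]
  exact algX_le_regularAlg hL _ _ _ (h.natGeneric n)

/-- The coefficients of the terms which leave `ℕ^p` vanish. -/
theorem coeffN_eq_zero {L : DiffOp p} (hL : L ∈ algX p) {n : Fin p → ℕ}
    (h : DefinedAt (point (fun i => (n i : ℝ)) β N) (dualIso p L)) {ν : Shift p}
    (hν : ∃ i, (n i : ℤ) + ν.toAdd i < 0) : coeffN (dualIso p L) β N (fun i => (n i : ℤ)) ν = 0 := by
  have key : ∀ β : Fin (p + 2) → ℝ, DualGeneric β →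
      coeffN (dualIso p L) β N (fun i => (n i : ℤ)) ν = 0 := by
    intro β hd
    obtain ⟨ν, rfl⟩ := (dualShift p).surjective ν
    rw [coeffN, ratValue_coeff_dualIso (algX_le_regularAlg hL _ _ _ (hd.generic _)),
      -- The target grid point lies outside the image of `ℕ^p`, so its indicator vanishes on that
      -- image and the operator preserves this.
      ← actX_shiftIndicator]
    refine actX_algX_eq_zero hL hd _ (fun m => if_neg fun hm => ?_) n
    change gridPoint β N _ = fun i => gridPoint β N (fun i => (n i : ℤ)) i + (ν.toAdd i : ℝ) at hm
    rw [gridPoint_add] at hm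
    obtain ⟨i, hi⟩ := hν
    have h1 := congrFun (gridPoint_injective β N hm) i
    simp only [Pi.add_apply] at h1
    omega
  have := eq_of_eq_off_countable (t := 0)
    (f := fun t => coeffN (dualIso p L) (moveZero β t) N (fun i => (n i : ℤ)) ν) (g := fun _ => 0)
    (continuousAt_coeffN (continuous_moveZero β) continuous_const ?_) continuousAt_const
    (countable_not_dualGeneric β) fun t ht => key _ (not_not.mp ht)
  · simpa [moveZero_zero] using this
  · rw [moveZero_zero]
    exact definedAt_iff.mp (definedAt_natCast.mpr h) ν

/-- `DualGeneric` is removed by moving `β_0`: it fails for countably many displacements only, both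
sides are continuous at displacement `0`, and `κ` does not involve `β_0`. -/
theorem actN_eq {L : DiffOp p} (hL : L ∈ algX p) {κ : (Fin (p + 2) → ℝ) → ℝ} {x : Fin p → ℝ}
    (hκ : ∀ β t, κ (Function.update β 0 t) = κ β)
    (heq : ∀ β, DualGeneric β → Regular β N → ∀ n,
      actX L (dualB β N) N (dualFun x β N) (natPoint β N n) = κ β * racahHat n x β N)
    {n : Fin p → ℕ} (h : DefinedAt (point (fun i => (n i : ℝ)) β N) (dualIso p L)) (hr : Regular β N) :
    actN (dualIso p L) β N (racahHatZ x β N) (fun i => (n i : ℤ)) = κ β * racahHat n x β N := by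
  have hnz : ∀ m, normalizer m (moveZero β 0) N ≠ 0 := fun m => by
    rw [moveZero_zero]; exact hr.normalizer_ne_zero
  have := eq_of_eq_off_countable (t := 0)
    (f := fun t => actN (dualIso p L) (moveZero β t) N (racahHatZ x (moveZero β t) N) (fun i => (n i : ℤ)))
    (g := fun t => κ β * racahHatZ x (moveZero β t) N (fun i => (n i : ℤ))) ?_ ?_
    ((countable_not_dualGeneric β).union (countable_not_regular hr)) fun t ht => ?_
  · simpa [moveZero_zero, racahHatZ_natCast] using this
  · refine tendsto_finsetSum _ fun ν _ => Tendsto.mul ?_ ?_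
    · refine continuousAt_coeffN (continuous_moveZero β) continuous_const ?_
      rw [moveZero_zero]
      exact definedAt_iff.mp (definedAt_natCast.mpr h) ν
    · exact continuousAt_racahHatZ (continuous_moveZero β) continuous_const x _ 0 fun _ => hnz _
  · exact continuousAt_const.mul
      (continuousAt_racahHatZ (continuous_moveZero β) continuous_const x _ 0 fun _ => hnz _)
  · simp only [Set.mem_union, Set.mem_ofPred_eq, not_or, not_not] at ht
    rw [actN_dualIso (algX_le_regularAlg hL _ _ _ (ht.1.generic _)) _ _ (dualFun_gridPoint x),
      racahHatZ_natCast, ← hκ β (β 0 + t)]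
    exact heq _ ht.1 ht.2 n

/-! ### The limit in `N` -/

theorem eventually_ne_int (c : ℝ) : ∀ᶠ y : ℝ in 𝓝[≠] c, ∀ m : ℤ, y ≠ m := by
  have hcl : IsClosed (((↑) : ℤ → ℝ) '' {m : ℤ | (m : ℝ) ≠ c}) :=
    Int.isClosedEmbedding_coe_real.isClosedMap _ (isClosed_discrete _)
  have h1 : ∀ᶠ y in 𝓝[≠] c, y ∈ (((↑) : ℤ → ℝ) '' {m : ℤ | (m : ℝ) ≠ c})ᶜ :=
    nhdsWithin_le_nhds (hcl.isOpen_compl.mem_nhds (by rintro ⟨m, hm, h⟩; exact hm h))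
  filter_upwards [h1, self_mem_nhdsWithin] with y hy hyc m hm
  exact hy ⟨m, by rw [Set.mem_ofPred_eq, ← hm]; exact hyc, hm.symm⟩

theorem eventually_ne_nat (N b : ℝ) : ∀ᶠ N' : ℝ in 𝓝[≠] N, ∀ m : ℕ, N' ≠ m ∧ N' + b ≠ m := by
  have hmap : Tendsto (fun N' : ℝ => N' + b) (𝓝[≠] N) (𝓝[≠] (N + b)) := by
    refine tendsto_nhdsWithin_of_tendsto_nhds_of_eventually_within _ ?_ ?_
    · exact ((continuous_id.add continuous_const).tendsto N).mono_left nhdsWithin_le_nhds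
    · filter_upwards [self_mem_nhdsWithin] with y hy h
      exact hy (by simpa using h)
  filter_upwards [eventually_ne_int N, hmap.eventually (eventually_ne_int (N + b))] with y h1 h2 m
  exact ⟨by exact_mod_cast h1 m, by exact_mod_cast h2 m⟩

theorem eventually_definedAt {L : DiffOp p} {y : Fin p → ℝ} (h : DefinedAt (point y β N) L) :
    ∀ᶠ N' in 𝓝[≠] N, DefinedAt (point y β N') L := by
  refine (Filter.eventually_all_finset L.support).mpr fun ν hν => nhdsWithin_le_nhds ?_
  have hc : Continuous fun N' : ℝ => MvPolynomial.eval (point y β N')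
      (IsFractionRing.den (Poly p) (L.coeff ν) : Poly p) :=
    (MvPolynomial.continuous_eval _).comp (continuous_point continuous_const continuous_const continuous_id)
  exact hc.continuousAt.eventually_ne (h ν hν)

theorem continuous_dualPoint (n : Fin p → ℕ) (β : Fin (p + 2) → ℝ) :
    Continuous fun N => point (natPoint β N n) (dualB β N) N := by
  refine continuous_point (continuous_pi fun i => ?_) (continuous_pi fun k => ?_) continuous_id
  · simp only [natPoint_eq, dualX]; fun_prop
  · refine Fin.cases ?_ (fun k => ?_) k
    · exact continuous_const
    · simp only [dualB, Fin.cases_succ]; fun_prop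

/-- Every term of `L R̂` has a limit. -/
theorem exists_tendsto_term {L : DiffOp p} (hL : L ∈ algX p) {n : Fin p → ℕ}
    (h : DefinedAt (point (fun i => (n i : ℝ)) β N) (dualIso p L))
    (hβ : ∀ (k : Fin p) (m : ℕ), β k.succ.succ - β k.castSucc.succ + m ≠ 0)
    (hN : ∀ m : ℕ, m < total n → N ≠ m ∧ N + β 0 ≠ m) (x : Fin p → ℝ) (ν : Shift p) :
    ∃ T, Tendsto (fun N' : ℝ => coeffN (dualIso p L) β N' (fun i => (n i : ℤ)) ν *
        racahHatZ x β N' ((fun i => (n i : ℤ)) + ν.toAdd)) (𝓝[≠] N) (𝓝 T) := by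
  by_cases hν : ∀ i, 0 ≤ ((fun i => (n i : ℤ)) + ν.toAdd) i
  swap
  · refine ⟨0, ?_⟩
    simp only [racahHatZ, if_neg hν, mul_zero]
    exact tendsto_const_nhds
  obtain ⟨ν, rfl⟩ := (dualShift p).surjective ν
  set n' : Fin p → ℕ := fun i => (((fun i => (n i : ℤ)) + (dualShift p ν).toAdd) i).toNat with hn'
  have hnn : (fun i => (n' i : ℤ)) = (fun i => (n i : ℤ)) + (dualShift p ν).toAdd :=
    funext fun i => Int.toNat_of_nonneg (hν i)
  rw [← hnn]
  simp only [racahHatZ_natCast]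
  obtain ⟨q, hq⟩ := exists_cofactor hL ν n n' hnn
  set k := total n' - total n with hk
  set m := min (total n) (total n') with hm
  -- The normalizer of the target is split at degree `min |n| |n'|`. The lower part is nonzero at
  -- `N` by hypothesis; the upper part may vanish there but is exactly what the numerator of the
  -- coefficient contains.
  have hnorm : ∀ N', normalizer n' β N' = poch (-N' + total n) k * poch (-N' - β 0 + total n) k *
      (poch (-N') m * poch (-N' - β 0) m * ∏ i : Fin p, poch (β i.succ.succ - β i.castSucc.succ) (n' i)) := by
    intro N'
    have hp : ∀ a, poch a (total n') = poch a m * poch (a + total n) k := by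
      intro a
      rcases le_total (total n') (total n) with hle | hle
      · rw [hk, Nat.sub_eq_zero_of_le hle, poch_zero, mul_one, hm, min_eq_right hle]
      · rw [hm, min_eq_left hle, ← poch_add, hk, Nat.add_sub_cancel' hle]
    rw [normalizer, hp, hp]
    ring
  set P := fun N' => point (natPoint β N' n) (dualB β N') N' with hP
  have hPc : Continuous P := continuous_dualPoint n β
  have hL' : DefinedAt (P N) L := by
    have := definedAt_dualIso.mp h
    rwa [← natPoint_eq] at this
  set den := (IsFractionRing.den (Poly p) (L.coeff ν) : Poly p) with hden
  set F := fun N' => MvPolynomial.eval (P N') q / MvPolynomial.eval (P N') den * racah n' x β N' /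
      (poch (-N') m * poch (-N' - β 0) m * ∏ i : Fin p, poch (β i.succ.succ - β i.castSucc.succ) (n' i))
    with hF
  refine ⟨F N, ?_⟩
  have hcont : ContinuousAt F N := by
    have hev : ∀ q : Poly p, Continuous fun N' => MvPolynomial.eval (P N') q := fun q =>
      (MvPolynomial.continuous_eval q).comp hPc
    refine (((hev q).continuousAt.div (hev den).continuousAt (definedAt_iff.mp hL' ν)).mul
      (continuous_racah n' continuous_const continuous_const continuous_id).continuousAt).div
      (Continuous.continuousAt (by fun_prop)) ?_
    refine mul_ne_zero (mul_ne_zero ?_ ?_) (Finset.prod_ne_zero_iff.mpr fun i _ => ?_)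
    · exact poch_ne_zero _ fun i hi h0 => (hN i (by omega)).1 (by linarith)
    · exact poch_ne_zero _ fun i hi h0 => (hN i (by omega)).2 (by linarith)
    · exact poch_ne_zero _ fun j _ => hβ i j
  refine (hcont.tendsto.mono_left nhdsWithin_le_nhds).congr' ?_
  filter_upwards [eventually_ne_nat N (β 0), eventually_definedAt h] with N' h1 h2
  have h3 : DefinedAt (P N') L := by
    have := definedAt_dualIso.mp h2
    rwa [← natPoint_eq] at this
  have h4 : coeffN (dualIso p L) β N' (fun i => (n i : ℤ)) (dualShift p ν) =
      ratValue (P N') (L.coeff ν) := ratValue_coeff_dualIso h3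
  have h5 : poch (-N' + total n) k ≠ 0 := poch_ne_zero _ fun i _ h0 =>
    (h1 (total n + i)).1 (by push_cast; linarith)
  have h6 : poch (-N' - β 0 + total n) k ≠ 0 := poch_ne_zero _ fun i _ h0 =>
    (h1 (total n + i)).2 (by push_cast; linarith)
  rw [h4, racahHat, hnorm, ratValue, hq, hF]
  simp only
  rw [div_mul_div_comm, div_mul_eq_mul_div, div_div]
  rw [show ∀ A B C D E G H : ℝ, A * B * C * D / (E * (A * B * (G * H))) =
    (A * B) * (C * D) / ((A * B) * (E * (G * H))) from fun A B C D E G H => by ring_nf,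
    mul_div_mul_left _ _ (mul_ne_zero h5 h6)]

/-- For `N'` close to `N` but different from it all parameters in `N'` are regular and the equation
holds; the limits of the terms then sum to the limit of the right-hand side. -/
theorem actsInLimit {L : DiffOp p} (hL : L ∈ algX p) {κ : (Fin (p + 2) → ℝ) → ℝ → ℝ} {x : Fin p → ℝ}
    (hκ : ∀ β N t, κ (Function.update β 0 t) N = κ β N) (hκc : ∀ β, Continuous (κ β))
    (heq : ∀ β N, DualGeneric β → Regular β N → ∀ n,
      actX L (dualB β N) N (dualFun x β N) (natPoint β N n) = κ β N * racahHat n x β N)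
    {n : Fin p → ℕ} (h : DefinedAt (point (fun i => (n i : ℝ)) β N) (dualIso p L))
    (hβ : ∀ (k : Fin p) (m : ℕ), β k.succ.succ - β k.castSucc.succ + m ≠ 0)
    (hN : ∀ m : ℕ, m < total n → N ≠ m ∧ N + β 0 ≠ m) :
    ActsInLimit (dualIso p L) β N x n (κ β N * racahHat n x β N) := by
  choose T hT using exists_tendsto_term hL h hβ hN x
  refine ⟨T, fun ν _ => hT ν, ?_⟩
  have h1 := tendsto_finsetSum (dualIso p L).support fun ν _ => hT ν
  have h2 : Tendsto (fun N' => κ β N' * racahHatZ x β N' (fun i => (n i : ℤ))) (𝓝[≠] N)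
      (𝓝 (κ β N * racahHat n x β N)) := by
    rw [← racahHatZ_natCast x n]
    refine Tendsto.mono_left ?_ nhdsWithin_le_nhds
    refine (hκc β).continuousAt.mul
      (continuousAt_racahHatZ continuous_const continuous_id x _ N fun _ => ?_)
    exact normalizer_ne_zero hβ (by simpa using hN)
  refine tendsto_nhds_unique h1 (h2.congr' ?_)
  filter_upwards [eventually_ne_nat N (β 0), eventually_definedAt h] with N' h3 h4
  rw [racahHatZ_natCast, ← actN_eq hL (fun β t => hκ β N' t) (fun β => heq β N') h4 ⟨hβ, h3⟩]
  rfl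

/-- In the variables `n` this bounds the increase of `|n|` by one, so the plain equation needs only
normalizers up to degree `|n| + 1`. -/
theorem toAdd_le_one_of_mem_support_opX {j : Fin p} {ν : Shift p} (hν : ν ∈ (opX j).support) (i : Fin p) :
    ν.toAdd i ≤ 1 := by
  by_contra hc
  refine SkewMonoidAlgebra.mem_support_iff.mp hν (ratFun_eq_zero fun v hv => ?_)
  have hx := hv.1
  rw [eq_point v]
  refine ⟨definedAt_iff.mp (definedAt_opX j fun i _ => hx.ne i) ν, ?_⟩
  rw [← actX_shiftIndicator, actX_opX j fun i _ => hx.ne i]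
  refine chainOp_eq_zero _ _ _ _ fun y hy => if_neg fun h => hc ?_
  have h1 := congrFun h i
  have h2 := hy.2 i
  rw [seq_val] at h2
  simp only at h1
  rw [h1] at h2
  have h3 : (ν.toAdd i : ℝ) = 0 ∨ (ν.toAdd i : ℝ) = 1 ∨ (ν.toAdd i : ℝ) = -1 := by
    rcases h2 with h2 | h2 | h2
    · left; linarith
    · right; left; linarith
    · right; right; linarith
  norm_cast at h3
  omega

theorem total_le_of_mem_support_opN {j : Fin p} {ν : Shift p} (hν : ν ∈ (opN j).support) {n n' : Fin p → ℕ}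
    (hn : (fun i => (n' i : ℤ)) = (fun i => (n i : ℤ)) + ν.toAdd) : total n' ≤ total n + 1 := by
  obtain ⟨ν, rfl⟩ := (dualShift p).surjective ν
  have hp : 0 < p := by have := j.2; omega
  have h1 := toAdd_le_one_of_mem_support_opX (mem_support_dualIso.mp hν) ⟨0, hp⟩
  have h2 := total_add_dualShift hp hn
  omega

/-- If no term has a pole, then the action in the limit is the action. -/
theorem ActsInLimit.actN_eq {j : Fin p} {x : Fin p → ℝ} {n : Fin p → ℕ} {s : ℝ}
    (h : ActsInLimit (opN j) β N x n s) (hd : DefinedAt (point (fun i => (n i : ℝ)) β N) (opN j))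
    (hβ : ∀ (k : Fin p) (m : ℕ), β k.succ.succ - β k.castSucc.succ + m ≠ 0)
    (hN : ∀ m : ℕ, m ≤ total n → N ≠ m ∧ N + β 0 ≠ m) :
    actN (opN j) β N (racahHatZ x β N) (fun i => (n i : ℤ)) = s := by
  obtain ⟨T, hT, rfl⟩ := h
  refine Finset.sum_congr rfl fun ν hν => tendsto_nhds_unique ?_ (hT ν hν)
  refine Tendsto.mono_left ?_ nhdsWithin_le_nhds
  refine (continuousAt_coeffN continuous_const continuous_id
    (definedAt_iff.mp (definedAt_natCast.mpr hd) ν)).mul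
    (continuousAt_racahHatZ continuous_const continuous_id x _ N fun h0 => ?_)
  -- The normalizer of degree `|n| + 1` involves the values `m ≤ |n|`, which is why the assumption
  -- is not strict here.
  refine normalizer_ne_zero hβ fun m hm => hN m ?_
  have := total_le_of_mem_support_opN hν (n := n) (funext fun i => Int.toNat_of_nonneg (h0 i))
  omega

end DualEquations

end Racah

end

/-! ### Assembly of the theorem -/

theorem theorem4p6 (p : ℕ) :
    -- the two algebras are commutative, and `𝓐_n = 𝔟(𝓐_x)` is generated by the `𝔏^n_j = 𝔟(𝔏^x_j)`
    (∀ L ∈ Racah.algX p, ∀ M ∈ Racah.algX p, L * M = M * L) ∧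
    (∀ L ∈ Racah.algN p, ∀ M ∈ Racah.algN p, L * M = M * L) ∧
    Racah.algN p = Algebra.adjoin ℝ (Set.range Racah.opN) ∧
    -- the eigenfunctions are not identically zero
    (∀ (n : Fin p → ℕ) (β : Fin (p + 2) → ℝ) (N : ℝ), Racah.normalizer n β N ≠ 0 →
      ∃ x : Fin p → ℝ, Racah.racahHat n x β N ≠ 0) ∧
    -- `𝔏^x_j R̂ = μ_j(n) R̂`
    (∀ (n : Fin p → ℕ) (β : Fin (p + 2) → ℝ) (N : ℝ) (x : Fin p → ℝ) (j : Fin p),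
      Racah.normalizer n β N ≠ 0 →
      (∀ i ≤ j, 2 * x i + β i.castSucc.succ ≠ 0 ∧ 2 * x i + β i.castSucc.succ + 1 ≠ 0 ∧
        2 * x i + β i.castSucc.succ - 1 ≠ 0) →
      Racah.DefinedAt (Racah.point x β N) (Racah.opX j) ∧
      Racah.actX (Racah.opX j) β N (fun y => Racah.racahHat n y β N) x =
        Racah.eigenMu j n β * Racah.racahHat n x β N) ∧
    -- `𝔏^n_j R̂ = κ_j(x) R̂`
    (∀ (n : Fin p → ℕ) (β : Fin (p + 2) → ℝ) (N : ℝ) (j : Fin p),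
      (∀ (k : Fin p) (m : ℕ), β k.succ.succ - β k.castSucc.succ + m ≠ 0) →
      (∀ i : Fin p, j.rev ≤ i →
        2 * ((Racah.psum n i : ℕ) : ℝ) + β i.succ.succ - β 0 - 1 ≠ 0 ∧
        2 * ((Racah.psum n i : ℕ) : ℝ) + β i.succ.succ - β 0 ≠ 0 ∧
        2 * ((Racah.psum n i : ℕ) : ℝ) + β i.succ.succ - β 0 - 2 ≠ 0) →
      Racah.DefinedAt (Racah.point (fun i => (n i : ℝ)) β N) (Racah.opN j) ∧
      -- no term involves a point outside `ℕ^p`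
      (∀ ν : Racah.Shift p, (∃ i, (n i : ℤ) + ν.toAdd i < 0) →
        Racah.coeffN (Racah.opN j) β N (fun i => (n i : ℤ)) ν = 0) ∧
      -- the equation itself, when `R̂` is defined for all multi-indices of total degree `≤ |n| + 1`
      ((∀ m : ℕ, m ≤ Racah.total n → N ≠ m ∧ N + β 0 ≠ m) → ∀ x : Fin p → ℝ,
        Racah.actN (Racah.opN j) β N (Racah.racahHatZ x β N) (fun i => (n i : ℤ)) =
          Racah.eigenKappa j x β N * Racah.racahHat n x β N) ∧
      -- the equation in the limit, when `R̂` is defined for `n`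
      -- (this is `|n| ≤ N` when `N` is a natural number)
      ((∀ m : ℕ, m < Racah.total n → N ≠ m ∧ N + β 0 ≠ m) → ∀ x : Fin p → ℝ,
        Racah.ActsInLimit (Racah.opN j) β N x n
          (Racah.eigenKappa j x β N * Racah.racahHat n x β N))) ∧
    -- every operator of `𝓐_x` is diagonalized, with eigenvalues independent of `x`
    (∀ L ∈ Racah.algX p,
      (∀ (x : Fin p → ℝ) (β : Fin (p + 2) → ℝ) (N : ℝ),
        (∀ (i : Fin p) (m : ℤ), 2 * x i + β i.castSucc.succ ≠ m) →
        Racah.DefinedAt (Racah.point x β N) L) ∧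
      ∃ μ : (Fin p → ℕ) → (Fin (p + 2) → ℝ) → ℝ → ℝ,
        ∀ (n : Fin p → ℕ) (β : Fin (p + 2) → ℝ) (N : ℝ) (x : Fin p → ℝ),
          Racah.normalizer n β N ≠ 0 → Racah.DefinedAt (Racah.point x β N) L →
          Racah.actX L β N (fun y => Racah.racahHat n y β N) x =
            μ n β N * Racah.racahHat n x β N) ∧
    -- every operator of `𝓐_n` is diagonalized, with eigenvalues independent of `n`
    (∀ L ∈ Racah.algN p,
      (∀ (n : Fin p → ℕ) (β : Fin (p + 2) → ℝ) (N : ℝ),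
        (∀ (i : Fin p) (m : ℤ), β i.succ.succ - β 0 ≠ m) →
        Racah.DefinedAt (Racah.point (fun i => (n i : ℝ)) β N) L) ∧
      ∃ κ : (Fin p → ℝ) → (Fin (p + 2) → ℝ) → ℝ → ℝ,
        ∀ (n : Fin p → ℕ) (β : Fin (p + 2) → ℝ) (N : ℝ) (x : Fin p → ℝ),
          (∀ (k : Fin p) (m : ℕ), β k.succ.succ - β k.castSucc.succ + m ≠ 0) →
          Racah.DefinedAt (Racah.point (fun i => (n i : ℝ)) β N) L →
          ((∀ m : ℕ, N ≠ m ∧ N + β 0 ≠ m) →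
            Racah.actN L β N (Racah.racahHatZ x β N) (fun i => (n i : ℤ)) =
              κ x β N * Racah.racahHat n x β N) ∧
          ((∀ m : ℕ, m < Racah.total n → N ≠ m ∧ N + β 0 ≠ m) →
            Racah.ActsInLimit L β N x n (κ x β N * Racah.racahHat n x β N))) := by
  open Racah in
  refine ⟨fun L hL M hM => algX_commute hL hM, fun L hL M hM => algN_commute hL hM, algN_eq_adjoin,
    exists_racahHat_ne_zero, fun n β N x j _ hx => ⟨definedAt_opX j hx,
      actX_racahHat (actX_opX_racah n j hx)⟩, fun n β N j hβ hn => ?_, fun L hL => ?_, ?_⟩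
  · have hop : opX j ∈ algX p := Algebra.subset_adjoin ⟨j, rfl⟩
    have hd : DefinedAt (point (fun i => (n i : ℝ)) β N) (opN j) := by
      rw [opN, definedAt_dualIso]
      refine definedAt_opX j fun i hi => ?_
      rw [two_mul_dualX]
      have e : psum (fun i => (n i : ℝ)) i.rev = ((psum n i.rev : ℕ) : ℝ) := by simp [psum]
      rw [e]
      -- The map `𝔟` reverses the order of the variables, so the condition for `i ≤ j` becomes one
      -- for indices from `j.rev` on.
      obtain ⟨h1, h2, h3⟩ := hn i.rev (Fin.rev_le_rev.mpr hi)
      exact ⟨h1, fun h => h2 (by linarith), fun h => h3 (by linarith)⟩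
    have hlim : ∀ (x : Fin p → ℝ), (∀ m : ℕ, m < total n → N ≠ m ∧ N + β 0 ≠ m) →
        ActsInLimit (opN j) β N x n (eigenKappa j x β N * racahHat n x β N) := fun x hN =>
      actsInLimit hop (κ := fun β N => eigenKappa j x β N) (fun β N t => eigenKappa_update j x β N t)
        (fun β => by unfold eigenKappa; fun_prop)
        (fun β N h hr n => actX_opX_dualFun h hr j x n) hd hβ hN
    exact ⟨hd, fun ν hν => coeffN_eq_zero hop hd hν,
      fun hN x => (hlim x fun m hm => hN m hm.le).actN_eq hd hβ hN, fun hN x => hlim x hN⟩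
  · obtain ⟨μ, hμ⟩ := algX_generic_eigen hL
    exact ⟨fun x β N h => algX_le_regularAlg hL x β N h, μ, fun n β N x _ hd =>
      actX_racahHat (actX_eq_of_generic (fun y hy => hμ n β N y hy) hd)⟩
  · rintro _ ⟨L, hL, rfl⟩
    obtain ⟨κ, h1, h2, h3⟩ := exists_kappa hL
    refine ⟨fun n β N h => DualGeneric.definedAt hL h n, κ, fun n β N x hβ hd => ⟨fun hN => ?_, fun hN => ?_⟩⟩
    · exact actN_eq hL (fun β t => h1 x β N t) (fun β => h3 x β N) hd ⟨hβ, hN⟩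
    · exact actsInLimit hL (h1 x) (h2 x) (h3 x) hd hβ hN
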